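/- **Setting.** Fix a real number $q>2$. *Data.* Let $\mathbf v\in\mathbb R^d\setminus\{0\}$ and $\sigma_\xi>0$. A data point $(\mathbf x,y)$ consists of a Rademacher label $y\in\{\pm1\}$ and an input $\mathbf x=(\mathbf x_1,\mathbf x_2)=(y\mathbf v,\boldsymbol\xi)$, where $\boldsymbol\xi\sim\mathcal N(0,\sigma_\xi^2(\mathbf I-\mathbf v\mathbf v^\top/\|\mathbf v\|_2^2))$ is independent of $y$. The training set $(\mathbf x_i,y_i)$, $i\in[n]$, is i.i.d., and $\boldsymbol\xi_i$ is the second patch of $\mathbf x_i$. Put $\mathrm{SNR}=\|\mathbf v\|_2/(\sigma_\xi\sqrt d)$. *Network and loss.* For $j\in\{\pm1\}$, $r\in[m]$ let $\mathbf w_{j,r}\in\mathbb R^d$ and, with $\sigma(z)=\max\{0,z\}^q$, let $F_j(\mathbf W_j,\mathbf x)=\frac1m\sum_{r=1}^m[\sigma(\langle\mathbf w_{j,r},\mathbf x_1\rangle)+\sigma(\langle\mathbf w_{j,r},\mathbf x_2\rangle)]$, $f=F_{+1}-F_{-1}$ and $L_D(\mathbf W)=\frac1n\sum_{i=1}^n\log(1+e^{-y_if(\mathbf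 W,\mathbf x_i)})$. *Noisy gradient descent.* The entries of all $\mathbf w^{(0)}_{j,r}$ are i.i.d. $\mathcal N(0,\sigma_0^2)$, and for $t\ge0$ $$\mathbf w^{(t+1)}_{j,r}=\mathbf w^{(t)}_{j,r}-\eta\bigl(\nabla_{\mathbf w_{j,r}}L_D(\mathbf W^{(t)})+\mathbf z_{t+1}\bigr),$$ where $\mathbf z_1,\mathbf z_2,\dots$ are i.i.d. $\mathcal N(0,\sigma_z^2\mathbf I_d)$ (the same $\mathbf z_{t+1}$ for all filters); training set, initialization and private noise are independent. The noise is that of the Gaussian mechanism for a privacy budget $(\varepsilon,\delta)$, $\varepsilon>0$, $0<\delta<1$, and a horizon of $T$ iterations: $$\sigma_z=\sqrt T\cdot\frac{\Delta\sqrt{2\ln(1.25/\delta)}}{\varepsilon},\qquad \Delta=\frac{S(\|\mathbf v\|_2+\sigma_\xi\sqrt d)}{nm}.$$ *Coefficients.* $\Gamma^{(t)}_{j,r}\ge0$ and $\Phi^{(t)}_{j,r,i}$ are the coefficients in $$\mathbf w^{(t)}_{j,r}=\mathbf w^{(0)}_{j,r}+j\,\Gamma^{(t)}_{j,r}\frac{\mathbf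 v}{\|\mathbf v\|_2^2}+\sum_{i=1}^n\Phi^{(t)}_{j,r,i}\frac{\boldsymbol\xi_i}{\|\boldsymbol\xi_i\|_2^2}-\eta\sum_{s=1}^t\mathbf z_s,$$ and $\bar\Phi^{(t)}_{j,r,i}=\Phi^{(t)}_{j,r,i}\mathbb 1(\Phi^{(t)}_{j,r,i}\ge0)$, $\underline\Phi^{(t)}_{j,r,i}=\Phi^{(t)}_{j,r,i}\mathbb 1(\Phi^{(t)}_{j,r,i}\le0)$. **Theorem.** For every $q>2$, $C_0\in\mathbb R$ and $K_0\in\mathbb N$ there are constants $C\ge1$, $K\in\mathbb N$, $C_1$, $C_2$ and $K_2\in\mathbb N$, depending only on $q,C_0,K_0$, such that the following holds for all $d,n,m\in\mathbb N$, $\mathbf v\in\mathbb R^d\setminus\{0\}$, $\sigma_\xi,\sigma_0,\eta,\varepsilon,S>0$, $\delta\in(0,1)$ and $T\in\mathbb N$. Write $L=C(1+\log d)^K$ and $L_0=C_0(1+\log d)^{K_0}$. Assume $S\le L_0$, $\ln(1.25/\delta)\le L_0$, $T\le L_0\,\dfrac{\sigma_0mn\varepsilon}{\eta(\|\mathbf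 v\|_2+\sigma_\xi\sqrt d)}$ and * $d\ge L\,m^{\max\{2,\,4/(q-2)\}}\,n^{\max\{4,\,(2q-2)/(q-2)\}}$, $n\ge L$ and $m\ge L$; * $\eta\le L^{-1}\min\{\|\mathbf v\|_2^{-2},(\sigma_\xi\sqrt d)^{-2}\}$; * $L\max\bigl\{\varepsilon^{-1/q}(\sigma_\xi\sqrt d)^{-1},\ \tfrac{n}{\sqrt d}\|\mathbf v\|_2^{-1},\ m^{1/q}\tfrac{n}{\sqrt d}(\sigma_\xi\sqrt d)^{-1}\bigr\}\le\sigma_0\le L^{-1}\min\bigl\{(n\varepsilon)^{-1/q}\|\mathbf v\|_2^{-1},\ (\sigma_\xi\sqrt d)^{-1}\bigr\}$; * $\min\{\mathrm{SNR}^{-1}\varepsilon,\ \mathrm{SNR}^{-q}n^{-1}\}\ge L$. Then there is $T_1\in\mathbb N$ with $$T_1\le C_1\,\frac{\log\bigl(1/(\sigma_0\sigma_\xi\sqrt d)\bigr)\,mn}{0.15^{q-2}\,\eta\,q\,\sigma_0^{q-2}(\sigma_\xi\sqrt d)^q}$$ such that, with probability at least $1-1/d$, the coefficients above exist and are unique,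 and * $\max_{j,r}\bar\Phi^{(T_1)}_{j,r,i}\ge2$ for all $i\in[n]$; * $\max_{j,r}\Gamma^{(t)}_{j,r}\le C_2(1+\log d)^{K_2}\,\sigma_0\|\mathbf v\|_2$ for all $0\le t\le T_1$; * $\max_{j,r,i}|\underline\Phi^{(t)}_{j,r,i}|\le C_2(1+\log d)^{K_2}\,\sigma_0\sigma_\xi\sqrt d$ for all $0\le t\le T_1$. -/

import Mathlib

open MeasureTheory ProbabilityTheory

noncomputable section

namespace NoisyCNN

/-- `ℝ^d` with the Euclidean norm. -/
abbrev Vec (d : ℕ) := EuclideanSpace ℝ (Fin d)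

/-- The sign in `{+1, -1}` encoded by a Boolean (`true` is `+1`). It is used for the labels `y` and
for the index `j` of the two groups of filters. -/
def sgn (b : Bool) : ℝ := if b then 1 else -1

/-! ### Probability distributions -/

/-- The centred isotropic Gaussian `N(0, s² I)` on `ℝ^d`. -/
def isoGaussian (d : ℕ) (s : ℝ) : Measure (Vec d) :=
  multivariateGaussian 0 (s ^ 2 • (1 : Matrix (Fin d) (Fin d) ℝ))

/-- The matrix `H = I - v vᵀ / ‖v‖²`. -/
def projMatrix {d : ℕ} (v : Vec d) : Matrix (Fin d) (Fin d) ℝ :=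
  1 - (‖v‖ ^ 2)⁻¹ • Matrix.vecMulVec (fun k => v k) (fun k => v k)

/-- The Rademacher distribution, on Boolean-encoded signs. -/
def labelLaw : Measure Bool := (PMF.uniformOfFintype Bool).toMeasure

/-- A data point `(x, y)`: the input `x = (x₁, x₂)` has two patches, `y` is the encoded label. -/
abbrev DataPoint (d : ℕ) := (Vec d × Vec d) × Bool

/-- The data distribution: `y` is Rademacher, `ξ ∼ N(0, σξ² H)` is independent of `y`, and
`x = (y • v, ξ)`. -/
def dataLaw {d : ℕ} (v : Vec d) (σξ : ℝ) : Measure (DataPoint d) :=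
  (labelLaw.prod (multivariateGaussian 0 (σξ ^ 2 • projMatrix v))).map
    (fun p : Bool × Vec d => ((sgn p.1 • v, p.2), p.1))

/-! ### The network, the training loss and noisy gradient descent -/

/-- The polynomial ReLU `σ(z) = max(0, z)^q`. -/
def act (q z : ℝ) : ℝ := (max 0 z) ^ q

/-- The weights: one filter `w_{j,r} ∈ ℝ^d` for each sign `j` and each `r`. -/
abbrev Weights (m d : ℕ) := Bool → Fin m → Vec d

/-- `F_j(W_j, x) = (1/m) ∑ᵣ [σ(⟨w_{j,r}, x₁⟩) + σ(⟨w_{j,r}, x₂⟩)]`. -/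
def subnet (q : ℝ) {m d : ℕ} (w : Fin m → Vec d) (x : Vec d × Vec d) : ℝ :=
  (1 / (m : ℝ)) * ∑ r : Fin m, (act q (inner ℝ (w r) x.1) + act q (inner ℝ (w r) x.2))

/-- The network `f(W, x) = F_{+1}(W_{+1}, x) - F_{-1}(W_{-1}, x)`. -/
def network (q : ℝ) {m d : ℕ} (W : Weights m d) (x : Vec d × Vec d) : ℝ :=
  subnet q (W true) x - subnet q (W false) x

/-- The logistic loss. -/
def logisticLoss (z : ℝ) : ℝ := Real.log (1 + Real.exp (-z))

/-- The empirical risk `L_D(W)` of the training set `D`. -/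
def empRisk (q : ℝ) {n m d : ℕ} (D : Fin n → DataPoint d) (W : Weights m d) : ℝ :=
  (1 / (n : ℝ)) * ∑ i : Fin n, logisticLoss (sgn (D i).2 * network q W (D i).1)

/-- The weights `W` with the single filter `w_{j,r}` replaced by `u`. -/
def setFilter {m d : ℕ} (W : Weights m d) (j : Bool) (r : Fin m) (u : Vec d) : Weights m d :=
  Function.update W j (Function.update (W j) r u)

/-- The partial gradient `∇_{w_{j,r}} L_D(W)`. -/
def gradFilter (q : ℝ) {n m d : ℕ} (D : Fin n → DataPoint d) (W : Weights m d)
    (j : Bool) (r : Fin m) : Vec d :=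
  gradient (fun u : Vec d => empRisk q D (setFilter W j r u)) (W j r)

/-- Noisy gradient descent
`w_{j,r}^{(t+1)} = w_{j,r}^{(t)} - η (∇_{w_{j,r}} L_D(W^{(t)}) + z_{t+1})`. -/
def noisyGD (q η : ℝ) {n m d : ℕ} (D : Fin n → DataPoint d) (W₀ : Weights m d)
    (z : ℕ → Vec d) : ℕ → Weights m d
  | 0 => W₀
  | t + 1 => fun j r =>
      noisyGD q η D W₀ z t j r - η • (gradFilter q D (noisyGD q η D W₀ z t) j r + z (t + 1))

/-- Everything that is random in a training run: the training set, the initial weights and the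
sequence of private noise vectors. -/
abbrev Run (n m d : ℕ) := (Fin n → DataPoint d) × (Weights m d × (ℕ → Vec d))

/-- The law of a training run: `n` i.i.d. samples, i.i.d. `N(0, σ0²)` initial weights and i.i.d.
private noise `z_t ∼ N(0, σz² I)`, all independent. -/
def runLaw (n m : ℕ) {d : ℕ} (v : Vec d) (σξ σ0 σz : ℝ) : Measure (Run n m d) :=
  (Measure.pi fun _ : Fin n => dataLaw v σξ).prod
    ((Measure.pi fun _ : Bool => Measure.pi fun _ : Fin m => isoGaussian d σ0).prod
      (Measure.infinitePi fun _ : ℕ => isoGaussian d σz))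

instance isProbabilityMeasure_isoGaussian (d : ℕ) (s : ℝ) :
    IsProbabilityMeasure (isoGaussian d s) := by
  unfold isoGaussian; infer_instance

instance isProbabilityMeasure_labelLaw : IsProbabilityMeasure labelLaw := by
  unfold labelLaw; infer_instance

instance isProbabilityMeasure_dataLaw {d : ℕ} (v : Vec d) (σξ : ℝ) :
    IsProbabilityMeasure (dataLaw v σξ) := by
  unfold dataLaw
  refine Measure.isProbabilityMeasure_map (Measurable.aemeasurable ?_)
  have h : Measurable (fun b : Bool => sgn b • v) := measurable_from_top
  exact ((h.comp measurable_fst).prodMk measurable_snd).prodMk measurable_fst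

instance isProbabilityMeasure_runLaw (n m : ℕ) {d : ℕ} (v : Vec d) (σξ σ0 σz : ℝ) :
    IsProbabilityMeasure (runLaw n m v σξ σ0 σz) := by
  unfold runLaw; infer_instance

/-! ### The scale of the private noise -/

/-- The noise scale of the Gaussian mechanism for `L₂`-sensitivity `Δ` and privacy parameters
`(ε, δ)`. -/
def gaussianMechanismScale (Δ ε δ : ℝ) : ℝ := Δ * √(2 * Real.log (1.25 / δ)) / ε

/-- The standard deviation `σ_z` of the private noise for a privacy budget `(ε, δ)` spread over `T`
iterations, when the gradient has `L₂`-sensitivity `S (‖v‖ + σξ √d) / (n m)`. -/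
def privateNoiseScale (S : ℝ) (T n m : ℕ) {d : ℕ} (v : Vec d) (σξ ε δ : ℝ) : ℝ :=
  √(T : ℝ) * gaussianMechanismScale (S * (‖v‖ + σξ * √(d : ℝ)) / ((n : ℝ) * m)) ε δ

/-! ### The signal-noise decomposition -/

/-- `Γ` and `Φ` are coefficients of the signal-noise decomposition of the iterates `w^{(t)}`:
`Γ ≥ 0` and `w_{j,r}^{(t)} = w_{j,r}^{(0)} + j Γ_{j,r}^{(t)} v / ‖v‖²
  + ∑ᵢ Φ_{j,r,i}^{(t)} ξᵢ / ‖ξᵢ‖² - η ∑_{s=1}^t z_s`. -/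
def IsDecomposition {n m d : ℕ} (v : Vec d) (ξ : Fin n → Vec d) (η : ℝ) (z : ℕ → Vec d)
    (w : ℕ → Weights m d) (Γ : ℕ → Bool → Fin m → ℝ) (Φ : ℕ → Bool → Fin m → Fin n → ℝ) : Prop :=
  ∀ t j r, 0 ≤ Γ t j r ∧
    w t j r = w 0 j r + (sgn j * Γ t j r) • ((‖v‖ ^ 2)⁻¹ • v)
      + ∑ i : Fin n, Φ t j r i • ((‖ξ i‖ ^ 2)⁻¹ • ξ i)
      - η • ∑ s ∈ Finset.Icc 1 t, z s

/-- `Γ` and `Φ` are the unique coefficients of the decomposition. -/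
def IsUniqueDecomposition {n m d : ℕ} (v : Vec d) (ξ : Fin n → Vec d) (η : ℝ) (z : ℕ → Vec d)
    (w : ℕ → Weights m d) (Γ : ℕ → Bool → Fin m → ℝ) (Φ : ℕ → Bool → Fin m → Fin n → ℝ) : Prop :=
  IsDecomposition v ξ η z w Γ Φ ∧
    ∀ Γ' Φ', IsDecomposition v ξ η z w Γ' Φ' → Γ' = Γ ∧ Φ' = Φ

/-- The positive part `φ 1(φ ≥ 0)` of a noise coefficient. -/
def posCoeff (φ : ℝ) : ℝ := if 0 ≤ φ then φ else 0

/-- The negative part `φ 1(φ ≤ 0)` of a noise coefficient. -/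
def negCoeff (φ : ℝ) : ℝ := if φ ≤ 0 then φ else 0

/-! ### The parameter regime -/

/-- The polylogarithmic factor `C (1 + log d)^K`. -/
def polylog (C : ℝ) (K d : ℕ) : ℝ := C * (1 + Real.log d) ^ K

/-- The signal-to-noise ratio `‖v‖ / (σξ √d)`. -/
def SNR {d : ℕ} (v : Vec d) (σξ : ℝ) : ℝ := ‖v‖ / (σξ * √(d : ℝ))

/-- The conditions of data noise memorization, with the polylogarithmic factor `L` in every
occurrence of `Õ` and `Ω̃`. -/
structure NoiseMemorizationCondition (L q : ℝ) (n m : ℕ) {d : ℕ} (v : Vec d)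
    (σξ σ0 η ε : ℝ) : Prop where
  dim_large : L * ((m : ℝ) ^ max 2 (4 / (q - 2)) * (n : ℝ) ^ max 4 ((2 * q - 2) / (q - 2))) ≤ d
  samples_large : L ≤ n
  width_large : L ≤ m
  stepsize_small : η ≤ min (‖v‖ ^ 2)⁻¹ ((σξ * √(d : ℝ)) ^ 2)⁻¹ / L
  init_lower : L * max (ε ^ (-(1 / q)) * (σξ * √(d : ℝ))⁻¹) ((n : ℝ) / √(d : ℝ) * ‖v‖⁻¹) ≤ σ0
  init_upper : σ0 ≤ min (((n : ℝ) * ε) ^ (-(1 / q)) * ‖v‖⁻¹) (σξ * √(d : ℝ))⁻¹ / L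
  /-- The initialization also dominates the correlations between different noise patches. This
  follows from the other bounds on `σ0`, `d` and the `SNR` if `m ≤ n` or `ε ≤ n^q m^(q-1)`. -/
  init_lower_width : L * ((m : ℝ) ^ (1 / q) * ((n : ℝ) / √(d : ℝ)) * (σξ * √(d : ℝ))⁻¹) ≤ σ0

end NoisyCNN

end

open NoisyCNN

/-!
The weights move only along `v`, along the noise patches `ξᵢ` and along the accumulated private
noise, so the accumulated gradient steps are coefficients of the decomposition
(`isDecomposition_coeff`); they are unique because `ξᵢ ⊥ v` and the Gram matrix of the patches is
strictly diagonally dominant (`isUniqueDecomposition_of_isDecomposition`). The proof separates a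
deterministic analysis of these coefficients from a concentration argument.

*Deterministic part.* On a typical run (`TypicalRun`), put `N = σξ √d`, `a = σ0 N`, `b = σ0 ‖v‖`.
Correlations of a filter with `ξᵢ` equal `⟨w⁽⁰⁾, ξᵢ⟩ + Φᵢ` up to `a / 4`
(`TypicalRun.abs_inner_noise_sub_le`). This rests on bounds that are propagated simultaneously
(`TypicalRun.coeffBounds`):

* `Γ` stays of order `b`, because `n` times the `q`-th power of the signal-to-noise ratio is small;
* a decreasing `Φ` stops as soon as it outweighs the initial correlation, as the ReLU then vanishes;
* an increasing `Φ` stays of order `m^{1/q}` up to logarithms: above that level the margin of its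
  sample is at least logarithmic in `d`, and the gradient is so small that the rest of the training
  adds only a bounded amount (`ScaleBounds.saturated_total`). This is what keeps the cross terms
  between different patches below `a`.

As long as no filter has memorized `ξᵢ`, the gradient weight of that sample is bounded below, and a
filter that starts with `⟨w⁽⁰⁾, ξᵢ⟩ ≥ a / 2` grows geometrically with the rate `growthRate`
(`TypicalRun.exists_two_le_noiseCoeff`). So `T₁` is `8 log (1 / a)` divided by this rate.

*Probabilistic part.* Linear functionals and norms of Gaussian vectors concentrate, which bounds the
probability of an atypical run by a union bound (`runLaw_not_typicalRun_le`). The private noise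
needs a maximal inequality (`privateNoise_exists_gt_le`, from Doob's inequality for an exponential
submartingale): `T₁` is inversely proportional to `η`, hence not polynomial in `d`, and a union
bound over the time steps would fail. That its size is negligible is a computation with the noise scale of
the Gaussian mechanism and the lower bound for `σ0` (`ScaleBounds.private_noise_le`).
-/

namespace NoisyCNN

/-- The derivative `q max(0, z)^(q - 1)` of the activation. -/
noncomputable def actDeriv (q z : ℝ) : ℝ := q * (max 0 z) ^ (q - 1)

/-- The weight `1 / (1 + e^{z})` of a sample with margin `z` in the gradient: it is `-ℓ'(z)` for the
logistic loss `ℓ`. -/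
noncomputable def gate (z : ℝ) : ℝ := 1 / (1 + Real.exp z)

/-! ### The gradient of the empirical risk -/

lemma gate_pos (z : ℝ) : 0 < gate z := by unfold gate; positivity

lemma gate_le_one (z : ℝ) : gate z ≤ 1 := by
  unfold gate
  rw [div_le_one (by positivity)]
  linarith [Real.exp_pos z]

lemma gate_anti {x y : ℝ} (h : x ≤ y) : gate y ≤ gate x := by
  unfold gate
  exact one_div_le_one_div_of_le (by positivity) (by linarith [Real.exp_le_exp.2 h])

lemma gate_le_exp_neg (z : ℝ) : gate z ≤ Real.exp (-z) := by
  unfold gate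
  rw [Real.exp_neg, ← one_div]
  exact one_div_le_one_div_of_le (Real.exp_pos z) (by linarith)

lemma act_nonneg (q z : ℝ) : 0 ≤ act q z := by unfold act; positivity

lemma act_mono {q : ℝ} (hq : 0 ≤ q) {x y : ℝ} (h : x ≤ y) : act q x ≤ act q y := by
  unfold act
  exact Real.rpow_le_rpow (le_max_left _ _) (max_le_max le_rfl h) hq

lemma actDeriv_nonneg {q : ℝ} (hq : 0 ≤ q) (z : ℝ) : 0 ≤ actDeriv q z := by
  unfold actDeriv; positivity

lemma actDeriv_mono {q : ℝ} (hq : 1 ≤ q) {x y : ℝ} (h : x ≤ y) : actDeriv q x ≤ actDeriv q y := by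
  unfold actDeriv
  have := Real.rpow_le_rpow (le_max_left 0 x) (max_le_max le_rfl h) (z := q - 1) (by linarith)
  gcongr

lemma actDeriv_of_nonneg {q z : ℝ} (hz : 0 ≤ z) : actDeriv q z = q * z ^ (q - 1) := by
  rw [actDeriv, max_eq_right hz]

lemma actDeriv_of_nonpos {q z : ℝ} (hq : 1 < q) (hz : z ≤ 0) : actDeriv q z = 0 := by
  rw [actDeriv, max_eq_left hz, Real.zero_rpow (by linarith), mul_zero]

lemma act_of_nonneg {q z : ℝ} (hz : 0 ≤ z) : act q z = z ^ q := by
  rw [act, max_eq_right hz]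

lemma hasDerivAt_act {q : ℝ} (hq : 1 < q) (z : ℝ) : HasDerivAt (act q) (actDeriv q z) z := by
  rcases lt_trichotomy z 0 with hz | rfl | hz
  · rw [actDeriv_of_nonpos hq hz.le]
    refine (hasDerivAt_const z (0 : ℝ)).congr_of_eventuallyEq ?_
    filter_upwards [eventually_lt_nhds hz] with x hx
    rw [act, max_eq_left hx.le, Real.zero_rpow (by linarith)]
  · have h := hasDerivAt_abs_rpow 0 hq
    rw [actDeriv_of_nonpos hq le_rfl]
    rw [hasDerivAt_iff_isLittleO] at h ⊢
    refine Asymptotics.IsBigO.trans_isLittleO (Asymptotics.IsBigO.of_bound 1 ?_) h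
    refine Filter.Eventually.of_forall fun x => ?_
    have hq0 : q ≠ 0 := by linarith
    simp only [act, max_self, Real.zero_rpow hq0, abs_zero, mul_zero, smul_zero, sub_zero, one_mul,
      Real.norm_eq_abs]
    rw [abs_of_nonneg (by positivity), abs_of_nonneg (by positivity)]
    exact Real.rpow_le_rpow (le_max_left _ _) (max_le (abs_nonneg x) (le_abs_self x)) (by linarith)
  · rw [actDeriv_of_nonneg hz.le]
    refine (Real.hasDerivAt_rpow_const (Or.inl hz.ne')).congr_of_eventuallyEq ?_
    filter_upwards [eventually_gt_nhds hz] with x hx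
    rw [act, max_eq_right hx.le]

lemma hasDerivAt_logisticLoss (z : ℝ) : HasDerivAt logisticLoss (-gate z) z := by
  have h1 : HasDerivAt (fun z : ℝ => 1 + Real.exp (-z)) (-Real.exp (-z)) z := by
    simpa using ((hasDerivAt_neg z).exp).const_add 1
  have h2 := h1.log (by positivity)
  refine h2.congr_deriv ?_
  rw [gate, Real.exp_neg]
  have := Real.exp_pos z
  field_simp
  ring

lemma sgn_mul_self (b : Bool) : sgn b * sgn b = 1 := by cases b <;> simp [sgn]

lemma network_setFilter (q : ℝ) {m d : ℕ} (W : Weights m d) (j : Bool) (r : Fin m) (u : Vec d)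
    (x : Vec d × Vec d) :
    network q (setFilter W j r u) x = network q W x + sgn j * (1 / (m : ℝ)) *
      ((act q (inner ℝ u x.1) + act q (inner ℝ u x.2))
        - (act q (inner ℝ (W j r) x.1) + act q (inner ℝ (W j r) x.2))) := by
  have key : ∀ w : Fin m → Vec d, subnet q (Function.update w r u) x = subnet q w x
      + (1 / (m : ℝ)) * ((act q (inner ℝ u x.1) + act q (inner ℝ u x.2))
        - (act q (inner ℝ (w r) x.1) + act q (inner ℝ (w r) x.2))) := by
    intro w
    unfold subnet
    rw [← mul_add]
    congr 1
    rw [← Finset.add_sum_erase _ _ (Finset.mem_univ r),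
      ← Finset.add_sum_erase _ (fun r => act q (inner ℝ (w r) x.1) + act q (inner ℝ (w r) x.2))
        (Finset.mem_univ r)]
    have : ∑ k ∈ Finset.univ.erase r, (act q (inner ℝ (Function.update w r u k) x.1)
          + act q (inner ℝ (Function.update w r u k) x.2))
        = ∑ k ∈ Finset.univ.erase r, (act q (inner ℝ (w k) x.1) + act q (inner ℝ (w k) x.2)) := by
      refine Finset.sum_congr rfl fun k hk => ?_
      rw [Function.update_of_ne (Finset.ne_of_mem_erase hk)]
    rw [this, Function.update_self]
    ring
  cases j <;> simp [network, setFilter, sgn, key] <;> ring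

lemma hasFDerivAt_act_inner {q : ℝ} (hq : 1 < q) {d : ℕ} (x u : Vec d) :
    HasFDerivAt (fun u : Vec d => act q (inner ℝ u x))
      (actDeriv q (inner ℝ u x) • innerSL ℝ x) u := by
  have h : HasFDerivAt (fun u : Vec d => inner ℝ u x) (innerSL ℝ x) u := by
    refine (innerSL ℝ x).hasFDerivAt.congr_of_eventuallyEq (Filter.Eventually.of_forall fun u => ?_)
    simp [real_inner_comm]
  exact (hasDerivAt_act hq _).comp_hasFDerivAt u h

/-- The partial gradient of the empirical risk. -/
lemma gradFilter_eq {q : ℝ} (hq : 1 < q) {n m d : ℕ} (D : Fin n → DataPoint d) (W : Weights m d)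
    (j : Bool) (r : Fin m) :
    gradFilter q D W j r = -∑ i, (1 / ((n : ℝ) * m) * (gate (sgn (D i).2 * network q W (D i).1) *
      (sgn (D i).2 * sgn j))) • (actDeriv q (inner ℝ (W j r) (D i).1.1) • (D i).1.1
        + actDeriv q (inner ℝ (W j r) (D i).1.2) • (D i).1.2) := by
  refine HasGradientAt.gradient ?_
  rw [hasGradientAt_iff_hasFDerivAt]
  have hnet : ∀ i, HasFDerivAt (fun u => sgn (D i).2 * network q (setFilter W j r u) (D i).1)
      (sgn (D i).2 • ((sgn j * (1 / (m : ℝ))) •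
        (actDeriv q (inner ℝ (W j r) (D i).1.1) • innerSL ℝ (D i).1.1
          + actDeriv q (inner ℝ (W j r) (D i).1.2) • innerSL ℝ (D i).1.2))) (W j r) := by
    intro i
    simp only [network_setFilter]
    refine HasFDerivAt.const_mul ?_ _
    refine HasFDerivAt.const_add _ (HasFDerivAt.const_mul ?_ _)
    exact ((hasFDerivAt_act_inner hq _ _).add (hasFDerivAt_act_inner hq _ _)).sub_const _
  have hself : setFilter W j r (W j r) = W := by
    unfold setFilter; simp
  have hloss := fun i => (hasDerivAt_logisticLoss
    (sgn (D i).2 * network q (setFilter W j r (W j r)) (D i).1)).comp_hasFDerivAt (W j r) (hnet i)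
  have hsum := (HasFDerivAt.fun_sum (u := Finset.univ) fun i _ => hloss i).const_mul (1 / (n : ℝ))
  refine hsum.congr_fderiv ?_
  ext u
  simp only [hself, smul_apply, sum_apply,
    add_apply, innerSL_apply_apply, smul_eq_mul, InnerProductSpace.toDual_apply_apply,
    inner_neg_left, sum_inner, inner_smul_left, inner_add_left, Finset.mul_sum,
    ← Finset.sum_neg_distrib]
  refine Finset.sum_congr rfl fun i _ => ?_
  simp only [conj_trivial, one_div, mul_inv]
  ring

/-! ### The coefficients of the signal-noise decomposition -/

/-- The margin `yᵢ f(W, xᵢ)` of the `i`-th sample. -/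
noncomputable def margin (q : ℝ) {n m d : ℕ} (D : Fin n → DataPoint d) (W : Weights m d)
    (i : Fin n) : ℝ :=
  sgn (D i).2 * network q W (D i).1

/-- The coefficient `Γ_{j,r}^{(t)}` of the signal direction along a trajectory `w`: the accumulated
gradient updates in the direction `j v`. -/
noncomputable def signalCoeff (q η : ℝ) {n m d : ℕ} (v : Vec d) (D : Fin n → DataPoint d)
    (w : ℕ → Weights m d) (t : ℕ) (j : Bool) (r : Fin m) : ℝ :=
  ∑ s ∈ Finset.range t, η / ((n : ℝ) * m) * ‖v‖ ^ 2 *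
    ∑ i, gate (margin q D (w s) i) * actDeriv q (inner ℝ (w s j r) (sgn (D i).2 • v))

/-- The coefficient `Φ_{j,r,i}^{(t)}` of the noise patch `ξᵢ` along a trajectory `w`. -/
noncomputable def noiseCoeff (q η : ℝ) {n m d : ℕ} (D : Fin n → DataPoint d)
    (w : ℕ → Weights m d) (t : ℕ) (j : Bool) (r : Fin m) (i : Fin n) : ℝ :=
  ∑ s ∈ Finset.range t, sgn (D i).2 * sgn j * (η / ((n : ℝ) * m) * ‖(D i).1.2‖ ^ 2 *
    (gate (margin q D (w s) i) * actDeriv q (inner ℝ (w s j r) (D i).1.2)))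

section Coefficients

variable {q η : ℝ} {n m d : ℕ} {v : Vec d} {D : Fin n → DataPoint d} {W₀ : Weights m d}
  {z : ℕ → Vec d}

lemma signalCoeff_succ (w : ℕ → Weights m d) (t : ℕ) (j : Bool) (r : Fin m) :
    signalCoeff q η v D w (t + 1) j r = signalCoeff q η v D w t j r + η / ((n : ℝ) * m) * ‖v‖ ^ 2 *
      ∑ i, gate (margin q D (w t) i) * actDeriv q (inner ℝ (w t j r) (sgn (D i).2 • v)) := by
  rw [signalCoeff, Finset.sum_range_succ, signalCoeff]

lemma noiseCoeff_succ (w : ℕ → Weights m d) (t : ℕ) (j : Bool) (r : Fin m) (i : Fin n) :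
    noiseCoeff q η D w (t + 1) j r i = noiseCoeff q η D w t j r i +
      sgn (D i).2 * sgn j * (η / ((n : ℝ) * m) * ‖(D i).1.2‖ ^ 2 *
        (gate (margin q D (w t) i) * actDeriv q (inner ℝ (w t j r) (D i).1.2))) := by
  rw [noiseCoeff, Finset.sum_range_succ, noiseCoeff]

/-- One step of noisy gradient descent adds multiples of `v` and of the noise patches, and subtracts
the private noise. -/
lemma noisyGD_succ (hq : 1 < q) (hlabel : ∀ i, (D i).1.1 = sgn (D i).2 • v) (t : ℕ) (j : Bool)
    (r : Fin m) :
    noisyGD q η D W₀ z (t + 1) j r = noisyGD q η D W₀ z t j r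
      + (sgn j * (η / ((n : ℝ) * m) * ∑ i, gate (margin q D (noisyGD q η D W₀ z t) i) *
          actDeriv q (inner ℝ (noisyGD q η D W₀ z t j r) (sgn (D i).2 • v)))) • v
      + ∑ i, (sgn (D i).2 * sgn j * (η / ((n : ℝ) * m) *
          (gate (margin q D (noisyGD q η D W₀ z t) i) *
            actDeriv q (inner ℝ (noisyGD q η D W₀ z t j r) (D i).1.2)))) • (D i).1.2
      - η • z (t + 1) := by
  set w := noisyGD q η D W₀ z t with hw
  have h0 : noisyGD q η D W₀ z (t + 1) j r = w j r - η • (gradFilter q D w j r + z (t + 1)) := rfl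
  rw [h0, gradFilter_eq hq]
  have h1 : ∀ i, (1 / ((n : ℝ) * m) * (gate (sgn (D i).2 * network q w (D i).1) *
      (sgn (D i).2 * sgn j))) • (actDeriv q (inner ℝ (w j r) (D i).1.1) • (D i).1.1
        + actDeriv q (inner ℝ (w j r) (D i).1.2) • (D i).1.2)
      = (sgn j * (1 / ((n : ℝ) * m) * (gate (margin q D w i) *
          actDeriv q (inner ℝ (w j r) (sgn (D i).2 • v))))) • v
        + (sgn (D i).2 * sgn j * (1 / ((n : ℝ) * m) * (gate (margin q D w i) *
            actDeriv q (inner ℝ (w j r) (D i).1.2)))) • (D i).1.2 := by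
    intro i
    rw [hlabel i, ← hlabel i, ← margin, smul_add, smul_smul, smul_smul]
    rw [hlabel i, smul_smul]
    congr 2
    · linear_combination (1 / ((n : ℝ) * m) * gate (margin q D w i) * sgn j *
        actDeriv q (inner ℝ (w j r) (sgn (D i).2 • v))) * sgn_mul_self (D i).2
    · ring
  simp only [h1, Finset.sum_add_distrib, ← Finset.sum_smul]
  rw [smul_add, smul_neg, smul_add, smul_smul, Finset.smul_sum]
  simp only [smul_smul]
  have h2 : η * ∑ i, sgn j * (1 / ((n : ℝ) * m) * (gate (margin q D w i) *
          actDeriv q (inner ℝ (w j r) (sgn (D i).2 • v))))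
      = sgn j * (η / ((n : ℝ) * m) * ∑ i, gate (margin q D w i) *
          actDeriv q (inner ℝ (w j r) (sgn (D i).2 • v))) := by
    simp only [Finset.mul_sum]
    exact Finset.sum_congr rfl fun i _ => by ring
  have h3 : ∀ i, η * (sgn (D i).2 * sgn j * (1 / ((n : ℝ) * m) * (gate (margin q D w i) *
            actDeriv q (inner ℝ (w j r) (D i).1.2))))
      = sgn (D i).2 * sgn j * (η / ((n : ℝ) * m) * (gate (margin q D w i) *
            actDeriv q (inner ℝ (w j r) (D i).1.2))) := fun i => by ring
  simp only [h2, h3]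
  abel

lemma signalCoeff_nonneg (hq : 0 ≤ q) (hη : 0 ≤ η) (w : ℕ → Weights m d) (t : ℕ) (j : Bool)
    (r : Fin m) : 0 ≤ signalCoeff q η v D w t j r := by
  refine Finset.sum_nonneg fun s _ => mul_nonneg (by positivity) (Finset.sum_nonneg fun i _ => ?_)
  exact mul_nonneg (gate_pos _).le (actDeriv_nonneg hq _)

/-- The accumulated updates are coefficients of the signal-noise decomposition. -/
lemma isDecomposition_coeff (hq : 1 < q) (hη : 0 ≤ η) (hv : v ≠ 0)
    (hξ : ∀ i, (D i).1.2 ≠ 0) (hlabel : ∀ i, (D i).1.1 = sgn (D i).2 • v) :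
    IsDecomposition v (fun i => (D i).1.2) η z (noisyGD q η D W₀ z)
      (signalCoeff q η v D (noisyGD q η D W₀ z)) (noiseCoeff q η D (noisyGD q η D W₀ z)) := by
  intro t j r
  refine ⟨signalCoeff_nonneg (by linarith) hη _ t j r, ?_⟩
  induction t with
  | zero => simp [signalCoeff, noiseCoeff]
  | succ t ih =>
    rw [noisyGD_succ hq hlabel, signalCoeff_succ, Finset.sum_Icc_succ_top (by omega)]
    simp only [noiseCoeff_succ]
    nth_rw 1 [ih]
    set w := noisyGD q η D W₀ z
    simp only [add_smul, mul_add, Finset.sum_add_distrib, smul_add]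
    have h1 : (sgn j * (η / ((n : ℝ) * m) * ‖v‖ ^ 2 * ∑ i, gate (margin q D (w t) i) *
          actDeriv q (inner ℝ (w t j r) (sgn (D i).2 • v)))) • (‖v‖ ^ 2)⁻¹ • v
        = (sgn j * (η / ((n : ℝ) * m) * ∑ i, gate (margin q D (w t) i) *
          actDeriv q (inner ℝ (w t j r) (sgn (D i).2 • v)))) • v := by
      rw [smul_smul]
      congr 1
      have : ‖v‖ ≠ 0 := norm_ne_zero_iff.2 hv
      field_simp
    have h2 : ∀ i, (sgn (D i).2 * sgn j * (η / ((n : ℝ) * m) * ‖(D i).1.2‖ ^ 2 *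
          (gate (margin q D (w t) i) * actDeriv q (inner ℝ (w t j r) (D i).1.2))))
            • (‖(D i).1.2‖ ^ 2)⁻¹ • (D i).1.2
        = (sgn (D i).2 * sgn j * (η / ((n : ℝ) * m) *
          (gate (margin q D (w t) i) * actDeriv q (inner ℝ (w t j r) (D i).1.2)))) • (D i).1.2 := by
      intro i
      rw [smul_smul]
      congr 1
      have : ‖(D i).1.2‖ ≠ 0 := norm_ne_zero_iff.2 (hξ i)
      field_simp
    simp only [h1, h2]
    abel

end Coefficients

/-- Vectors whose Gram matrix is strictly diagonally dominant, together with a nonzero vector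
orthogonal to all of them, determine the coefficients of a linear combination. -/
lemma coeff_eq_zero_of_gram {n d : ℕ} {v : Vec d} {ξ : Fin n → Vec d} {ρ : ℝ} (hv : v ≠ 0)
    (hξ : ∀ i, ξ i ≠ 0) (horth : ∀ i, inner ℝ (ξ i) v = 0) (hρ : 0 ≤ ρ)
    (hcorr : ∀ i k, i ≠ k → |inner ℝ (ξ i) (ξ k)| ≤ ρ * ‖ξ k‖ ^ 2) (hnρ : n * ρ < 1)
    (a : ℝ) (b : Fin n → ℝ) (h : a • v + ∑ i, b i • ξ i = 0) : a = 0 ∧ ∀ i, b i = 0 := by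
  constructor
  · have h1 := congrArg (fun x => inner ℝ x v) h
    simp only [inner_add_left, sum_inner, inner_smul_left, horth, inner_zero_left, mul_zero,
      Finset.sum_const_zero, add_zero, conj_trivial] at h1
    rcases mul_eq_zero.1 h1 with h2 | h2
    · exact h2
    · exact absurd (inner_self_eq_zero.1 h2) hv
  · set c : Fin n → ℝ := fun i => |b i| * ‖ξ i‖ ^ 2 with hc
    have hc0 : ∀ i, 0 ≤ c i := fun i => by positivity
    have hle : ∀ i, c i ≤ ρ * ∑ k, c k := by
      intro i
      have h1 := congrArg (fun x => inner ℝ x (ξ i)) h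
      have h0 : inner ℝ v (ξ i) = 0 := by rw [real_inner_comm]; exact horth i
      simp only [inner_add_left, sum_inner, inner_smul_left, h0, inner_zero_left, mul_zero,
        zero_add, conj_trivial] at h1
      rw [← Finset.add_sum_erase _ _ (Finset.mem_univ i), real_inner_self_eq_norm_sq] at h1
      have h2 : c i = |∑ k ∈ Finset.univ.erase i, b k * inner ℝ (ξ k) (ξ i)| := by
        rw [← abs_neg, show -(∑ k ∈ Finset.univ.erase i, b k * inner ℝ (ξ k) (ξ i))
          = b i * ‖ξ i‖ ^ 2 by linarith, abs_mul, abs_of_nonneg (sq_nonneg ‖ξ i‖)]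
      rw [h2, Finset.mul_sum]
      refine (Finset.abs_sum_le_sum_abs _ _).trans ?_
      refine (Finset.sum_le_sum (g := fun k => ρ * c k) fun k hk => ?_).trans
        (Finset.sum_le_sum_of_subset_of_nonneg (Finset.erase_subset _ _)
          fun k _ _ => mul_nonneg hρ (hc0 k))
      rw [abs_mul, real_inner_comm]
      have := hcorr i k (Finset.ne_of_mem_erase hk).symm
      calc |b k| * |inner ℝ (ξ i) (ξ k)| ≤ |b k| * (ρ * ‖ξ k‖ ^ 2) := by gcongr
        _ = ρ * c k := by rw [hc]; ring
    have hsum : ∑ k, c k ≤ n * ρ * ∑ k, c k := by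
      calc ∑ k, c k ≤ ∑ _k : Fin n, ρ * ∑ k, c k := Finset.sum_le_sum fun i _ => hle i
        _ = n * ρ * ∑ k, c k := by simp; ring
    have hS0 : 0 ≤ ∑ k, c k := Finset.sum_nonneg fun i _ => hc0 i
    have hS : ∑ k, c k = 0 := by nlinarith
    intro i
    have hi := (Finset.sum_eq_zero_iff_of_nonneg fun i _ => hc0 i).1 hS i (Finset.mem_univ i)
    rcases mul_eq_zero.1 hi with h1 | h1
    · exact abs_eq_zero.1 h1
    · exact absurd (norm_eq_zero.1 (pow_eq_zero_iff (by norm_num) |>.1 h1)) (hξ i)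

lemma isUniqueDecomposition_of_isDecomposition {n m d : ℕ} {v : Vec d} {ξ : Fin n → Vec d}
    {ρ η : ℝ} {z : ℕ → Vec d} {w : ℕ → Weights m d} {Γ : ℕ → Bool → Fin m → ℝ}
    {Φ : ℕ → Bool → Fin m → Fin n → ℝ} (hv : v ≠ 0)
    (hξ : ∀ i, ξ i ≠ 0) (horth : ∀ i, inner ℝ (ξ i) v = 0) (hρ : 0 ≤ ρ)
    (hcorr : ∀ i k, i ≠ k → |inner ℝ (ξ i) (ξ k)| ≤ ρ * ‖ξ k‖ ^ 2) (hnρ : n * ρ < 1)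
    (h : IsDecomposition v ξ η z w Γ Φ) : IsUniqueDecomposition v ξ η z w Γ Φ := by
  refine ⟨h, fun Γ' Φ' h' => ?_⟩
  have key : ∀ t j r, Γ' t j r = Γ t j r ∧ ∀ i, Φ' t j r i = Φ t j r i := by
    intro t j r
    have h1 := (h t j r).2
    have h2 := (h' t j r).2
    have h3 : ((sgn j * (Γ' t j r - Γ t j r)) * (‖v‖ ^ 2)⁻¹) • v
        + ∑ i, ((Φ' t j r i - Φ t j r i) * (‖ξ i‖ ^ 2)⁻¹) • ξ i = 0 := by
      simp only [← smul_smul, sub_smul, Finset.sum_sub_distrib, mul_sub]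
      rw [h1] at h2
      rw [← sub_eq_zero] at h2
      rw [← neg_eq_zero, ← h2]
      simp only [mul_smul]
      abel
    obtain ⟨h4, h5⟩ := coeff_eq_zero_of_gram hv hξ horth hρ hcorr hnρ _ _ h3
    have hvn : (‖v‖ ^ 2)⁻¹ ≠ 0 := by
      have : ‖v‖ ≠ 0 := norm_ne_zero_iff.2 hv
      positivity
    have hs : sgn j ≠ 0 := by cases j <;> simp [sgn]
    refine ⟨?_, fun i => ?_⟩
    · have := (mul_eq_zero.1 ((mul_eq_zero.1 h4).resolve_right hvn)).resolve_left hs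
      linarith
    · have hn : (‖ξ i‖ ^ 2)⁻¹ ≠ 0 := by
        have : ‖ξ i‖ ≠ 0 := norm_ne_zero_iff.2 (hξ i)
        positivity
      have := (mul_eq_zero.1 (h5 i)).resolve_right hn
      linarith
  refine ⟨?_, ?_⟩
  · funext t j r; exact (key t j r).1
  · funext t j r i; exact (key t j r).2 i

/-! ### Typical training runs -/

/-- The properties of a training run that drive noise memorization. Here `N` is the size of the
noise patches, `a` and `b` are the sizes of the initial correlations of a filter with the noise
patches and with the signal, `l` absorbs logarithmic factors, `ρ` bounds the relative correlation of
two noise patches and `T` is the horizon. -/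
structure TypicalRun {n m d : ℕ} (v : Vec d) (N a b l ρ η : ℝ) (T : ℕ) (ω : Run n m d) : Prop where
  label : ∀ i, (ω.1 i).1.1 = sgn (ω.1 i).2 • v
  orth : ∀ i, inner ℝ (ω.1 i).1.2 v = 0
  norm_lower : ∀ i, N ^ 2 / 4 ≤ ‖(ω.1 i).1.2‖ ^ 2
  norm_upper : ∀ i, ‖(ω.1 i).1.2‖ ^ 2 ≤ 2 * N ^ 2
  corr : ∀ i k, i ≠ k → |inner ℝ (ω.1 i).1.2 (ω.1 k).1.2| ≤ ρ * ‖(ω.1 k).1.2‖ ^ 2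
  init_signal : ∀ j r, |inner ℝ (ω.2.1 j r) v| ≤ l * b
  init_noise : ∀ j r i, |inner ℝ (ω.2.1 j r) (ω.1 i).1.2| ≤ l * a
  init_large : ∀ i, ∃ r, a / 2 ≤ inner ℝ (ω.2.1 (ω.1 i).2 r) (ω.1 i).1.2
  private_signal : ∀ t ≤ T, η * |∑ s ∈ Finset.Icc 1 t, inner ℝ (ω.2.2 s) v| ≤ b
  private_noise : ∀ t ≤ T, ∀ i,
    η * |∑ s ∈ Finset.Icc 1 t, inner ℝ (ω.2.2 s) (ω.1 i).1.2| ≤ a / 8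

/-- A bound for the growth of a signal coefficient in one step, where `V = ‖v‖`. -/
noncomputable def signalStep (q η V b l : ℝ) (m : ℕ) : ℝ :=
  η / m * (q * (3 * l * b) ^ (q - 1)) * V ^ 2

/-- A bound for the growth in one step of a noise coefficient that exceeds `M`: the sample is then
classified with a margin of almost `(M / 2) ^ q / m`, and its gradient is exponentially small. -/
noncomputable def saturatedStep (q η N M : ℝ) (n m : ℕ) : ℝ :=
  η / ((n : ℝ) * m) * (Real.exp (2 - (M / 2) ^ q / m) * (q * (4 * M) ^ (q - 1))) * (2 * N ^ 2)

/-- The exponential rate at which the largest noise coefficient of a sample grows from its initial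
size `a` to a constant. -/
noncomputable def growthRate (q η N a : ℝ) (n m : ℕ) : ℝ :=
  η / ((n : ℝ) * m) * (gate (1 + 3 ^ q) * q * (a / 4) ^ (q - 2)) * (N ^ 2 / 4)

/-- The numerical conditions under which every typical run memorizes the noise within `T` steps. The
noise coefficients stay below `3 M`. -/
structure Regime (q η N V a b l M ρ : ℝ) (n m T : ℕ) : Prop where
  hq : 2 < q
  hn : 0 < n
  hm : 0 < m
  hη : 0 < η
  hl : 1 ≤ l
  hN : 0 < N
  ha : 0 < a
  hb : 0 ≤ b
  hM : 1 ≤ M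
  hρ : 0 ≤ ρ
  signal_small : 3 * l * b ≤ 1
  noise_small : 4 * l * a ≤ 1
  /-- The cross terms between noise patches are small compared with the initialization. -/
  cross : n * ρ * (3 * M) ≤ a / 8
  /-- A decreasing noise coefficient overshoots by at most `l a`. -/
  neg_step : η / ((n : ℝ) * m) * (q * (2 * l * a) ^ (q - 1)) * (2 * N ^ 2) ≤ l * a
  signal_total : T * signalStep q η V b l m ≤ l * b
  /-- An increasing noise coefficient jumps above `M` by at most `M`. -/
  pos_step : η / ((n : ℝ) * m) * (q * (2 * M) ^ (q - 1)) * (2 * N ^ 2) ≤ M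
  pos_total : T * saturatedStep q η N M n m ≤ M
  rate_le_one : growthRate q η N a n m ≤ 1
  /-- The horizon suffices for geometric growth from `a / 4` to `3`. -/
  growth : 2 * Real.log (12 / a) ≤ T * growthRate q η N a n m

/-! ### Bounds for the network output -/

lemma subnet_le {q : ℝ} (hq : 0 ≤ q) {m d : ℕ} (hm : 0 < m) {w : Fin m → Vec d} {x : Vec d × Vec d}
    {A B : ℝ} (hA0 : 0 ≤ A) (hB0 : 0 ≤ B)
    (hA : ∀ r, inner ℝ (w r) x.1 ≤ A) (hB : ∀ r, inner ℝ (w r) x.2 ≤ B) :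
    subnet q w x ≤ A ^ q + B ^ q := by
  have hm' : (0 : ℝ) < m := by exact_mod_cast hm
  have h : ∑ r : Fin m, (act q (inner ℝ (w r) x.1) + act q (inner ℝ (w r) x.2))
      ≤ ∑ _r : Fin m, (A ^ q + B ^ q) := by
    refine Finset.sum_le_sum fun r _ => add_le_add ?_ ?_
    · rw [← act_of_nonneg hA0]; exact act_mono hq (hA r)
    · rw [← act_of_nonneg hB0]; exact act_mono hq (hB r)
  simp only [Finset.sum_const, Finset.card_univ, Fintype.card_fin, nsmul_eq_mul] at h
  rw [subnet, one_div, inv_mul_le_iff₀ hm']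
  exact h

lemma subnet_nonneg (q : ℝ) {m d : ℕ} (w : Fin m → Vec d) (x : Vec d × Vec d) :
    0 ≤ subnet q w x :=
  mul_nonneg (by positivity) (Finset.sum_nonneg fun _ _ => add_nonneg (act_nonneg _ _)
    (act_nonneg _ _))

lemma le_subnet {q : ℝ} (hq : 0 ≤ q) {m d : ℕ} {w : Fin m → Vec d} {x : Vec d × Vec d}
    {B : ℝ} (hB0 : 0 ≤ B) (r : Fin m) (hB : B ≤ inner ℝ (w r) x.2) :
    B ^ q / m ≤ subnet q w x := by
  have h : B ^ q ≤ ∑ r : Fin m, (act q (inner ℝ (w r) x.1) + act q (inner ℝ (w r) x.2)) := by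
    refine le_trans ?_ (Finset.single_le_sum (fun r _ => add_nonneg (act_nonneg _ _)
      (act_nonneg _ _)) (Finset.mem_univ r))
    rw [← act_of_nonneg hB0]
    exact (act_mono hq hB).trans (le_add_of_nonneg_left (act_nonneg _ _))
  rw [subnet, div_eq_mul_one_div, mul_comm]
  gcongr

lemma margin_eq (q : ℝ) {n m d : ℕ} (D : Fin n → DataPoint d) (W : Weights m d) (i : Fin n) :
    margin q D W i = subnet q (W (D i).2) (D i).1 - subnet q (W (!(D i).2)) (D i).1 := by
  unfold margin network
  cases (D i).2 <;> simp [sgn]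

lemma sgn_mul_sgn_of_ne {x y : Bool} (h : x ≠ y) : sgn x * sgn y = -1 := by
  cases x <;> cases y <;> simp_all [sgn]

/-! ### The dynamics of the coefficients -/

/-- The absolute change of the coefficient `Φ_{j,r,i}` in the step from `t` to `t + 1`. -/
noncomputable def noiseStep (q η : ℝ) {n m d : ℕ} (D : Fin n → DataPoint d)
    (w : ℕ → Weights m d) (t : ℕ) (j : Bool) (r : Fin m) (i : Fin n) : ℝ :=
  η / ((n : ℝ) * m) * ‖(D i).1.2‖ ^ 2 *
    (gate (margin q D (w t) i) * actDeriv q (inner ℝ (w t j r) (D i).1.2))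

section Dynamics

variable {q η N a b l M ρ : ℝ} {n m d T : ℕ} {v : Vec d} {ω : Run n m d}

-- The trajectory of the run `ω`, its coefficients, and the changes of its noise coefficients.
local notation "traj" => noisyGD q η (Prod.fst ω) (Prod.fst (Prod.snd ω)) (Prod.snd (Prod.snd ω))
local notation "Γc" => signalCoeff q η v (Prod.fst ω) traj
local notation "Φc" => noiseCoeff q η (Prod.fst ω) traj
local notation "Δc" => noiseStep q η (Prod.fst ω) traj

lemma noiseStep_nonneg (hq : 0 ≤ q) (hη : 0 ≤ η) (t : ℕ) (j : Bool) (r : Fin m) (i : Fin n) :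
    0 ≤ Δc t j r i :=
  mul_nonneg (by positivity) (mul_nonneg (gate_pos _).le (actDeriv_nonneg hq _))

lemma noiseCoeff_succ_of_eq {t : ℕ} {j : Bool} {r : Fin m} {i : Fin n} (h : (ω.1 i).2 = j) :
    Φc (t + 1) j r i = Φc t j r i + Δc t j r i := by
  rw [noiseCoeff_succ, h, sgn_mul_self, one_mul, noiseStep]

lemma noiseCoeff_succ_of_ne {t : ℕ} {j : Bool} {r : Fin m} {i : Fin n} (h : (ω.1 i).2 ≠ j) :
    Φc (t + 1) j r i = Φc t j r i - Δc t j r i := by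
  rw [noiseCoeff_succ, sgn_mul_sgn_of_ne h, noiseStep]; ring

lemma noiseCoeff_monotone (hq : 0 ≤ q) (hη : 0 ≤ η) {j : Bool} (r : Fin m) {i : Fin n}
    (h : (ω.1 i).2 = j) : Monotone fun t => Φc t j r i :=
  monotone_nat_of_le_succ fun t => by
    rw [noiseCoeff_succ_of_eq h]
    linarith [noiseStep_nonneg (ω := ω) hq hη t j r i]

lemma noiseCoeff_nonneg (hq : 0 ≤ q) (hη : 0 ≤ η) {j : Bool} (t : ℕ) (r : Fin m) {i : Fin n}
    (h : (ω.1 i).2 = j) : 0 ≤ Φc t j r i := by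
  have := noiseCoeff_monotone hq hη r h (Nat.zero_le t)
  simpa [noiseCoeff] using this

lemma noiseCoeff_nonpos (hq : 0 ≤ q) (hη : 0 ≤ η) {j : Bool} (t : ℕ) (r : Fin m) {i : Fin n}
    (h : (ω.1 i).2 ≠ j) : Φc t j r i ≤ 0 := by
  have : Antitone fun t => Φc t j r i := antitone_nat_of_succ_le fun t => by
    rw [noiseCoeff_succ_of_ne h]
    linarith [noiseStep_nonneg (ω := ω) hq hη t j r i]
  simpa [noiseCoeff] using this (Nat.zero_le t)

lemma TypicalRun.noise_ne_zero (hω : TypicalRun v N a b l ρ η T ω) (hN : 0 < N) (i : Fin n) :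
    (ω.1 i).1.2 ≠ 0 := by
  intro h
  have := hω.norm_lower i
  rw [h, norm_zero] at this
  have : 0 < N ^ 2 := by positivity
  linarith

lemma TypicalRun.isDecomposition {V : ℝ} (hω : TypicalRun v N a b l ρ η T ω)
    (hR : Regime q η N V a b l M ρ n m T) (hv : v ≠ 0) :
    IsDecomposition v (fun i => (ω.1 i).1.2) η ω.2.2 traj Γc Φc :=
  isDecomposition_coeff (by linarith [hR.hq]) hR.hη.le hv (hω.noise_ne_zero hR.hN) hω.label

lemma TypicalRun.abs_inner_signal_le {V : ℝ} (hω : TypicalRun v N a b l ρ η T ω)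
    (hR : Regime q η N V a b l M ρ n m T) (hv : v ≠ 0) {t : ℕ} (ht : t ≤ T) (j : Bool) (r : Fin m)
    (hΓ : Γc t j r ≤ l * b) (y : Bool) : |inner ℝ (traj t j r) (sgn y • v)| ≤ 3 * l * b := by
  obtain ⟨h0, h⟩ := hω.isDecomposition hR hv t j r
  have hvn : ‖v‖ ≠ 0 := norm_ne_zero_iff.2 hv
  have h1 : inner ℝ (traj t j r) v = inner ℝ (ω.2.1 j r) v + sgn j * Γc t j r
      - η * ∑ s ∈ Finset.Icc 1 t, inner ℝ (ω.2.2 s) v := by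
    rw [h]
    simp only [inner_sub_left, inner_add_left, sum_inner, inner_smul_left, hω.orth, conj_trivial,
      mul_zero, Finset.sum_const_zero, add_zero, real_inner_self_eq_norm_sq]
    rw [inv_mul_cancel₀ (by positivity), mul_one]
    rfl
  have hs : ∀ y : Bool, |sgn y| = 1 := by intro y; cases y <;> simp [sgn]
  rw [inner_smul_right, abs_mul, hs, one_mul, h1]
  have h2 : |sgn j * Γc t j r| ≤ l * b := by rwa [abs_mul, hs, one_mul, abs_of_nonneg h0]
  have h3 := hω.init_signal j r
  have h4 : |η * ∑ s ∈ Finset.Icc 1 t, inner ℝ (ω.2.2 s) v| ≤ b := by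
    rw [abs_mul, abs_of_pos hR.hη]
    exact hω.private_signal t ht
  have h5 : b ≤ l * b := le_mul_of_one_le_left hR.hb hR.hl
  have h6 := abs_sub (inner ℝ (ω.2.1 j r) v + sgn j * Γc t j r)
    (η * ∑ s ∈ Finset.Icc 1 t, inner ℝ (ω.2.2 s) v)
  have h7 := abs_add_le (inner ℝ (ω.2.1 j r) v) (sgn j * Γc t j r)
  linarith

/-- The correlation of a filter with a noise patch is its initial value plus the noise coefficient,
up to an error that is small compared with the initialization. -/
lemma TypicalRun.abs_inner_noise_sub_le {V : ℝ} (hω : TypicalRun v N a b l ρ η T ω)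
    (hR : Regime q η N V a b l M ρ n m T) (hv : v ≠ 0) {t : ℕ} (ht : t ≤ T) (j : Bool) (r : Fin m)
    (hΦ : ∀ k, |Φc t j r k| ≤ 3 * M) (i : Fin n) :
    |inner ℝ (traj t j r) (ω.1 i).1.2 - inner ℝ (ω.2.1 j r) (ω.1 i).1.2 - Φc t j r i| ≤ a / 4 := by
  obtain ⟨-, h⟩ := hω.isDecomposition hR hv t j r
  have hne : ∀ k, (‖(ω.1 k).1.2‖ ^ 2) ≠ 0 := fun k => by
    have := norm_ne_zero_iff.2 (hω.noise_ne_zero hR.hN k)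
    positivity
  have h0 : inner ℝ v (ω.1 i).1.2 = 0 := by rw [real_inner_comm]; exact hω.orth i
  have h1 : inner ℝ (traj t j r) (ω.1 i).1.2 - inner ℝ (ω.2.1 j r) (ω.1 i).1.2 - Φc t j r i
      = ∑ k ∈ Finset.univ.erase i, Φc t j r k * ((‖(ω.1 k).1.2‖ ^ 2)⁻¹ *
          inner ℝ (ω.1 k).1.2 (ω.1 i).1.2)
        - η * ∑ s ∈ Finset.Icc 1 t, inner ℝ (ω.2.2 s) (ω.1 i).1.2 := by
    rw [h]
    simp only [inner_sub_left, inner_add_left, sum_inner, inner_smul_left, conj_trivial, h0,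
      mul_zero, add_zero]
    rw [← Finset.add_sum_erase _ _ (Finset.mem_univ i), real_inner_self_eq_norm_sq,
      inv_mul_cancel₀ (hne i)]
    change inner ℝ (ω.2.1 j r) (ω.1 i).1.2 + _ - _ - inner ℝ (ω.2.1 j r) (ω.1 i).1.2 - _ = _
    ring
  rw [h1]
  have h2 : |∑ k ∈ Finset.univ.erase i, Φc t j r k * ((‖(ω.1 k).1.2‖ ^ 2)⁻¹ *
          inner ℝ (ω.1 k).1.2 (ω.1 i).1.2)| ≤ a / 8 := by
    refine (Finset.abs_sum_le_sum_abs _ _).trans (le_trans ?_ hR.cross)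
    calc ∑ k ∈ Finset.univ.erase i, |Φc t j r k * ((‖(ω.1 k).1.2‖ ^ 2)⁻¹ *
          inner ℝ (ω.1 k).1.2 (ω.1 i).1.2)|
        ≤ ∑ k ∈ Finset.univ.erase i, 3 * M * ρ := by
          refine Finset.sum_le_sum fun k hk => ?_
          have hc := hω.corr i k (Finset.ne_of_mem_erase hk).symm
          have hpos : 0 < ‖(ω.1 k).1.2‖ ^ 2 := lt_of_le_of_ne (sq_nonneg _) (hne k).symm
          rw [abs_mul, abs_mul, abs_inv, abs_of_pos hpos, real_inner_comm]
          refine mul_le_mul (hΦ k) ?_ (by positivity) (by linarith [hR.hM])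
          rw [inv_mul_le_iff₀ hpos, mul_comm]
          exact hc
      _ ≤ ∑ k : Fin n, 3 * M * ρ := Finset.sum_le_sum_of_subset_of_nonneg (Finset.erase_subset _ _)
          fun _ _ _ => mul_nonneg (by linarith [hR.hM]) hR.hρ
      _ = n * ρ * (3 * M) := by simp; ring
  have h4 : |η * ∑ s ∈ Finset.Icc 1 t, inner ℝ (ω.2.2 s) (ω.1 i).1.2| ≤ a / 8 := by
    rw [abs_mul, abs_of_pos hR.hη]
    exact hω.private_noise t ht i
  have h6 := abs_sub (∑ k ∈ Finset.univ.erase i, Φc t j r k * ((‖(ω.1 k).1.2‖ ^ 2)⁻¹ *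
          inner ℝ (ω.1 k).1.2 (ω.1 i).1.2)) (η * ∑ s ∈ Finset.Icc 1 t, inner ℝ (ω.2.2 s) (ω.1 i).1.2)
  linarith

/-- The bounds for the coefficients at time `t` that are propagated along the trajectory. The bound
for the growing noise coefficients allows one jump above `M`, followed by saturated steps. -/
structure CoeffBounds (q η N M l a b V : ℝ) {n m d : ℕ} (v : Vec d) (ω : Run n m d) (t : ℕ) :
    Prop where
  signal : ∀ j r, signalCoeff q η v ω.1 (noisyGD q η ω.1 ω.2.1 ω.2.2) t j r
    ≤ t * signalStep q η V b l m
  pos : ∀ j r i, (ω.1 i).2 = j → noiseCoeff q η ω.1 (noisyGD q η ω.1 ω.2.1 ω.2.2) t j r i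
    ≤ 2 * M + t * saturatedStep q η N M n m
  neg : ∀ j r i, (ω.1 i).2 ≠ j →
    -(3 * l * a) ≤ noiseCoeff q η ω.1 (noisyGD q η ω.1 ω.2.1 ω.2.2) t j r i

section Consequences

variable {V : ℝ} {t : ℕ}

lemma signalStep_nonneg (hR : Regime q η N V a b l M ρ n m T) :
    0 ≤ signalStep q η V b l m := by
  have := hR.hq; have := hR.hη; have := hR.hb; have := hR.hl
  unfold signalStep; positivity

lemma saturatedStep_nonneg (hR : Regime q η N V a b l M ρ n m T) :
    0 ≤ saturatedStep q η N M n m := by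
  have := hR.hq; have := hR.hη; have := hR.hM
  unfold saturatedStep; positivity

lemma CoeffBounds.signal_le (h : CoeffBounds q η N M l a b V v ω t)
    (hR : Regime q η N V a b l M ρ n m T) (ht : t ≤ T) (j : Bool) (r : Fin m) :
    Γc t j r ≤ l * b := by
  refine (h.signal j r).trans (le_trans ?_ hR.signal_total)
  have : (t : ℝ) ≤ T := by exact_mod_cast ht
  exact mul_le_mul_of_nonneg_right this (signalStep_nonneg hR)

lemma CoeffBounds.abs_noise_le (h : CoeffBounds q η N M l a b V v ω t)
    (hR : Regime q η N V a b l M ρ n m T) (ht : t ≤ T) (j : Bool) (r : Fin m) (i : Fin n) :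
    |Φc t j r i| ≤ 3 * M := by
  have hq := hR.hq
  by_cases hi : (ω.1 i).2 = j
  · rw [abs_of_nonneg (noiseCoeff_nonneg (by linarith) hR.hη.le t r hi)]
    have h1 := h.pos j r i hi
    have : (t : ℝ) ≤ T := by exact_mod_cast ht
    have h2 := mul_le_mul_of_nonneg_right this (saturatedStep_nonneg hR)
    linarith [hR.pos_total]
  · rw [abs_of_nonpos (noiseCoeff_nonpos (by linarith) hR.hη.le t r hi)]
    have h1 := h.neg j r i hi
    linarith [hR.noise_small, hR.hM]

lemma CoeffBounds.abs_inner_noise_sub_le (h : CoeffBounds q η N M l a b V v ω t)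
    (hω : TypicalRun v N a b l ρ η T ω) (hR : Regime q η N V a b l M ρ n m T) (hv : v ≠ 0)
    (ht : t ≤ T) (j : Bool) (r : Fin m) (i : Fin n) :
    |inner ℝ (traj t j r) (ω.1 i).1.2 - inner ℝ (ω.2.1 j r) (ω.1 i).1.2 - Φc t j r i| ≤ a / 4 :=
  hω.abs_inner_noise_sub_le hR hv ht j r (h.abs_noise_le hR ht j r) i

lemma CoeffBounds.abs_inner_noise_sub_coeff_le (h : CoeffBounds q η N M l a b V v ω t)
    (hω : TypicalRun v N a b l ρ η T ω) (hR : Regime q η N V a b l M ρ n m T) (hv : v ≠ 0)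
    (ht : t ≤ T) (j : Bool) (r : Fin m) (i : Fin n) :
    |inner ℝ (traj t j r) (ω.1 i).1.2 - Φc t j r i| ≤ l * a + a / 4 := by
  have h1 := h.abs_inner_noise_sub_le hω hR hv ht j r i
  have h2 := hω.init_noise j r i
  rw [abs_le] at *
  constructor <;> linarith

lemma CoeffBounds.inner_signal_le_one (h : CoeffBounds q η N M l a b V v ω t)
    (hω : TypicalRun v N a b l ρ η T ω) (hR : Regime q η N V a b l M ρ n m T) (hv : v ≠ 0)
    (ht : t ≤ T) (j : Bool) (r : Fin m) (i : Fin n) :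
    inner ℝ (traj t j r) (ω.1 i).1.1 ≤ 1 := by
  rw [hω.label i]
  exact (le_abs_self _).trans ((hω.abs_inner_signal_le hR hv ht j r (h.signal_le hR ht j r) _).trans
    hR.signal_small)

/-- The change of a noise coefficient in one step, when the gradient weight of the sample is at most
`g` and the correlation of the filter with the patch is at most `B`. -/
lemma TypicalRun.noiseStep_le (hω : TypicalRun v N a b l ρ η T ω)
    (hR : Regime q η N V a b l M ρ n m T) {j : Bool} {r : Fin m} {i : Fin n} {g B : ℝ}
    (hg : gate (margin q ω.1 (traj t) i) ≤ g) (hB0 : 0 ≤ B)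
    (hB : inner ℝ (traj t j r) (ω.1 i).1.2 ≤ B) :
    Δc t j r i ≤ η / ((n : ℝ) * m) * (g * (q * B ^ (q - 1))) * (2 * N ^ 2) := by
  have hq := hR.hq
  have hη := hR.hη
  have h1 : actDeriv q (inner ℝ (traj t j r) (ω.1 i).1.2) ≤ q * B ^ (q - 1) := by
    rw [← actDeriv_of_nonneg hB0]
    exact actDeriv_mono (by linarith) hB
  have h2 := hω.norm_upper i
  have h3 := gate_pos (margin q ω.1 (traj t) i)
  have h4 := actDeriv_nonneg (q := q) (by linarith) (inner ℝ (traj t j r) (ω.1 i).1.2)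
  have h5 : gate (margin q ω.1 (traj t) i) * actDeriv q (inner ℝ (traj t j r) (ω.1 i).1.2)
      ≤ g * (q * B ^ (q - 1)) := mul_le_mul hg h1 h4 (h3.le.trans hg)
  have h6 : 0 ≤ g * (q * B ^ (q - 1)) := (mul_nonneg h3.le h4).trans h5
  calc Δc t j r i ≤ η / ((n : ℝ) * m) * (2 * N ^ 2) * (g * (q * B ^ (q - 1))) := by
        show η / ((n : ℝ) * m) * ‖(ω.1 i).1.2‖ ^ 2 *
          (gate (margin q ω.1 (traj t) i) * actDeriv q (inner ℝ (traj t j r) (ω.1 i).1.2)) ≤ _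
        gcongr
    _ = _ := by ring

lemma CoeffBounds.signal_succ (h : CoeffBounds q η N M l a b ‖v‖ v ω t)
    (hω : TypicalRun v N a b l ρ η T ω) (hR : Regime q η N ‖v‖ a b l M ρ n m T) (hv : v ≠ 0)
    (ht : t ≤ T) (j : Bool) (r : Fin m) :
    Γc (t + 1) j r ≤ (t + 1 : ℕ) * signalStep q η ‖v‖ b l m := by
  have hq := hR.hq; have hη := hR.hη; have hb := hR.hb; have hl := hR.hl
  have hn : (0 : ℝ) < n := by exact_mod_cast hR.hn
  have hm : (0 : ℝ) < m := by exact_mod_cast hR.hm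
  rw [signalCoeff_succ]
  have h1 : ∑ i, gate (margin q ω.1 (traj t) i) * actDeriv q (inner ℝ (traj t j r) (sgn (ω.1 i).2 • v))
      ≤ ∑ _i : Fin n, q * (3 * l * b) ^ (q - 1) := by
    refine Finset.sum_le_sum fun i _ => ?_
    have h2 := hω.abs_inner_signal_le hR hv ht j r (h.signal_le hR ht j r) (ω.1 i).2
    rw [← actDeriv_of_nonneg (by positivity)]
    refine (mul_le_of_le_one_left (actDeriv_nonneg (by linarith) _) (gate_le_one _)).trans ?_
    exact actDeriv_mono (by linarith) ((le_abs_self _).trans h2)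
  simp only [Finset.sum_const, Finset.card_univ, Fintype.card_fin, nsmul_eq_mul] at h1
  have h3 : η / ((n : ℝ) * m) * ‖v‖ ^ 2 *
      (∑ i, gate (margin q ω.1 (traj t) i) * actDeriv q (inner ℝ (traj t j r) (sgn (ω.1 i).2 • v)))
      ≤ signalStep q η ‖v‖ b l m := by
    refine (mul_le_mul_of_nonneg_left h1 (by positivity)).trans (le_of_eq ?_)
    unfold signalStep
    field_simp
  have := h.signal j r
  push_cast
  linarith

lemma CoeffBounds.neg_succ (h : CoeffBounds q η N M l a b V v ω t)
    (hω : TypicalRun v N a b l ρ η T ω) (hR : Regime q η N V a b l M ρ n m T) (hv : v ≠ 0)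
    (ht : t ≤ T) (j : Bool) (r : Fin m) (i : Fin n) (hi : (ω.1 i).2 ≠ j) :
    -(3 * l * a) ≤ Φc (t + 1) j r i := by
  have hq := hR.hq; have hη := hR.hη; have ha := hR.ha; have hl := hR.hl
  have hla : a ≤ l * a := le_mul_of_one_le_left ha.le hl
  rw [noiseCoeff_succ_of_ne hi]
  have h0 := noiseCoeff_nonpos (q := q) (by linarith) hη.le t r hi
  have h1 := (abs_le.1 (h.abs_inner_noise_sub_coeff_le hω hR hv ht j r i)).2
  by_cases hc : -(2 * l * a) ≤ Φc t j r i
  · have h2 : inner ℝ (traj t j r) (ω.1 i).1.2 ≤ 2 * l * a := by linarith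
    have h3 := hω.noiseStep_le hR (gate_le_one _) (by positivity) h2
    rw [one_mul] at h3
    have h4 := hR.neg_step
    linarith
  · have h2 : inner ℝ (traj t j r) (ω.1 i).1.2 ≤ 0 := by linarith
    have h3 := h.neg j r i hi
    rw [noiseStep, actDeriv_of_nonpos (show 1 < q by linarith) h2, mul_zero, mul_zero, sub_zero]
    exact h3

/-- A filter whose noise coefficient exceeds `M` makes the gradient of that sample small. -/
lemma CoeffBounds.gate_le (h : CoeffBounds q η N M l a b V v ω t)
    (hω : TypicalRun v N a b l ρ η T ω) (hR : Regime q η N V a b l M ρ n m T) (hv : v ≠ 0)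
    (ht : t ≤ T) (r : Fin m) (i : Fin n) (hc : M < Φc t (ω.1 i).2 r i) :
    gate (margin q ω.1 (traj t) i) ≤ Real.exp (2 - (M / 2) ^ q / m) := by
  have hq := hR.hq; have ha := hR.ha; have hl := hR.hl; have hM := hR.hM
  have hla : a ≤ l * a := le_mul_of_one_le_left ha.le hl
  have hsm := hR.noise_small
  have h1 := (abs_le.1 (h.abs_inner_noise_sub_coeff_le hω hR hv ht (ω.1 i).2 r i)).1
  have h2 : (M / 2) ^ q / m ≤ subnet q (traj t (ω.1 i).2) (ω.1 i).1 :=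
    le_subnet (by linarith) (by linarith) r (by linarith)
  have h3 : subnet q (traj t (!(ω.1 i).2)) (ω.1 i).1 ≤ 1 ^ q + 1 ^ q := by
    refine subnet_le (by linarith) hR.hm zero_le_one zero_le_one
      (fun r => h.inner_signal_le_one hω hR hv ht _ r i) fun r => ?_
    have h4 := (abs_le.1 (h.abs_inner_noise_sub_coeff_le hω hR hv ht (!(ω.1 i).2) r i)).2
    have h5 := noiseCoeff_nonpos (q := q) (ω := ω) (i := i) (j := !(ω.1 i).2) (by linarith) hR.hη.le
      t r (by simp)
    linarith
  rw [Real.one_rpow] at h3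
  refine (gate_le_exp_neg _).trans (Real.exp_le_exp.2 ?_)
  rw [margin_eq]
  linarith

lemma CoeffBounds.pos_succ (h : CoeffBounds q η N M l a b V v ω t)
    (hω : TypicalRun v N a b l ρ η T ω) (hR : Regime q η N V a b l M ρ n m T) (hv : v ≠ 0)
    (ht : t ≤ T) (j : Bool) (r : Fin m) (i : Fin n) (hi : (ω.1 i).2 = j) :
    Φc (t + 1) j r i ≤ 2 * M + (t + 1 : ℕ) * saturatedStep q η N M n m := by
  have hq := hR.hq; have hη := hR.hη; have ha := hR.ha; have hl := hR.hl; have hM := hR.hM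
  have hla : a ≤ l * a := le_mul_of_one_le_left ha.le hl
  have hsm := hR.noise_small
  rw [noiseCoeff_succ_of_eq hi]
  have h1 := (abs_le.1 (h.abs_inner_noise_sub_coeff_le hω hR hv ht j r i)).2
  have hs := saturatedStep_nonneg hR
  by_cases hc : Φc t j r i ≤ M
  · have h2 : inner ℝ (traj t j r) (ω.1 i).1.2 ≤ 2 * M := by linarith
    have h3 := hω.noiseStep_le hR (gate_le_one _) (by linarith) h2
    rw [one_mul] at h3
    have h4 := hR.pos_step
    have h5 : 0 ≤ ((t + 1 : ℕ) : ℝ) * saturatedStep q η N M n m := by positivity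
    linarith
  · have h2 : inner ℝ (traj t j r) (ω.1 i).1.2 ≤ 4 * M := by
      have := (abs_le.1 (h.abs_noise_le hR ht j r i)).2
      linarith
    subst hi
    have h3 := hω.noiseStep_le hR (h.gate_le hω hR hv ht r i (not_le.1 hc)) (by linarith) h2
    have h4 := h.pos _ r i rfl
    rw [← saturatedStep] at h3
    push_cast
    linarith

end Consequences

lemma TypicalRun.coeffBounds (hω : TypicalRun v N a b l ρ η T ω)
    (hR : Regime q η N ‖v‖ a b l M ρ n m T) (hv : v ≠ 0) {t : ℕ} (ht : t ≤ T) :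
    CoeffBounds q η N M l a b ‖v‖ v ω t := by
  induction t with
  | zero =>
    have := hR.hM; have := hR.hl; have := hR.ha
    refine ⟨fun j r => ?_, fun j r i _ => ?_, fun j r i _ => ?_⟩
    · simp [signalCoeff]
    · simp only [noiseCoeff, Finset.range_zero, Finset.sum_empty, Nat.cast_zero, zero_mul, add_zero]
      linarith
    · simp only [noiseCoeff, Finset.range_zero, Finset.sum_empty]
      have : 0 ≤ 3 * l * a := by positivity
      linarith
  | succ t ih =>
    have h := ih (by omega)
    exact ⟨h.signal_succ hω hR hv (by omega), h.pos_succ hω hR hv (by omega),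
      h.neg_succ hω hR hv (by omega)⟩

lemma exp_half_le_one_add {x : ℝ} (hx0 : 0 ≤ x) (hx : x ≤ 1) : Real.exp (x / 2) ≤ 1 + x := by
  have h1 := Real.one_sub_le_exp_neg (x / 2)
  rw [Real.exp_neg] at h1
  have h2 := Real.exp_pos (x / 2)
  have h3 : (1 - x / 2) * Real.exp (x / 2) ≤ 1 := by
    calc _ ≤ (Real.exp (x / 2))⁻¹ * Real.exp (x / 2) := by gcongr
      _ = 1 := inv_mul_cancel₀ h2.ne'
  nlinarith [mul_nonneg hx0 (sub_nonneg.2 hx)]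

/-- As long as no filter has memorized the `i`-th noise patch, the gradient of that sample is of
constant size, and a filter that starts with a correlation of at least `a / 2` keeps growing at the
rate `growthRate`. -/
lemma TypicalRun.exists_two_le_noiseCoeff (hω : TypicalRun v N a b l ρ η T ω)
    (hR : Regime q η N ‖v‖ a b l M ρ n m T) (hv : v ≠ 0) (i : Fin n) :
    ∃ r, 2 ≤ Φc T (ω.1 i).2 r i := by
  have hq := hR.hq; have hη := hR.hη; have ha := hR.ha; have hl := hR.hl; have hM := hR.hM
  have hla : a ≤ l * a := le_mul_of_one_le_left ha.le hl
  have hsm := hR.noise_small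
  have hn : (0 : ℝ) < n := by exact_mod_cast hR.hn
  have hm : (0 : ℝ) < m := by exact_mod_cast hR.hm
  by_contra! hcon
  obtain ⟨r, hr⟩ := hω.init_large i
  have hlt : ∀ t ≤ T, ∀ r', Φc t (ω.1 i).2 r' i < 2 := fun t ht r' =>
    (noiseCoeff_monotone (by linarith) hη.le r' rfl ht).trans_lt (hcon r')
  have hgate : ∀ t ≤ T, gate (1 + 3 ^ q) ≤ gate (margin q ω.1 (traj t) i) := by
    intro t ht
    have hB := hω.coeffBounds hR hv ht
    refine gate_anti ?_
    rw [margin_eq]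
    have h1 := subnet_nonneg q (traj t (!(ω.1 i).2)) (ω.1 i).1
    have h2 : subnet q (traj t (ω.1 i).2) (ω.1 i).1 ≤ 1 ^ q + 3 ^ q := by
      refine subnet_le (by linarith) hR.hm zero_le_one (by norm_num)
        (fun r => hB.inner_signal_le_one hω hR hv ht _ r i) fun r => ?_
      have h4 := (abs_le.1 (hB.abs_inner_noise_sub_coeff_le hω hR hv ht (ω.1 i).2 r i)).2
      have h5 := hlt t ht r
      linarith
    rw [Real.one_rpow] at h2
    linarith
  set κ := growthRate q η N a n m with hκ
  have hκ0 : 0 ≤ κ := by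
    have := gate_pos (1 + 3 ^ q)
    rw [hκ]; unfold growthRate; positivity
  have hgrow : ∀ t ≤ T, a / 4 * (1 + κ) ^ t ≤ Φc t (ω.1 i).2 r i + a / 4 := by
    intro t
    induction t with
    | zero => intro _; simp [noiseCoeff]
    | succ t ih =>
      intro ht
      have ih := ih (by omega)
      have hB := hω.coeffBounds hR hv (show t ≤ T by omega)
      have hA0 := noiseCoeff_nonneg (q := q) (by linarith) hη.le t r (rfl : (ω.1 i).2 = _)
      set A := Φc t (ω.1 i).2 r i + a / 4 with hA
      have h1 := (abs_le.1 (hB.abs_inner_noise_sub_le hω hR hv (by omega) (ω.1 i).2 r i)).1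
      have h2 : A ≤ inner ℝ (traj t (ω.1 i).2 r) (ω.1 i).1.2 := by linarith
      have hA4 : a / 4 ≤ A := by linarith
      have hApos : 0 < A := by linarith
      have h3 : q * ((a / 4) ^ (q - 2) * A)
          ≤ actDeriv q (inner ℝ (traj t (ω.1 i).2 r) (ω.1 i).1.2) := by
        refine le_trans ?_ (actDeriv_mono (by linarith) h2)
        rw [actDeriv_of_nonneg hApos.le, show q - 1 = (q - 2) + 1 by ring,
          Real.rpow_add_one hApos.ne']
        have := Real.rpow_le_rpow (by positivity) hA4 (show 0 ≤ q - 2 by linarith)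
        gcongr
      have h4 := hω.norm_lower i
      have h5 := hgate t (by omega)
      have h6 := gate_pos (1 + 3 ^ q)
      have h7 : κ * A ≤ Δc t (ω.1 i).2 r i := by
        calc κ * A = η / ((n : ℝ) * m) * (N ^ 2 / 4) *
              (gate (1 + 3 ^ q) * (q * ((a / 4) ^ (q - 2) * A))) := by
              rw [hκ, growthRate]; ring
          _ ≤ _ := by
              show _ ≤ η / ((n : ℝ) * m) * ‖(ω.1 i).1.2‖ ^ 2 * (gate (margin q ω.1 (traj t) i) *
                actDeriv q (inner ℝ (traj t (ω.1 i).2 r) (ω.1 i).1.2))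
              have h8 := gate_pos (margin q ω.1 (traj t) i)
              gcongr
      rw [noiseCoeff_succ_of_eq rfl, pow_succ]
      calc a / 4 * ((1 + κ) ^ t * (1 + κ)) = (a / 4 * (1 + κ) ^ t) * (1 + κ) := by ring
        _ ≤ A * (1 + κ) := by gcongr
        _ = A + κ * A := by ring
        _ ≤ _ := by linarith
  have h1 := hgrow T le_rfl
  have h2 := hcon r
  have h3 : 12 / a ≤ (1 + κ) ^ T := by
    calc 12 / a = Real.exp (Real.log (12 / a)) := (Real.exp_log (by positivity)).symm
      _ ≤ Real.exp (T * (κ / 2)) := Real.exp_le_exp.2 (by linarith [hR.growth])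
      _ = Real.exp (κ / 2) ^ T := Real.exp_nat_mul _ _
      _ ≤ (1 + κ) ^ T := by
          gcongr
          exact exp_half_le_one_add hκ0 hR.rate_le_one
  have h4 : 3 ≤ a / 4 * (1 + κ) ^ T := by
    calc (3 : ℝ) = a / 4 * (12 / a) := by field_simp; norm_num
      _ ≤ _ := by gcongr
  linarith

/-- Typical runs memorize the noise. -/
theorem TypicalRun.exists_coeff (hω : TypicalRun v N a b l ρ η T ω)
    (hR : Regime q η N ‖v‖ a b l M ρ n m T) (hv : v ≠ 0) :
    ∃ (Γ : ℕ → Bool → Fin m → ℝ) (Φ : ℕ → Bool → Fin m → Fin n → ℝ),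
      IsUniqueDecomposition v (fun i => (ω.1 i).1.2) η ω.2.2 traj Γ Φ ∧
      (∀ i, ∃ j r, 2 ≤ posCoeff (Φ T j r i)) ∧
      (∀ t ≤ T, ∀ j r, Γ t j r ≤ l * b) ∧
      (∀ t ≤ T, ∀ j r i, |negCoeff (Φ t j r i)| ≤ 3 * l * a) := by
  have hq := hR.hq; have ha := hR.ha; have hl := hR.hl
  have hnρ : n * ρ < 1 := by
    have h1 := hR.cross
    have h2 := hR.noise_small
    have h3 : 0 ≤ n * ρ := mul_nonneg (by positivity) hR.hρ
    have h4 : a ≤ l * a := le_mul_of_one_le_left ha.le hl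
    nlinarith [hR.hM]
  refine ⟨Γc, Φc, isUniqueDecomposition_of_isDecomposition hv (hω.noise_ne_zero hR.hN) hω.orth hR.hρ
    hω.corr hnρ (hω.isDecomposition hR hv), fun i => ?_, fun t ht j r => ?_, fun t ht j r i => ?_⟩
  · obtain ⟨r, hr⟩ := hω.exists_two_le_noiseCoeff hR hv i
    exact ⟨_, r, by rwa [posCoeff, if_pos (by linarith)]⟩
  · exact (hω.coeffBounds hR hv ht).signal_le hR ht j r
  · have h3 : 0 ≤ 3 * l * a := by positivity
    by_cases hi : (ω.1 i).2 = j
    · have h1 := noiseCoeff_nonneg (q := q) (by linarith) hR.hη.le t r hi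
      unfold negCoeff
      split_ifs with h2
      · rw [le_antisymm h2 h1, abs_zero]; exact h3
      · rwa [abs_zero]
    · have h1 := noiseCoeff_nonpos (q := q) (by linarith) hR.hη.le t r hi
      have h2 := (hω.coeffBounds hR hv ht).neg j r i hi
      rw [negCoeff, if_pos h1, abs_of_nonpos h1]
      linarith

end Dynamics

/-! ### Tails of Gaussian vectors -/

lemma measure_le_ofReal {α : Type*} [MeasurableSpace α] {μ : Measure α} [IsFiniteMeasure μ]
    {s : Set α} {c : ℝ} (h : μ.real s ≤ c) : μ s ≤ ENNReal.ofReal c := by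
  rw [← ofReal_measureReal]
  exact ENNReal.ofReal_le_ofReal h

/-- A Gaussian vector is a linear image of a standard Gaussian vector. -/
lemma map_stdGaussian_eq_multivariateGaussian {d : ℕ} {f : Vec d → Vec d} (hf : Measurable f)
    {g : Vec d → Vec d} (hfg : ∀ x t, inner ℝ (f x) t = inner ℝ x (g t))
    {S : Matrix (Fin d) (Fin d) ℝ} (hS : S.IsHermitian)
    (hSg : ∀ t : Vec d, t ⬝ᵥ S.mulVec t = ‖g t‖ ^ 2) :
    (stdGaussian (Vec d)).map f = multivariateGaussian 0 S := by
  have hpsd : S.PosSemidef := by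
    refine Matrix.PosSemidef.of_dotProduct_mulVec_nonneg hS fun x => ?_
    have := hSg (WithLp.toLp 2 x)
    simp only [star_trivial] at this ⊢
    rw [this]; positivity
  have : IsProbabilityMeasure ((stdGaussian (Vec d)).map f) :=
    Measure.isProbabilityMeasure_map hf.aemeasurable
  refine Measure.ext_of_charFun ?_
  ext t
  have h1 : charFun ((stdGaussian (Vec d)).map f) t = charFun (stdGaussian (Vec d)) (g t) := by
    rw [charFun_apply, charFun_apply, integral_map hf.aemeasurable (by fun_prop)]
    simp only [hfg]
  rw [h1, charFun_stdGaussian, charFun_multivariateGaussian hpsd, hSg]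
  simp
  ring_nf

lemma isoGaussian_eq_map (d : ℕ) (s : ℝ) :
    isoGaussian d s = (stdGaussian (Vec d)).map (fun x => s • x) := by
  rw [isoGaussian]
  refine (map_stdGaussian_eq_multivariateGaussian (g := fun t => s • t) (by fun_prop) ?_ ?_ ?_).symm
  · intro x t; rw [inner_smul_left, inner_smul_right]; rfl
  · exact Matrix.IsHermitian.ext fun i j => by simp [Matrix.one_apply, eq_comm]
  · intro t
    rw [Matrix.smul_mulVec, Matrix.one_mulVec, norm_smul, mul_pow, EuclideanSpace.real_norm_sq_eq]
    simp [dotProduct, Finset.mul_sum]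
    exact Finset.sum_congr rfl fun i _ => by ring

/-- The orthogonal projection along `v`. -/
noncomputable def projAway {d : ℕ} (v x : Vec d) : Vec d := x - ((‖v‖ ^ 2)⁻¹ * inner ℝ v x) • v

lemma inner_projAway_left {d : ℕ} (v x t : Vec d) :
    inner ℝ (projAway v x) t = inner ℝ x t - (‖v‖ ^ 2)⁻¹ * inner ℝ v x * inner ℝ v t := by
  rw [projAway, inner_sub_left, inner_smul_left]; rfl

lemma inner_projAway_comm {d : ℕ} (v x t : Vec d) :
    inner ℝ (projAway v x) t = inner ℝ x (projAway v t) := by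
  rw [inner_projAway_left, real_inner_comm, ← real_inner_comm x, inner_projAway_left,
    real_inner_comm]
  ring

lemma inner_projAway_self {d : ℕ} {v : Vec d} (hv : v ≠ 0) (x : Vec d) :
    inner ℝ (projAway v x) v = 0 := by
  have : ‖v‖ ≠ 0 := norm_ne_zero_iff.2 hv
  rw [inner_projAway_left, real_inner_self_eq_norm_sq, real_inner_comm v x]
  field_simp
  ring

lemma norm_projAway_sq {d : ℕ} {v : Vec d} (hv : v ≠ 0) (x : Vec d) :
    ‖projAway v x‖ ^ 2 = ‖x‖ ^ 2 - (‖v‖ ^ 2)⁻¹ * (inner ℝ v x) ^ 2 := by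
  rw [← real_inner_self_eq_norm_sq]
  nth_rw 2 [projAway]
  rw [inner_sub_right, inner_smul_right, inner_projAway_self hv, inner_projAway_left,
    real_inner_self_eq_norm_sq]
  ring

lemma norm_projAway_le {d : ℕ} {v : Vec d} (hv : v ≠ 0) (x : Vec d) : ‖projAway v x‖ ≤ ‖x‖ := by
  refine abs_le_of_sq_le_sq' ?_ (norm_nonneg _) |>.2
  rw [norm_projAway_sq hv]
  have : 0 ≤ (‖v‖ ^ 2)⁻¹ * (inner ℝ v x) ^ 2 := by positivity
  linarith

lemma measurable_projAway {d : ℕ} (v : Vec d) : Measurable (projAway v) := by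
  unfold projAway
  have : Continuous fun x : Vec d => x - ((‖v‖ ^ 2)⁻¹ * inner ℝ v x) • v := by fun_prop
  exact this.measurable

lemma measurable_smul_projAway {d : ℕ} (v : Vec d) (σ : ℝ) :
    Measurable fun x => σ • projAway v x := (measurable_projAway v).const_smul σ

lemma multivariateGaussian_projMatrix_eq_map {d : ℕ} {v : Vec d} (hv : v ≠ 0) (σ : ℝ) :
    multivariateGaussian 0 (σ ^ 2 • projMatrix v)
      = (stdGaussian (Vec d)).map (fun x => σ • projAway v x) := by
  refine (map_stdGaussian_eq_multivariateGaussian (g := fun t => σ • projAway v t)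
    (measurable_smul_projAway v σ) ?_ ?_ ?_).symm
  · intro x t; rw [inner_smul_left, inner_smul_right, inner_projAway_comm]; rfl
  · refine Matrix.IsHermitian.ext fun i j => ?_
    simp [projMatrix, Matrix.vecMulVec_apply, Matrix.one_apply, eq_comm, mul_comm]
  · intro t
    rw [norm_smul, mul_pow, norm_projAway_sq hv, projMatrix, Matrix.smul_mulVec, Matrix.sub_mulVec,
      Matrix.one_mulVec, Matrix.smul_mulVec, Matrix.vecMulVec_mulVec]
    have h1 : inner ℝ v t = (fun k => v k) ⬝ᵥ (fun k => t k) := by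
      simp [PiLp.inner_apply, dotProduct, mul_comm]
    have h2 : ‖t‖ ^ 2 = (fun k => t k) ⬝ᵥ (fun k => t k) := by
      rw [EuclideanSpace.real_norm_sq_eq]; simp [dotProduct, pow_two]
    rw [h1, h2]
    simp only [dotProduct_smul, dotProduct_sub, smul_eq_mul, Real.norm_eq_abs, sq_abs,
      MulOpposite.smul_eq_mul_unop, MulOpposite.unop_op]
    rw [dotProduct_comm (fun k => t k) (fun k => v k)]
    ring

lemma map_inner_stdGaussian {d : ℕ} (u : Vec d) :
    (stdGaussian (Vec d)).map (fun x => inner ℝ x u) = gaussianReal 0 (‖u‖ ^ 2).toNNReal := by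
  have h := IsGaussian.map_eq_gaussianReal (μ := stdGaussian (Vec d)) (innerSL ℝ u)
  rw [integral_strongDual_stdGaussian, variance_dual_stdGaussian, innerSL_apply_norm] at h
  rw [← h]
  congr 1
  ext x
  exact (real_inner_comm _ _)

lemma hasSubgaussianMGF_inner_stdGaussian {d : ℕ} (u : Vec d) :
    HasSubgaussianMGF (fun x => inner ℝ x u) (‖u‖ ^ 2).toNNReal (stdGaussian (Vec d)) := by
  have hm : AEMeasurable (fun x : Vec d => inner ℝ x u) (stdGaussian (Vec d)) := by fun_prop
  rw [← HasSubgaussianMGF.id_map_iff hm, map_inner_stdGaussian]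
  refine ⟨fun t => ?_, fun t => ?_⟩
  · exact integrable_exp_mul_gaussianReal t
  · rw [mgf_id_gaussianReal]; simp

lemma measure_abs_gt_le_of_hasSubgaussianMGF {Ω : Type*} [MeasurableSpace Ω] {μ : Measure Ω}
    [IsProbabilityMeasure μ] {X : Ω → ℝ} {c : NNReal} (h : HasSubgaussianMGF X c μ) {ε : ℝ}
    (hε : 0 ≤ ε) : μ {ω | ε < |X ω|} ≤ ENNReal.ofReal (2 * Real.exp (-ε ^ 2 / (2 * c))) := by
  refine measure_le_ofReal ?_
  have h1 := h.measure_ge_le hε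
  have h2 := h.neg.measure_ge_le hε
  have h3 : {ω | ε < |X ω|} ⊆ {ω | ε ≤ X ω} ∪ {ω | ε ≤ (-X) ω} := by
    intro ω hω
    rcases lt_abs.1 (Set.mem_ofPred_eq ▸ hω) with h | h
    · exact Or.inl h.le
    · exact Or.inr h.le
  have h4 := (measureReal_mono (μ := μ) h3).trans (measureReal_union_le _ _)
  linarith

lemma stdGaussian_abs_inner_gt_le {d : ℕ} (u : Vec d) {t : ℝ} (ht : 0 ≤ t) :
    stdGaussian (Vec d) {x | t * ‖u‖ < |inner ℝ x u|}
      ≤ ENNReal.ofReal (2 * Real.exp (-t ^ 2 / 2)) := by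
  rcases eq_or_ne u 0 with rfl | hu
  · simp
  refine (measure_abs_gt_le_of_hasSubgaussianMGF (hasSubgaussianMGF_inner_stdGaussian u)
    (by positivity)).trans ?_
  have : ‖u‖ ≠ 0 := norm_ne_zero_iff.2 hu
  refine ENNReal.ofReal_le_ofReal (le_of_eq ?_)
  rw [Real.coe_toNNReal _ (by positivity)]
  congr 2
  field_simp

lemma isoGaussian_abs_inner_gt_le {d : ℕ} {s : ℝ} (hs : 0 ≤ s) (u : Vec d) {t : ℝ} (ht : 0 ≤ t) :
    isoGaussian d s {x | t * (s * ‖u‖) < |inner ℝ x u|}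
      ≤ ENNReal.ofReal (2 * Real.exp (-t ^ 2 / 2)) := by
  rw [isoGaussian_eq_map, Measure.map_apply (by fun_prop)
    (measurableSet_lt (by fun_prop) (by fun_prop))]
  refine (measure_mono fun x hx => ?_).trans (stdGaussian_abs_inner_gt_le (s • u) ht)
  simp only [Set.mem_ofPred_eq, Set.preimage_ofPred_eq, norm_smul, Real.norm_eq_abs, abs_of_nonneg hs,
    inner_smul_left, inner_smul_right, conj_trivial] at hx ⊢
  exact hx

lemma integrable_exp_mul_sq_gaussianReal {c : ℝ} (hc : c < 1 / 2) :
    Integrable (fun x => Real.exp (c * x ^ 2)) (gaussianReal 0 1) := by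
  rw [gaussianReal_of_var_ne_zero _ one_ne_zero]
  rw [integrable_withDensity_iff_integrable_smul' (measurable_gaussianPDF _ _)
    (Filter.Eventually.of_forall fun _ => gaussianPDF_lt_top)]
  have h := (integrable_exp_neg_mul_sq (show 0 < 1 / 2 - c by linarith)).const_mul (√(2 * Real.pi))⁻¹
  refine h.congr (Filter.Eventually.of_forall fun x => ?_)
  simp only [toReal_gaussianPDF, gaussianPDFReal_def, smul_eq_mul, NNReal.coe_one, mul_one, sub_zero]
  rw [mul_assoc, ← Real.exp_add]
  congr 2
  ring

lemma integral_exp_mul_sq_gaussianReal {c : ℝ} (hc : c < 1 / 2) :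
    ∫ x, Real.exp (c * x ^ 2) ∂(gaussianReal 0 1) = √(1 / (1 - 2 * c)) := by
  rw [integral_gaussianReal_eq_integral_smul one_ne_zero]
  have h : ∀ x : ℝ, gaussianPDFReal 0 1 x • Real.exp (c * x ^ 2)
      = (√(2 * Real.pi))⁻¹ * Real.exp (-(1 / 2 - c) * x ^ 2) := by
    intro x
    simp only [gaussianPDFReal_def, smul_eq_mul, NNReal.coe_one, mul_one, sub_zero]
    rw [mul_assoc, ← Real.exp_add]
    congr 2
    ring
  simp only [h]
  rw [integral_const_mul, integral_gaussian, ← Real.sqrt_inv, ← Real.sqrt_mul (by positivity)]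
  congr 1
  have : (1 / 2 - c) ≠ 0 := by linarith
  have : (1 - 2 * c) ≠ 0 := by linarith
  field_simp

lemma integrable_exp_mul_norm_sq_stdGaussian (d : ℕ) {c : ℝ} (hc : c < 1 / 2) :
    Integrable (fun x : Vec d => Real.exp (c * ‖x‖ ^ 2)) (stdGaussian (Vec d)) := by
  rw [← map_pi_eq_stdGaussian, integrable_map_measure (by fun_prop) (by fun_prop)]
  have h := Integrable.fintype_prod (ι := Fin d) (f := fun _ x => Real.exp (c * x ^ 2))
    (μ := fun _ => gaussianReal 0 1) fun _ => integrable_exp_mul_sq_gaussianReal hc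
  refine h.congr (Filter.Eventually.of_forall fun x => ?_)
  simp [EuclideanSpace.real_norm_sq_eq, Finset.mul_sum, Real.exp_sum]

lemma mgf_norm_sq_stdGaussian (d : ℕ) {c : ℝ} (hc : c < 1 / 2) :
    mgf (fun x : Vec d => ‖x‖ ^ 2) (stdGaussian (Vec d)) c = √(1 / (1 - 2 * c)) ^ d := by
  rw [mgf, ← map_pi_eq_stdGaussian, integral_map (by fun_prop) (by fun_prop)]
  have h := integral_fintype_prod_eq_pow (ι := Fin d) (fun x => Real.exp (c * x ^ 2))
    (μ := gaussianReal 0 1)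
  rw [integral_exp_mul_sq_gaussianReal hc, Fintype.card_fin] at h
  rw [← h]
  refine integral_congr_ae (Filter.Eventually.of_forall fun x => ?_)
  simp [EuclideanSpace.real_norm_sq_eq, Finset.mul_sum, Real.exp_sum]

lemma stdGaussian_norm_sq_ge_le (d : ℕ) :
    stdGaussian (Vec d) {x | 2 * (d : ℝ) ≤ ‖x‖ ^ 2} ≤ ENNReal.ofReal (Real.exp (-(d / 16))) := by
  refine measure_le_ofReal ((measure_ge_le_exp_mul_mgf (t := 1 / 4) _ (by norm_num)
    (integrable_exp_mul_norm_sq_stdGaussian d (by norm_num))).trans ?_)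
  rw [mgf_norm_sq_stdGaussian d (by norm_num)]
  have h1 : √(1 / (1 - 2 * (1 / 4))) = Real.exp (Real.log 2 / 2) := by
    rw [show (1 : ℝ) / (1 - 2 * (1 / 4)) = 2 by norm_num, Real.sqrt_eq_rpow,
      Real.rpow_def_of_pos (by norm_num)]
    ring_nf
  rw [h1, ← Real.exp_nat_mul, ← Real.exp_add]
  refine Real.exp_le_exp.2 ?_
  have := Real.log_two_lt_d9
  nlinarith [(Nat.cast_nonneg d : (0 : ℝ) ≤ d)]

lemma stdGaussian_norm_sq_le_le (d : ℕ) :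
    stdGaussian (Vec d) {x | ‖x‖ ^ 2 ≤ (d : ℝ) / 2} ≤ ENNReal.ofReal (Real.exp (-(d / 16))) := by
  refine measure_le_ofReal ((measure_le_le_exp_mul_mgf (t := -(1 / 2)) _ (by norm_num)
    (integrable_exp_mul_norm_sq_stdGaussian d (by norm_num))).trans ?_)
  rw [mgf_norm_sq_stdGaussian d (by norm_num)]
  have h1 : √(1 / (1 - 2 * (-(1 / 2)))) = Real.exp (-(Real.log 2 / 2)) := by
    rw [show (1 : ℝ) / (1 - 2 * (-(1 / 2))) = 2⁻¹ by norm_num, Real.sqrt_eq_rpow,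
      Real.rpow_def_of_pos (by norm_num), Real.log_inv]
    ring_nf
  rw [h1, ← Real.exp_nat_mul, ← Real.exp_add]
  refine Real.exp_le_exp.2 ?_
  have := Real.log_two_gt_d9
  nlinarith [(Nat.cast_nonneg d : (0 : ℝ) ≤ d)]

/-! ### The noise patches -/

section NoisePatch

variable {d : ℕ} {v : Vec d} {σ : ℝ}

lemma noisePatch_inner_ne_zero (hv : v ≠ 0) :
    multivariateGaussian 0 (σ ^ 2 • projMatrix v) {x | inner ℝ x v ≠ 0} = 0 := by
  have hm : MeasurableSet {x : Vec d | inner ℝ x v ≠ 0} :=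
    (measurableSet_eq_fun (by fun_prop) (by fun_prop)).compl
  rw [multivariateGaussian_projMatrix_eq_map hv, Measure.map_apply (measurable_smul_projAway v σ) hm]
  refine measure_mono_null (t := ∅) (fun x hx => hx ?_) (by simp)
  simp [inner_smul_left, inner_projAway_self hv]

lemma noisePatch_abs_inner_gt_le (hv : v ≠ 0) (hσ : 0 ≤ σ) (u : Vec d) {t : ℝ} (ht : 0 ≤ t) :
    multivariateGaussian 0 (σ ^ 2 • projMatrix v) {x | t * (σ * ‖u‖) < |inner ℝ x u|}
      ≤ ENNReal.ofReal (2 * Real.exp (-t ^ 2 / 2)) := by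
  rw [multivariateGaussian_projMatrix_eq_map hv, Measure.map_apply
    (measurable_smul_projAway v σ) (measurableSet_lt (by fun_prop) (by fun_prop))]
  refine (measure_mono fun x hx => ?_).trans (stdGaussian_abs_inner_gt_le (σ • projAway v u) ht)
  simp only [Set.mem_ofPred_eq, Set.preimage_ofPred_eq, norm_smul, Real.norm_eq_abs, abs_of_nonneg hσ,
    inner_smul_left, inner_smul_right, conj_trivial, inner_projAway_comm] at hx ⊢
  refine lt_of_le_of_lt ?_ hx
  have := norm_projAway_le hv u
  gcongr

lemma noisePatch_norm_sq_gt_le (hv : v ≠ 0) (hσ : 0 < σ) :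
    multivariateGaussian 0 (σ ^ 2 • projMatrix v) {x | 2 * (σ * √(d : ℝ)) ^ 2 < ‖x‖ ^ 2}
      ≤ ENNReal.ofReal (2 * Real.exp (-(d / 16))) := by
  rw [multivariateGaussian_projMatrix_eq_map hv, Measure.map_apply
    (measurable_smul_projAway v σ) (measurableSet_lt (by fun_prop) (by fun_prop))]
  refine (measure_mono fun x hx => ?_).trans ((stdGaussian_norm_sq_ge_le d).trans
    (ENNReal.ofReal_le_ofReal (by linarith [Real.exp_pos (-((d : ℝ) / 16))])))
  simp only [Set.mem_ofPred_eq, Set.preimage_ofPred_eq, norm_smul, Real.norm_eq_abs,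
    abs_of_nonneg hσ.le, mul_pow, Real.sq_sqrt (Nat.cast_nonneg d)] at hx ⊢
  have h1 := norm_projAway_sq hv x
  have h2 : 0 ≤ (‖v‖ ^ 2)⁻¹ * (inner ℝ v x) ^ 2 := by positivity
  have h3 : σ ^ 2 * (2 * d) < σ ^ 2 * ‖projAway v x‖ ^ 2 := by linarith
  have h4 := lt_of_mul_lt_mul_left h3 (by positivity)
  linarith

lemma noisePatch_norm_sq_lt_le (hv : v ≠ 0) (hσ : 0 < σ) :
    multivariateGaussian 0 (σ ^ 2 • projMatrix v) {x | ‖x‖ ^ 2 < (σ * √(d : ℝ)) ^ 2 / 4}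
      ≤ ENNReal.ofReal (3 * Real.exp (-(d / 16))) := by
  rw [multivariateGaussian_projMatrix_eq_map hv, Measure.map_apply
    (measurable_smul_projAway v σ) (measurableSet_lt (by fun_prop) (by fun_prop))]
  have hvn : 0 < ‖v‖ := norm_pos_iff.2 hv
  have h0 : (fun x => σ • projAway v x) ⁻¹' {x | ‖x‖ ^ 2 < (σ * √(d : ℝ)) ^ 2 / 4}
      ⊆ {x | ‖x‖ ^ 2 ≤ (d : ℝ) / 2} ∪ {x | √(d : ℝ) / 2 * ‖v‖ < |inner ℝ x v|} := by
    intro x hx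
    by_contra hcon
    simp only [Set.mem_union, Set.mem_ofPred_eq, not_or, not_le, not_lt] at hcon
    simp only [Set.mem_ofPred_eq, Set.preimage_ofPred_eq, norm_smul, Real.norm_eq_abs,
      abs_of_nonneg hσ.le, mul_pow, Real.sq_sqrt (Nat.cast_nonneg d), norm_projAway_sq hv] at hx
    obtain ⟨h1, h2⟩ := hcon
    have h3 : (‖v‖ ^ 2)⁻¹ * (inner ℝ v x) ^ 2 ≤ d / 4 := by
      rw [inv_mul_le_iff₀ (by positivity), real_inner_comm, ← sq_abs]
      calc |inner ℝ x v| ^ 2 ≤ (√(d : ℝ) / 2 * ‖v‖) ^ 2 := by gcongr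
        _ = ‖v‖ ^ 2 * (d / 4) := by rw [mul_pow, div_pow, Real.sq_sqrt (Nat.cast_nonneg d)]; ring
    have h4 : σ ^ 2 * (d / 4) ≤ σ ^ 2 * (‖x‖ ^ 2 - (‖v‖ ^ 2)⁻¹ * (inner ℝ v x) ^ 2) := by
      gcongr; linarith
    linarith
  refine (measure_mono h0).trans ((measure_union_le _ _).trans
    ((add_le_add (stdGaussian_norm_sq_le_le d)
      (stdGaussian_abs_inner_gt_le v (by positivity))).trans ?_))
  rw [← ENNReal.ofReal_add (by positivity) (by positivity)]
  refine ENNReal.ofReal_le_ofReal ?_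
  have h5 : Real.exp (-(√(d : ℝ) / 2) ^ 2 / 2) ≤ Real.exp (-(d / 16)) := by
    refine Real.exp_le_exp.2 ?_
    rw [div_pow, Real.sq_sqrt (Nat.cast_nonneg d)]
    have : (0 : ℝ) ≤ d := Nat.cast_nonneg d
    linarith
  linarith

end NoisePatch

/-! ### The accumulated private noise -/

section Maximal

variable {Ω : Type*} [MeasurableSpace Ω] {μ : Measure Ω} {X : ℕ → Ω → ℝ} {c : NNReal}

/-- The exponential of a random walk with `1 ≤ E exp (s X)` is a submartingale. -/
lemma submartingale_exp_sum (hX : ∀ i, Measurable (X i)) (hind : iIndepFun X μ)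
    (hsub : ∀ i, HasSubgaussianMGF (X i) c μ) {s : ℝ} (hs : ∀ i, 1 ≤ mgf (X i) μ s) :
    Submartingale (fun k ω => Real.exp (s * ∑ i ∈ Finset.range (k + 1), X i ω))
      (Filtration.natural X fun i => (hX i).stronglyMeasurable) μ := by
  have := hind.isProbabilityMeasure
  set 𝒢 := Filtration.natural X fun i => (hX i).stronglyMeasurable with h𝒢
  have hint : ∀ k, Integrable (fun ω => Real.exp (s * ∑ i ∈ Finset.range (k + 1), X i ω)) μ :=
    fun k => (HasSubgaussianMGF.sum_of_iIndepFun hind (c := fun _ => c)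
      (s := Finset.range (k + 1)) fun i _ => hsub i).integrable_exp_mul s
  have hadapt : StronglyAdapted 𝒢 (fun k ω => Real.exp (s * ∑ i ∈ Finset.range (k + 1), X i ω)) := by
    intro k
    refine Real.continuous_exp.comp_stronglyMeasurable (StronglyMeasurable.const_mul ?_ s)
    refine Finset.stronglyMeasurable_fun_sum _ fun i hi => ?_
    exact ((Filtration.stronglyAdapted_natural fun i => (hX i).stronglyMeasurable) i).mono
      (𝒢.mono (Nat.lt_succ_iff.1 (Finset.mem_range.1 hi)))
  refine submartingale_nat hadapt hint fun k => ?_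
  have hg : Integrable (fun ω => Real.exp (s * X (k + 1) ω)) μ := (hsub (k + 1)).integrable_exp_mul s
  have hprod : (fun ω => Real.exp (s * ∑ i ∈ Finset.range (k + 1 + 1), X i ω))
      = (fun ω => Real.exp (s * ∑ i ∈ Finset.range (k + 1), X i ω)) *
        (fun ω => Real.exp (s * X (k + 1) ω)) := by
    ext ω
    rw [Pi.mul_apply, Finset.sum_range_succ, mul_add, Real.exp_add]
  have h1 := condExp_mul_of_stronglyMeasurable_left (m := 𝒢 k) (hadapt k)
    (hprod ▸ hint (k + 1)) hg
  have h2 : μ[fun ω => Real.exp (s * X (k + 1) ω) | 𝒢 k]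
      =ᵐ[μ] fun _ => ∫ ω, Real.exp (s * X (k + 1) ω) ∂μ := by
    refine condExp_indep_eq (hX (k + 1)).comap_le (𝒢.le k) ?_
      (hind.indep_comap_natural_of_lt (fun i => (hX i).stronglyMeasurable) (Nat.lt_succ_self k))
    exact (Real.measurable_exp.comp
      (measurable_const.mul (comap_measurable (X (k + 1))))).stronglyMeasurable
  simp only [hprod]
  filter_upwards [h1, h2] with ω hω1 hω2
  rw [hω1, Pi.mul_apply, hω2]
  exact le_mul_of_one_le_right (Real.exp_pos _).le (hs (k + 1))

/-- A one-sided maximal inequality for a sub-Gaussian random walk. -/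
lemma measure_exists_sum_gt_le (hX : ∀ i, Measurable (X i)) (hind : iIndepFun X μ)
    (hsub : ∀ i, HasSubgaussianMGF (X i) c μ) {s : ℝ} (hs0 : 0 ≤ s) (hs : ∀ i, 1 ≤ mgf (X i) μ s)
    {β : ℝ} (hβ : 0 ≤ β) (T : ℕ) :
    μ {ω | ∃ t ≤ T, β < ∑ i ∈ Finset.range t, X i ω}
      ≤ ENNReal.ofReal (Real.exp (-(s * β) + T * c * s ^ 2 / 2)) := by
  have := hind.isProbabilityMeasure
  rcases Nat.eq_zero_or_pos T with rfl | hT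
  · refine le_trans (le_of_eq ?_) zero_le
    refine measure_mono_null (t := ∅) (fun ω hω => ?_) (by simp)
    obtain ⟨t, ht, h⟩ := hω
    rw [Nat.le_zero.1 ht] at h
    simp at h
    linarith
  obtain ⟨n, rfl⟩ : ∃ n, T = n + 1 := ⟨T - 1, by omega⟩
  have hsm := submartingale_exp_sum hX hind hsub hs
  set f : ℕ → Ω → ℝ := fun k ω => Real.exp (s * ∑ i ∈ Finset.range (k + 1), X i ω) with hf
  have hmax := maximal_ineq hsm (fun k ω => (Real.exp_pos _).le) (ε := (Real.exp (s * β)).toNNReal) n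
  rw [Real.coe_toNNReal _ (Real.exp_pos _).le] at hmax
  set A := {ω | Real.exp (s * β) ≤ (Finset.range (n + 1)).sup' Finset.nonempty_range_add_one
    fun k => f k ω} with hA
  have hsubset : {ω | ∃ t ≤ n + 1, β < ∑ i ∈ Finset.range t, X i ω} ⊆ A := by
    rintro ω ⟨t, ht, h⟩
    rcases Nat.eq_zero_or_pos t with rfl | ht0
    · simp at h; linarith
    obtain ⟨k, rfl⟩ : ∃ k, t = k + 1 := ⟨t - 1, by omega⟩
    rw [hA, Set.mem_ofPred_eq]
    refine le_trans ?_ (Finset.le_sup' (fun k => f k ω)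
      (Finset.mem_range.2 (show k < n + 1 by omega)))
    exact Real.exp_le_exp.2 (mul_le_mul_of_nonneg_left h.le hs0)
  have hint : ∫ ω in A, f n ω ∂μ ≤ Real.exp ((n + 1 : ℕ) * c * s ^ 2 / 2) := by
    have h1 := HasSubgaussianMGF.sum_of_iIndepFun hind (c := fun _ => c)
      (s := Finset.range (n + 1)) fun i _ => hsub i
    refine (setIntegral_le_integral (h1.integrable_exp_mul s)
      (Filter.Eventually.of_forall fun ω => (Real.exp_pos _).le)).trans ?_
    refine (h1.mgf_le s).trans (le_of_eq ?_)
    simp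
  have h3 : μ A ≤ ENNReal.ofReal (Real.exp (-(s * β)) * Real.exp ((n + 1 : ℕ) * c * s ^ 2 / 2)) := by
    have h4 := hmax.trans (ENNReal.ofReal_le_ofReal hint)
    rw [Real.exp_neg, ENNReal.ofReal_mul (by positivity), ENNReal.ofReal_inv_of_pos (Real.exp_pos _)]
    rw [mul_comm, ← div_eq_mul_inv, ENNReal.le_div_iff_mul_le, mul_comm]
    · exact h4
    · left; simp [Real.exp_pos]
    · left; simp
  rw [← Real.exp_add] at h3
  exact (measure_mono hsubset).trans h3

end Maximal

/-- All partial sums of the first `T` private noise vectors stay below `β ‖u‖` in the direction `u`, up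
to the probability of a single Gaussian tail. The variance may vanish. -/
lemma privateNoise_exists_gt_le {d : ℕ} (u : Vec d) (σ : ℝ) (T : ℕ) {β t : ℝ} (hβ : 0 < β)
    (hT : T * σ ^ 2 * t ^ 2 ≤ β ^ 2) :
    Measure.infinitePi (fun _ : ℕ => isoGaussian d σ)
        {z | ∃ k ≤ T, β * ‖u‖ < |∑ s ∈ Finset.Icc 1 k, inner ℝ (z s) u|}
      ≤ ENNReal.ofReal (2 * Real.exp (-t ^ 2 / 2)) := by
  set μ := Measure.infinitePi (fun _ : ℕ => isoGaussian d σ) with hμ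
  rcases eq_or_ne u 0 with rfl | hu
  · simp
  have hun : 0 < ‖u‖ := norm_pos_iff.2 hu
  have key : ∀ u : Vec d, ‖u‖ > 0 →
      μ {z | ∃ k ≤ T, β * ‖u‖ < ∑ i ∈ Finset.range k, inner ℝ (z (i + 1)) u}
      ≤ ENNReal.ofReal (Real.exp (-t ^ 2 / 2)) := by
    intro u hun
    have hlaw : ∀ i, μ.map (fun z : ℕ → Vec d => inner ℝ (z (i + 1)) u)
        = gaussianReal 0 (‖σ • u‖ ^ 2).toNNReal := by
      intro i
      have h1 : μ.map (fun z : ℕ → Vec d => z (i + 1)) = isoGaussian d σ :=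
        Measure.infinitePi_map_eval _ (i + 1)
      have h2 : (fun z : ℕ → Vec d => inner ℝ (z (i + 1)) u)
          = (fun x : Vec d => inner ℝ x u) ∘ (fun z : ℕ → Vec d => z (i + 1)) := rfl
      rw [h2, ← Measure.map_map (by fun_prop) (by fun_prop), h1, isoGaussian_eq_map,
        Measure.map_map (by fun_prop) (by fun_prop), ← map_inner_stdGaussian]
      congr 1
      ext x
      simp [inner_smul_left, inner_smul_right]
    have hind : iIndepFun (fun (i : ℕ) (z : ℕ → Vec d) => inner ℝ (z (i + 1)) u) μ := by
      have h1 : iIndepFun (fun (i : ℕ) (z : ℕ → Vec d) => inner ℝ (z i) u) μ :=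
        iIndepFun_infinitePi (P := fun _ : ℕ => isoGaussian d σ)
          (X := fun _ x => inner ℝ x u) fun _ => by fun_prop
      exact h1.precomp (add_left_injective 1)
    have hm : ∀ i : ℕ, Measurable (fun z : ℕ → Vec d => inner ℝ (z (i + 1)) u) := fun i => by fun_prop
    have hsub : ∀ i : ℕ, HasSubgaussianMGF (fun z : ℕ → Vec d => inner ℝ (z (i + 1)) u)
        (‖σ • u‖ ^ 2).toNNReal μ := by
      intro i
      rw [← HasSubgaussianMGF.id_map_iff (hm i).aemeasurable, hlaw]
      refine ⟨fun t => integrable_exp_mul_gaussianReal t, fun t => ?_⟩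
      rw [mgf_id_gaussianReal]; simp
    have hmgf : ∀ (i : ℕ) (s : ℝ), 1 ≤ mgf (fun z : ℕ → Vec d => inner ℝ (z (i + 1)) u) μ s := by
      intro i s
      rw [mgf_gaussianReal (hlaw i)]
      refine Real.one_le_exp ?_
      rw [zero_mul, zero_add]; positivity
    -- The exponent is chosen in terms of `β` and not of the variance, which may be zero.
    refine (measure_exists_sum_gt_le hm hind hsub (s := t ^ 2 / (β * ‖u‖)) (by positivity)
      (fun i => hmgf i _) (by positivity) T).trans (ENNReal.ofReal_le_ofReal (Real.exp_le_exp.2 ?_))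
    rw [Real.coe_toNNReal _ (by positivity), norm_smul, mul_pow, Real.norm_eq_abs, sq_abs,
      div_mul_cancel₀ _ (by positivity)]
    have h3 : T * (σ ^ 2 * ‖u‖ ^ 2) * (t ^ 2 / (β * ‖u‖)) ^ 2 ≤ t ^ 2 := by
      have : T * (σ ^ 2 * ‖u‖ ^ 2) * (t ^ 2 / (β * ‖u‖)) ^ 2 = (T * σ ^ 2 * t ^ 2) / β ^ 2 * t ^ 2 := by
        field_simp
      rw [this]
      exact mul_le_of_le_one_left (sq_nonneg t) ((div_le_one (by positivity)).2 hT)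
    linarith
  have hsum : ∀ (z : ℕ → Vec d) (k : ℕ), ∑ s ∈ Finset.Icc 1 k, inner ℝ (z s) u
      = ∑ i ∈ Finset.range k, inner ℝ (z (i + 1)) u := by
    intro z k
    rw [Finset.range_eq_Ico, Finset.sum_Ico_add' (fun s => inner ℝ (z s) u) 0 k 1]
    rfl
  have hsubset : {z : ℕ → Vec d | ∃ k ≤ T, β * ‖u‖ < |∑ s ∈ Finset.Icc 1 k, inner ℝ (z s) u|}
      ⊆ {z | ∃ k ≤ T, β * ‖u‖ < ∑ i ∈ Finset.range k, inner ℝ (z (i + 1)) u}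
        ∪ {z | ∃ k ≤ T, β * ‖-u‖ < ∑ i ∈ Finset.range k, inner ℝ (z (i + 1)) (-u)} := by
    rintro z ⟨k, hk, h⟩
    rw [hsum] at h
    rcases lt_abs.1 h with h | h
    · exact Or.inl ⟨k, hk, h⟩
    · refine Or.inr ⟨k, hk, ?_⟩
      simpa only [norm_neg, inner_neg_right, Finset.sum_neg_distrib] using h
  refine (measure_mono hsubset).trans ((measure_union_le _ _).trans
    ((add_le_add (key u hun) (key (-u) (by rwa [norm_neg]))).trans ?_))
  rw [← ENNReal.ofReal_add (by positivity) (by positivity)]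
  exact ENNReal.ofReal_le_ofReal (by linarith)

open scoped ENNReal

/-! ### Most training runs are typical -/

/-- The probability that a standard Gaussian variable is at least `1`. -/
noncomputable def gaussianTail : ℝ := (gaussianReal 0 1).real (Set.Ici 1)

lemma gaussianTail_pos : 0 < gaussianTail := by
  rw [gaussianTail, measureReal_def, ENNReal.toReal_pos_iff]
  refine ⟨?_, measure_lt_top _ _⟩
  have h1 : 0 < volume (Set.Ici (1 : ℝ)) := by simp
  rw [pos_iff_ne_zero] at h1 ⊢
  exact fun h => h1 ((gaussianReal_absolutelyContinuous' 0 one_ne_zero) h)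

lemma isoGaussian_inner_lt_le {d : ℕ} {s : ℝ} (hs : 0 < s) (u : Vec d) :
    isoGaussian d s {x | inner ℝ x u < s * ‖u‖} ≤ ENNReal.ofReal (Real.exp (-gaussianTail)) := by
  rcases eq_or_ne u 0 with rfl | hu
  · simp
  have hun : 0 < ‖u‖ := norm_pos_iff.2 hu
  have h1 : isoGaussian d s {x | inner ℝ x u < s * ‖u‖} = gaussianReal 0 1 (Set.Iio 1) := by
    have h2 := map_inner_stdGaussian (‖u‖⁻¹ • u)
    rw [norm_smul, norm_inv, norm_norm, inv_mul_cancel₀ hun.ne', one_pow, Real.toNNReal_one] at h2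
    rw [isoGaussian_eq_map, Measure.map_apply (by fun_prop)
      (measurableSet_lt (by fun_prop) (by fun_prop)), ← h2, Measure.map_apply (by fun_prop)
      measurableSet_Iio]
    congr 1
    ext x
    simp only [Set.mem_preimage, Set.mem_ofPred_eq, Set.mem_Iio, inner_smul_left, inner_smul_right,
      conj_trivial]
    rw [mul_lt_mul_iff_right₀ hs, inv_mul_lt_iff₀ hun, mul_one]
  rw [h1]
  refine measure_le_ofReal ?_
  have h3 : (gaussianReal 0 1).real (Set.Iio 1) = 1 - gaussianTail := by
    rw [gaussianTail, ← Set.compl_Ici, probReal_compl_eq_one_sub measurableSet_Ici]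
  rw [h3]
  exact Real.one_sub_le_exp_neg _

lemma pi_isoGaussian_forall_inner_lt_le {d m : ℕ} {s : ℝ} (hs : 0 < s) (u : Vec d) :
    Measure.pi (fun _ : Fin m => isoGaussian d s) {w | ∀ r, inner ℝ (w r) u < s * ‖u‖}
      ≤ ENNReal.ofReal (Real.exp (-(gaussianTail * m))) := by
  have h1 : {w : Fin m → Vec d | ∀ r, inner ℝ (w r) u < s * ‖u‖}
      = Set.pi Set.univ fun _ => {x | inner ℝ x u < s * ‖u‖} := by
    ext w; simp
  rw [h1, Measure.pi_pi, Finset.prod_const, Finset.card_univ, Fintype.card_fin]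
  calc _ ≤ ENNReal.ofReal (Real.exp (-gaussianTail)) ^ m := by
        gcongr; exact isoGaussian_inner_lt_le hs u
    _ = _ := by
        rw [← ENNReal.ofReal_pow (Real.exp_pos _).le, ← Real.exp_nat_mul]
        congr 2; ring

lemma measure_exists_le {α ι : Type*} [MeasurableSpace α] {μ : Measure α} [Fintype ι]
    {P : ι → α → Prop} {c : ℝ≥0∞} (h : ∀ i, μ {ω | P i ω} ≤ c) :
    μ {ω | ∃ i, P i ω} ≤ Fintype.card ι * c := by
  have h1 : {ω | ∃ i, P i ω} = ⋃ i, {ω | P i ω} := by ext; simp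
  rw [h1]
  refine (measure_iUnion_fintype_le _ _).trans ((Finset.sum_le_sum fun i _ => h i).trans ?_)
  simp

lemma measure_union_le_add {α : Type*} [MeasurableSpace α] {μ : Measure α} {s t : Set α} {a b : ℝ≥0∞}
    (hs : μ s ≤ a) (ht : μ t ≤ b) : μ (s ∪ t) ≤ a + b :=
  (measure_union_le s t).trans (add_le_add hs ht)

/-- A bound for all sections of a set bounds its measure for the product with a probability
measure. -/
lemma prod_measure_le_of_section {α β : Type*} [MeasurableSpace α] [MeasurableSpace β]
    {μ : Measure α} [IsProbabilityMeasure μ] {ν : Measure β} [SFinite ν] {s : Set (α × β)}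
    (hs : MeasurableSet s) {c : ℝ≥0∞} (h : ∀ x, ν (Prod.mk x ⁻¹' s) ≤ c) : μ.prod ν s ≤ c := by
  rw [Measure.prod_apply hs]
  refine (lintegral_mono h).trans ?_
  simp

/-! #### The marginals of a training run -/

section Marginals

variable {n m d : ℕ} {v : Vec d} {σξ σ0 σz : ℝ}

lemma measurable_sgn : Measurable sgn := measurable_from_top

lemma measurePreserving_noisePatch (v : Vec d) (σξ : ℝ) :
    MeasurePreserving (fun p : DataPoint d => p.1.2) (dataLaw v σξ)
      (multivariateGaussian 0 (σξ ^ 2 • projMatrix v)) := by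
  refine ⟨by fun_prop, ?_⟩
  have hm : Measurable fun p : Bool × Vec d => (((sgn p.1 • v, p.2), p.1) : DataPoint d) := by
    have h : Measurable (fun b : Bool => sgn b • v) := measurable_from_top
    exact ((h.comp measurable_fst).prodMk measurable_snd).prodMk measurable_fst
  rw [dataLaw, Measure.map_map (by fun_prop) hm]
  exact (measurePreserving_snd (μ := labelLaw)).map_eq

lemma dataLaw_label_ne (v : Vec d) (σξ : ℝ) :
    dataLaw v σξ {p | p.1.1 ≠ sgn p.2 • v} = 0 := by
  have hm : Measurable fun p : Bool × Vec d => (((sgn p.1 • v, p.2), p.1) : DataPoint d) := by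
    have h : Measurable (fun b : Bool => sgn b • v) := measurable_from_top
    exact ((h.comp measurable_fst).prodMk measurable_snd).prodMk measurable_fst
  have hs : MeasurableSet {p : DataPoint d | p.1.1 ≠ sgn p.2 • v} :=
    (measurableSet_eq_fun (by fun_prop)
      ((measurable_sgn.comp measurable_snd).smul_const v)).compl
  rw [dataLaw, Measure.map_apply hm hs]
  refine measure_mono_null (t := ∅) (fun x hx => hx ?_) (by simp)
  simp

lemma measurePreserving_dataPoint (i : Fin n) :
    MeasurePreserving (fun ω : Run n m d => ω.1 i) (runLaw n m v σξ σ0 σz) (dataLaw v σξ) :=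
  (measurePreserving_eval (fun _ : Fin n => dataLaw v σξ) i).comp measurePreserving_fst

lemma measurePreserving_patch (i : Fin n) :
    MeasurePreserving (fun ω : Run n m d => (ω.1 i).1.2) (runLaw n m v σξ σ0 σz)
      (multivariateGaussian 0 (σξ ^ 2 • projMatrix v)) :=
  (measurePreserving_noisePatch v σξ).comp (measurePreserving_dataPoint i)

lemma measurePreserving_filter (j : Bool) (r : Fin m) :
    MeasurePreserving (fun ω : Weights m d × (ℕ → Vec d) => ω.1 j r)
      ((Measure.pi fun _ : Bool => Measure.pi fun _ : Fin m => isoGaussian d σ0).prod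
        (Measure.infinitePi fun _ : ℕ => isoGaussian d σz)) (isoGaussian d σ0) :=
  ((measurePreserving_eval (fun _ : Fin m => isoGaussian d σ0) r).comp
    (measurePreserving_eval (fun _ : Bool => Measure.pi fun _ : Fin m => isoGaussian d σ0) j)).comp
    measurePreserving_fst

lemma measurePreserving_patch_patch {i k : Fin n} (hik : i ≠ k) :
    MeasurePreserving (fun ω : Run n m d => ((ω.1 k).1.2, (ω.1 i).1.2)) (runLaw n m v σξ σ0 σz)
      ((multivariateGaussian 0 (σξ ^ 2 • projMatrix v)).prod
        (multivariateGaussian 0 (σξ ^ 2 • projMatrix v))) := by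
  have h1 : iIndepFun (fun (i : Fin n) (D : Fin n → DataPoint d) => (D i).1.2)
      (Measure.pi fun _ : Fin n => dataLaw v σξ) :=
    iIndepFun_pi (X := fun _ (p : DataPoint d) => p.1.2) fun _ => by fun_prop
  have h2 := (indepFun_iff_map_prod_eq_prod_map_map (Measurable.aemeasurable (by fun_prop))
    (Measurable.aemeasurable (by fun_prop))).1
    (h1.indepFun hik.symm)
  have h3 : ∀ i, MeasurePreserving (fun D : Fin n → DataPoint d => (D i).1.2)
      (Measure.pi fun _ : Fin n => dataLaw v σξ)
      (multivariateGaussian 0 (σξ ^ 2 • projMatrix v)) := fun i =>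
    (measurePreserving_noisePatch v σξ).comp (measurePreserving_eval (fun _ => dataLaw v σξ) i)
  rw [(h3 i).map_eq, (h3 k).map_eq] at h2
  have h4 : MeasurePreserving (fun D : Fin n → DataPoint d => ((D k).1.2, (D i).1.2))
      (Measure.pi fun _ : Fin n => dataLaw v σξ)
      ((multivariateGaussian 0 (σξ ^ 2 • projMatrix v)).prod
        (multivariateGaussian 0 (σξ ^ 2 • projMatrix v))) := ⟨by fun_prop, h2⟩
  exact h4.comp measurePreserving_fst

end Marginals

/-! #### The bad events -/

section BadEvents

variable {n m d T : ℕ} {v : Vec d} {σξ σ0 σz β t : ℝ}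

lemma runLaw_label_ne_eq_zero (i : Fin n) :
    runLaw n m v σξ σ0 σz {ω | (ω.1 i).1.1 ≠ sgn (ω.1 i).2 • v} = 0 := by
  have hs : MeasurableSet {p : DataPoint d | p.1.1 ≠ sgn p.2 • v} :=
    (measurableSet_eq_fun (by fun_prop)
      ((measurable_sgn.comp measurable_snd).smul_const v)).compl
  rw [← dataLaw_label_ne v σξ, ← (measurePreserving_dataPoint i).measure_preimage hs.nullMeasurableSet]
  rfl

lemma runLaw_patch_inner_ne_eq_zero (hv : v ≠ 0) (i : Fin n) :
    runLaw n m v σξ σ0 σz {ω | inner ℝ (ω.1 i).1.2 v ≠ 0} = 0 := by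
  have hs : MeasurableSet {x : Vec d | inner ℝ x v ≠ 0} :=
    (measurableSet_eq_fun (by fun_prop) (by fun_prop)).compl
  rw [← noisePatch_inner_ne_zero (σ := σξ) hv,
    ← (measurePreserving_patch i).measure_preimage hs.nullMeasurableSet]
  rfl

lemma runLaw_patch_norm_lt_le (hv : v ≠ 0) (hσ : 0 < σξ) (i : Fin n) :
    runLaw n m v σξ σ0 σz {ω | ‖(ω.1 i).1.2‖ ^ 2 < (σξ * √(d : ℝ)) ^ 2 / 4}
      ≤ ENNReal.ofReal (3 * Real.exp (-(d / 16))) := by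
  have hs : MeasurableSet {x : Vec d | ‖x‖ ^ 2 < (σξ * √(d : ℝ)) ^ 2 / 4} :=
    measurableSet_lt (by fun_prop) (by fun_prop)
  refine le_trans (le_of_eq ?_) (noisePatch_norm_sq_lt_le hv hσ)
  rw [← (measurePreserving_patch i).measure_preimage hs.nullMeasurableSet]
  rfl

lemma runLaw_patch_norm_gt_le (hv : v ≠ 0) (hσ : 0 < σξ) (i : Fin n) :
    runLaw n m v σξ σ0 σz {ω | 2 * (σξ * √(d : ℝ)) ^ 2 < ‖(ω.1 i).1.2‖ ^ 2}
      ≤ ENNReal.ofReal (2 * Real.exp (-(d / 16))) := by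
  have hs : MeasurableSet {x : Vec d | 2 * (σξ * √(d : ℝ)) ^ 2 < ‖x‖ ^ 2} :=
    measurableSet_lt (by fun_prop) (by fun_prop)
  refine le_trans (le_of_eq ?_) (noisePatch_norm_sq_gt_le hv hσ)
  rw [← (measurePreserving_patch i).measure_preimage hs.nullMeasurableSet]
  rfl

lemma runLaw_patch_corr_le (hv : v ≠ 0) (hσ : 0 ≤ σξ) (ht : 0 ≤ t) {i k : Fin n} (hik : i ≠ k) :
    runLaw n m v σξ σ0 σz {ω | t * (σξ * ‖(ω.1 k).1.2‖) < |inner ℝ (ω.1 i).1.2 (ω.1 k).1.2|}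
      ≤ ENNReal.ofReal (2 * Real.exp (-t ^ 2 / 2)) := by
  have hs : MeasurableSet {p : Vec d × Vec d | t * (σξ * ‖p.1‖) < |inner ℝ p.2 p.1|} :=
    measurableSet_lt (by fun_prop) (by fun_prop)
  refine le_trans (le_of_eq ?_) (prod_measure_le_of_section
    (μ := multivariateGaussian 0 (σξ ^ 2 • projMatrix v)) hs fun x =>
    noisePatch_abs_inner_gt_le (σ := σξ) hv hσ x ht)
  rw [← (measurePreserving_patch_patch hik).measure_preimage hs.nullMeasurableSet]
  rfl

lemma runLaw_init_signal_le (hσ0 : 0 ≤ σ0) (ht : 0 ≤ t) (j : Bool) (r : Fin m) :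
    runLaw n m v σξ σ0 σz {ω | t * (σ0 * ‖v‖) < |inner ℝ (ω.2.1 j r) v|}
      ≤ ENNReal.ofReal (2 * Real.exp (-t ^ 2 / 2)) := by
  have hs : MeasurableSet {x : Vec d | t * (σ0 * ‖v‖) < |inner ℝ x v|} :=
    measurableSet_lt (by fun_prop) (by fun_prop)
  refine le_trans (le_of_eq ?_) (isoGaussian_abs_inner_gt_le hσ0 v ht)
  rw [← ((measurePreserving_filter (σz := σz) j r).comp (measurePreserving_snd
    (μ := Measure.pi fun _ : Fin n => dataLaw v σξ))).measure_preimage hs.nullMeasurableSet]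
  rfl

lemma runLaw_init_noise_le (hσ0 : 0 ≤ σ0) (ht : 0 ≤ t) (j : Bool) (r : Fin m) (i : Fin n) :
    runLaw n m v σξ σ0 σz {ω | t * (σ0 * ‖(ω.1 i).1.2‖) < |inner ℝ (ω.2.1 j r) (ω.1 i).1.2|}
      ≤ ENNReal.ofReal (2 * Real.exp (-t ^ 2 / 2)) := by
  have hs : MeasurableSet {p : DataPoint d × Vec d | t * (σ0 * ‖p.1.1.2‖) < |inner ℝ p.2 p.1.1.2|} :=
    measurableSet_lt (by fun_prop) (by fun_prop)
  refine le_trans (le_of_eq ?_) (prod_measure_le_of_section (μ := dataLaw v σξ) hs fun x =>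
    isoGaussian_abs_inner_gt_le hσ0 x.1.2 ht)
  rw [← ((measurePreserving_eval (fun _ : Fin n => dataLaw v σξ) i).prod
    (measurePreserving_filter (σz := σz) j r)).measure_preimage hs.nullMeasurableSet]
  rfl

lemma runLaw_init_small_le (hσ0 : 0 < σ0) (i : Fin n) :
    runLaw n m v σξ σ0 σz
        {ω | ∀ r, inner ℝ (ω.2.1 (ω.1 i).2 r) (ω.1 i).1.2 < σ0 * ‖(ω.1 i).1.2‖}
      ≤ ENNReal.ofReal (Real.exp (-(gaussianTail * m))) := by
  have hs : MeasurableSet {p : DataPoint d × Weights m d |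
      ∀ r, inner ℝ (p.2 p.1.2 r) p.1.1.2 < σ0 * ‖p.1.1.2‖} := by
    have h1 : {p : DataPoint d × Weights m d |
        ∀ r, inner ℝ (p.2 p.1.2 r) p.1.1.2 < σ0 * ‖p.1.1.2‖}
        = ⋃ b : Bool, {p | p.1.2 = b} ∩
            ⋂ r, {p | inner ℝ (p.2 b r) p.1.1.2 < σ0 * ‖p.1.1.2‖} := by
      ext p; simp
    rw [h1]
    refine MeasurableSet.iUnion fun b => MeasurableSet.inter ?_ (MeasurableSet.iInter fun r =>
      measurableSet_lt (by fun_prop) (by fun_prop))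
    exact (measurable_snd.comp measurable_fst) (measurableSet_singleton b)
  refine le_trans (le_of_eq ?_) (prod_measure_le_of_section (μ := dataLaw v σξ)
    (ν := Measure.pi fun _ : Bool => Measure.pi fun _ : Fin m => isoGaussian d σ0) hs fun x => ?_)
  · rw [← ((measurePreserving_eval (fun _ : Fin n => dataLaw v σξ) i).prod
      (measurePreserving_fst (ν := Measure.infinitePi fun _ : ℕ => isoGaussian d σz))).measure_preimage
      hs.nullMeasurableSet]
    rfl
  · refine le_trans (le_of_eq ?_) (pi_isoGaussian_forall_inner_lt_le (m := m) hσ0 x.1.2)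
    have hs' : MeasurableSet {w : Fin m → Vec d | ∀ r, inner ℝ (w r) x.1.2 < σ0 * ‖x.1.2‖} := by
      rw [show {w : Fin m → Vec d | ∀ r, inner ℝ (w r) x.1.2 < σ0 * ‖x.1.2‖}
        = ⋂ r, {w | inner ℝ (w r) x.1.2 < σ0 * ‖x.1.2‖} by ext; simp]
      exact MeasurableSet.iInter fun r => measurableSet_lt (by fun_prop) (by fun_prop)
    rw [← (measurePreserving_eval (fun _ : Bool => Measure.pi fun _ : Fin m => isoGaussian d σ0)
      x.2).measure_preimage hs'.nullMeasurableSet]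
    rfl

lemma measurableSet_exists_gt {α : Type*} [MeasurableSpace α] {f : α → ℝ} {g : ℕ → α → ℝ}
    (hf : Measurable f) (hg : ∀ k, Measurable (g k)) (T : ℕ) :
    MeasurableSet {x | ∃ k ≤ T, f x < g k x} := by
  rw [show {x | ∃ k ≤ T, f x < g k x} = ⋃ k, ⋃ _ : k ≤ T, {x | f x < g k x} by ext; simp]
  exact MeasurableSet.iUnion fun k => MeasurableSet.iUnion fun _ => measurableSet_lt hf (hg k)

lemma runLaw_private_signal_le (hβ : 0 < β) (hT : T * σz ^ 2 * t ^ 2 ≤ β ^ 2) :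
    runLaw n m v σξ σ0 σz
        {ω | ∃ k ≤ T, β * ‖v‖ < |∑ s ∈ Finset.Icc 1 k, inner ℝ (ω.2.2 s) v|}
      ≤ ENNReal.ofReal (2 * Real.exp (-t ^ 2 / 2)) := by
  have hs : MeasurableSet {z : ℕ → Vec d |
      ∃ k ≤ T, β * ‖v‖ < |∑ s ∈ Finset.Icc 1 k, inner ℝ (z s) v|} :=
    measurableSet_exists_gt (by fun_prop) (fun k => by fun_prop) T
  refine le_trans (le_of_eq ?_) (privateNoise_exists_gt_le v σz T hβ hT)
  rw [← ((measurePreserving_snd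
    (μ := Measure.pi fun _ : Bool => Measure.pi fun _ : Fin m => isoGaussian d σ0)).comp
    (measurePreserving_snd (μ := Measure.pi fun _ : Fin n => dataLaw v σξ))).measure_preimage
      hs.nullMeasurableSet]
  rfl

lemma runLaw_private_noise_le (hβ : 0 < β) (hT : T * σz ^ 2 * t ^ 2 ≤ β ^ 2) (i : Fin n) :
    runLaw n m v σξ σ0 σz
        {ω | ∃ k ≤ T, β * ‖(ω.1 i).1.2‖ < |∑ s ∈ Finset.Icc 1 k, inner ℝ (ω.2.2 s) (ω.1 i).1.2|}
      ≤ ENNReal.ofReal (2 * Real.exp (-t ^ 2 / 2)) := by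
  have hs : MeasurableSet {p : DataPoint d × (ℕ → Vec d) |
      ∃ k ≤ T, β * ‖p.1.1.2‖ < |∑ s ∈ Finset.Icc 1 k, inner ℝ (p.2 s) p.1.1.2|} :=
    measurableSet_exists_gt (by fun_prop) (fun k => by fun_prop) T
  refine le_trans (le_of_eq ?_) (prod_measure_le_of_section (μ := dataLaw v σξ)
    (ν := Measure.infinitePi fun _ : ℕ => isoGaussian d σz) hs fun x =>
      privateNoise_exists_gt_le x.1.2 σz T hβ hT)
  rw [← ((measurePreserving_eval (fun _ : Fin n => dataLaw v σξ) i).prod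
    (measurePreserving_snd
      (μ := Measure.pi fun _ : Bool => Measure.pi fun _ : Fin m => isoGaussian d σ0))).measure_preimage
      hs.nullMeasurableSet]
  rfl

/-- The union bound over all events that make a training run atypical. -/
lemma runLaw_not_typicalRun_le {η p : ℝ} (hd : 0 < d) (hv : v ≠ 0) (hσξ : 0 < σξ) (hσ0 : 0 < σ0)
    (hη : 0 < η) (ht : 0 ≤ t) (hT : T * σz ^ 2 * t ^ 2 ≤ (σ0 / (16 * η)) ^ 2)
    (hp1 : 3 * Real.exp (-(d / 16)) ≤ p) (hp2 : 2 * Real.exp (-t ^ 2 / 2) ≤ p)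
    (hp3 : Real.exp (-(gaussianTail * m)) ≤ p) :
    runLaw n m v σξ σ0 σz {ω | ¬ TypicalRun v (σξ * √(d : ℝ)) (σ0 * (σξ * √(d : ℝ))) (σ0 * ‖v‖)
        (2 * t) (2 * t / √(d : ℝ)) η T ω}
      ≤ ENNReal.ofReal ((6 * n + n * n + 2 * m + 2 * m * n + 1) * p) := by
  set μ := runLaw n m v σξ σ0 σz with hμ
  set N := σξ * √(d : ℝ) with hN
  have hd' : (0 : ℝ) < d := by exact_mod_cast hd
  have hsd : 0 < √(d : ℝ) := Real.sqrt_pos.2 hd'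
  have hN0 : 0 < N := by positivity
  have hp0 : 0 ≤ p := (Real.exp_pos _).le.trans hp3
  have hβ : 0 < σ0 / (16 * η) := by positivity
  have c1 := ENNReal.ofReal_le_ofReal hp1
  have c1' := ENNReal.ofReal_le_ofReal (show 2 * Real.exp (-((d : ℝ) / 16)) ≤ p by
    linarith [Real.exp_pos (-((d : ℝ) / 16))])
  have c2 := ENNReal.ofReal_le_ofReal hp2
  have c3 := ENNReal.ofReal_le_ofReal hp3
  set e := ENNReal.ofReal p with he
  have b1 : μ {ω | ∃ i, (ω.1 i).1.1 ≠ sgn (ω.1 i).2 • v} ≤ n * e := by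
    simpa using measure_exists_le fun i => (runLaw_label_ne_eq_zero (m := m) i).le.trans zero_le
  have b2 : μ {ω | ∃ i, inner ℝ (ω.1 i).1.2 v ≠ 0} ≤ n * e := by
    simpa using measure_exists_le fun i => (runLaw_patch_inner_ne_eq_zero (m := m) hv i).le.trans zero_le
  have b3 : μ {ω | ∃ i, ‖(ω.1 i).1.2‖ ^ 2 < N ^ 2 / 4} ≤ n * e := by
    simpa using measure_exists_le fun i => (runLaw_patch_norm_lt_le (m := m) hv hσξ i).trans c1
  have b4 : μ {ω | ∃ i, 2 * N ^ 2 < ‖(ω.1 i).1.2‖ ^ 2} ≤ n * e := by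
    simpa using measure_exists_le fun i => (runLaw_patch_norm_gt_le (m := m) hv hσξ i).trans c1'
  have b5 : μ {ω | ∃ q : Fin n × Fin n, q.1 ≠ q.2 ∧
      t * (σξ * ‖(ω.1 q.2).1.2‖) < |inner ℝ (ω.1 q.1).1.2 (ω.1 q.2).1.2|} ≤ (n * n : ℕ) * e := by
    have h := measure_exists_le (μ := μ) (P := fun (q : Fin n × Fin n) ω => q.1 ≠ q.2 ∧
      t * (σξ * ‖(ω.1 q.2).1.2‖) < |inner ℝ (ω.1 q.1).1.2 (ω.1 q.2).1.2|) (c := e) fun q => by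
        by_cases hq : q.1 = q.2
        · simp [hq]
        · exact (measure_mono fun ω hω => hω.2).trans
            ((runLaw_patch_corr_le hv hσξ.le ht hq).trans c2)
    simpa using h
  have b6 : μ {ω | ∃ q : Bool × Fin m, t * (σ0 * ‖v‖) < |inner ℝ (ω.2.1 q.1 q.2) v|}
      ≤ (2 * m : ℕ) * e := by
    simpa using measure_exists_le fun q : Bool × Fin m =>
      (runLaw_init_signal_le (n := n) (σξ := σξ) (σz := σz) hσ0.le ht q.1 q.2).trans c2
  have b7 : μ {ω | ∃ q : (Bool × Fin m) × Fin n, t * (σ0 * ‖(ω.1 q.2).1.2‖)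
      < |inner ℝ (ω.2.1 q.1.1 q.1.2) (ω.1 q.2).1.2|} ≤ (2 * m * n : ℕ) * e := by
    simpa using measure_exists_le fun q : (Bool × Fin m) × Fin n =>
      (runLaw_init_noise_le (σz := σz) hσ0.le ht q.1.1 q.1.2 q.2).trans c2
  have b8 : μ {ω | ∃ i, ∀ r, inner ℝ (ω.2.1 (ω.1 i).2 r) (ω.1 i).1.2 < σ0 * ‖(ω.1 i).1.2‖}
      ≤ n * e := by
    simpa using measure_exists_le fun i : Fin n => (runLaw_init_small_le hσ0 i).trans c3
  have b9 := (runLaw_private_signal_le (n := n) (m := m) (v := v) (σξ := σξ) (σ0 := σ0) hβ hT).trans c2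
  have b10 : μ {ω | ∃ i, ∃ k ≤ T, σ0 / (16 * η) * ‖(ω.1 i).1.2‖
      < |∑ s ∈ Finset.Icc 1 k, inner ℝ (ω.2.2 s) (ω.1 i).1.2|} ≤ n * e := by
    simpa using measure_exists_le fun i : Fin n => (runLaw_private_noise_le hβ hT i).trans c2
  refine le_trans (measure_mono ?_) (le_trans (measure_union_le_add b1 <| measure_union_le_add b2 <|
    measure_union_le_add b3 <| measure_union_le_add b4 <| measure_union_le_add b5 <|
    measure_union_le_add b6 <| measure_union_le_add b7 <| measure_union_le_add b8 <|
    measure_union_le_add b9 b10) (le_of_eq ?_))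
  · intro ω hω
    by_contra hcon
    simp only [Set.mem_union, Set.mem_ofPred_eq, not_or, not_exists, not_and, not_lt, not_forall,
      ne_eq, not_not] at hcon
    obtain ⟨g1, g2, g3, g4, g5, g6, g7, g8, g9, g10⟩ := hcon
    refine hω ?_
    have hlow : ∀ i, N / 2 ≤ ‖(ω.1 i).1.2‖ := fun i =>
      abs_le_of_sq_le_sq' (by have := g3 i; linarith [show (N / 2) ^ 2 = N ^ 2 / 4 by ring])
        (norm_nonneg _) |>.2
    have hup : ∀ i, ‖(ω.1 i).1.2‖ ≤ 2 * N := fun i =>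
      abs_le_of_sq_le_sq' (by
        have := g4 i
        linarith [show (2 * N) ^ 2 = 2 * N ^ 2 + 2 * N ^ 2 by ring, sq_nonneg N]) (by positivity) |>.2
    refine ⟨g1, g2, g3, g4, fun i k hik => ?_, fun j r => ?_, fun j r i => ?_, fun i => ?_,
      fun k hk => ?_, fun k hk i => ?_⟩
    · refine (g5 (i, k) hik).trans ?_
      have h1 : σξ ≤ 2 / √(d : ℝ) * ‖(ω.1 k).1.2‖ := by
        calc σξ = 2 / √(d : ℝ) * (N / 2) := by rw [hN]; field_simp
          _ ≤ _ := by gcongr; exact hlow k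
      calc t * (σξ * ‖(ω.1 k).1.2‖) ≤ t * ((2 / √(d : ℝ) * ‖(ω.1 k).1.2‖) * ‖(ω.1 k).1.2‖) := by
            gcongr
        _ = 2 * t / √(d : ℝ) * ‖(ω.1 k).1.2‖ ^ 2 := by ring
    · refine (g6 (j, r)).trans ?_
      have : 0 ≤ t * (σ0 * ‖v‖) := by positivity
      linarith
    · refine (g7 ((j, r), i)).trans ?_
      calc t * (σ0 * ‖(ω.1 i).1.2‖) ≤ t * (σ0 * (2 * N)) := by gcongr; exact hup i
        _ = _ := by ring
    · obtain ⟨r, hr⟩ := g8 i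
      refine ⟨r, le_trans ?_ hr⟩
      calc σ0 * N / 2 = σ0 * (N / 2) := by ring
        _ ≤ _ := by gcongr; exact hlow i
    · calc η * |∑ s ∈ Finset.Icc 1 k, inner ℝ (ω.2.2 s) v| ≤ η * (σ0 / (16 * η) * ‖v‖) := by
            gcongr; exact g9 k hk
        _ = σ0 * ‖v‖ / 16 := by field_simp
        _ ≤ _ := by
            have : 0 ≤ σ0 * ‖v‖ := by positivity
            linarith
    · calc η * |∑ s ∈ Finset.Icc 1 k, inner ℝ (ω.2.2 s) (ω.1 i).1.2|
          ≤ η * (σ0 / (16 * η) * ‖(ω.1 i).1.2‖) := by gcongr; exact g10 i k hk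
        _ ≤ η * (σ0 / (16 * η) * (2 * N)) := by gcongr; exact hup i
        _ = _ := by field_simp; norm_num
  · have h1 : ∀ k : ℕ, (k : ℝ≥0∞) * e = ENNReal.ofReal (k * p) := fun k => by
      rw [ENNReal.ofReal_mul (Nat.cast_nonneg k), ENNReal.ofReal_natCast]
    simp only [h1]
    rw [he]
    rw [← ENNReal.ofReal_add, ← ENNReal.ofReal_add, ← ENNReal.ofReal_add, ← ENNReal.ofReal_add,
      ← ENNReal.ofReal_add, ← ENNReal.ofReal_add, ← ENNReal.ofReal_add, ← ENNReal.ofReal_add,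
      ← ENNReal.ofReal_add]
    · congr 1; push_cast; ring
    all_goals positivity

end BadEvents

/-! ### The parameter regime -/

/-- The constant in the bound for the product of the training time and the growth rate. -/
noncomputable def timeConst (q : ℝ) : ℝ := 32 * 4 ^ (q - 2) / (gate (1 + 3 ^ q) * q)

/-- The factor `A` such that a noise coefficient of size `2 (m A (1 + log d))^{1/q}` makes the
gradient of its sample negligible over the whole training time. -/
noncomputable def saturationConst (q : ℝ) : ℝ :=
  2 * (q + 2 * q * Real.exp 2 * 8 ^ q * timeConst q)

/-- The level `2 (m A ℓ)^{1/q}` above which a noise coefficient is saturated. -/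
noncomputable def saturationLevel (q ℓ : ℝ) (m : ℕ) : ℝ :=
  2 * ((m : ℝ) * (saturationConst q * ℓ)) ^ (1 / q)

/-- The requirements on the polylogarithmic factor `L`, where `ℓ = 1 + log d` and `L₀` bounds the
given polylogarithmic quantities. -/
structure FactorLarge (q L₀ ℓ L : ℝ) : Prop where
  log_le : 128 * ℓ ≤ L
  exponent_le : 4 * q ≤ L
  cross_le : 384 * ℓ * (saturationConst q * ℓ) ≤ L
  signal_le : q * timeConst q * (24 * ℓ) ^ (q - 1) ≤ 8 * L
  jump_le : q * 4 ^ q * (saturationConst q * ℓ) ≤ L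
  tail_le : 8 * ℓ / gaussianTail ≤ L
  private_le : 16384 * timeConst q * ℓ ^ 3 * L₀ ^ 4 ≤ L

lemma timeConst_pos {q : ℝ} (hq : 0 < q) : 0 < timeConst q := by
  have := gate_pos (1 + 3 ^ q)
  unfold timeConst; positivity

lemma saturationConst_ge {q : ℝ} (hq : 0 < q) : 2 * q ≤ saturationConst q := by
  have := timeConst_pos hq
  have h : 0 ≤ 2 * q * Real.exp 2 * 8 ^ q * timeConst q := by positivity
  unfold saturationConst
  linarith

lemma exists_factorLarge {q : ℝ} (hq : 2 < q) (C₀ : ℝ) (K₀ : ℕ) :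
    ∃ (C : ℝ) (K : ℕ), 1 ≤ C ∧ ∀ d : ℕ, 0 < d →
      FactorLarge q (polylog (|C₀|) K₀ d) (1 + Real.log d) (polylog C K d) := by
  have ht := timeConst_pos (show 0 < q by linarith)
  have hA : 0 < saturationConst q := by
    have := saturationConst_ge (show 0 < q by linarith)
    linarith
  have hg := gaussianTail_pos
  set c1 : ℝ := 4 * q
  set c2 : ℝ := 384 * saturationConst q
  set c3 : ℝ := q * timeConst q * 24 ^ (q - 1)
  set c4 : ℝ := q * 4 ^ q * saturationConst q
  set c5 : ℝ := 8 / gaussianTail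
  set c6 : ℝ := 16384 * timeConst q * |C₀| ^ 4
  have h1 : 0 ≤ c1 := by positivity
  have h2 : 0 ≤ c2 := by positivity
  have h3 : 0 ≤ c3 := by positivity
  have h4 : 0 ≤ c4 := by positivity
  have h5 : 0 ≤ c5 := by positivity
  have h6 : 0 ≤ c6 := by positivity
  refine ⟨128 + c1 + c2 + c3 + c4 + c5 + c6, ⌈q⌉₊ + 3 + 4 * K₀, by linarith, fun d hd => ?_⟩
  have hℓ : 1 ≤ 1 + Real.log d := by
    have := Real.log_nonneg (show (1 : ℝ) ≤ d by exact_mod_cast hd)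
    linarith
  unfold polylog
  set ℓ := 1 + Real.log d
  set K := ⌈q⌉₊ + 3 + 4 * K₀ with hK
  have hpow : ∀ k ≤ K, ℓ ^ k ≤ ℓ ^ K := fun k hk => pow_le_pow_right₀ hℓ hk
  have hpos : 0 < ℓ ^ K := by positivity
  have key : ∀ c x : ℝ, 0 ≤ c → c ≤ 128 + c1 + c2 + c3 + c4 + c5 + c6 → x ≤ ℓ ^ K →
      c * x ≤ (128 + c1 + c2 + c3 + c4 + c5 + c6) * ℓ ^ K := by
    intro c x hc0 hc hx
    calc c * x ≤ c * ℓ ^ K := by gcongr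
      _ ≤ _ := by gcongr
  have hℓ1 : ℓ ≤ ℓ ^ K := by simpa using hpow 1 (by omega)
  refine ⟨key _ _ (by norm_num) (by linarith) hℓ1, ?_, ?_, ?_, ?_, ?_, ?_⟩
  · simpa using key c1 1 h1 (by linarith) (one_le_pow₀ hℓ)
  · refine le_trans (le_of_eq ?_) (key c2 (ℓ ^ 2) h2 (by linarith) (hpow 2 (by omega)))
    simp only [c2]; ring
  · have h7 : ℓ ^ (q - 1) ≤ ℓ ^ K := by
      rw [← Real.rpow_natCast]
      refine Real.rpow_le_rpow_of_exponent_le hℓ ?_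
      have h8 := Nat.le_ceil q
      rw [hK]; push_cast
      have : (0 : ℝ) ≤ K₀ := Nat.cast_nonneg _
      linarith
    have h9 := key c3 _ h3 (by linarith) h7
    have h10 : 0 ≤ (128 + c1 + c2 + c3 + c4 + c5 + c6) * ℓ ^ K := by positivity
    rw [Real.mul_rpow (by norm_num) (by linarith), ← mul_assoc]
    linarith
  · refine le_trans (le_of_eq ?_) (key c4 ℓ h4 (by linarith) hℓ1)
    simp only [c4]; ring
  · refine le_trans (le_of_eq ?_) (key c5 ℓ h5 (by linarith) hℓ1)
    simp only [c5]; ring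
  · refine le_trans (le_of_eq ?_) (key c6 (ℓ ^ (3 + 4 * K₀)) h6 (by linarith) (hpow _ (by omega)))
    simp only [c6]; rw [pow_add, pow_mul, mul_pow, ← pow_mul, ← pow_mul, mul_comm K₀ 4]; ring

/-- The consequences of the conditions of data noise memorization that the analysis uses, in terms
of `V = ‖v‖`, `N = σξ √d` and `a = σ0 N`. -/
structure ScaleBounds (L q : ℝ) (n m d : ℕ) (V N a η ε : ℝ) : Prop where
  one_le_L : 1 ≤ L
  hd : 0 < d
  hn : 1 ≤ n
  hm : 1 ≤ m
  width_large : L ≤ m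
  dim_large : L ≤ d
  mul_le_dim : (m : ℝ) * n ≤ d
  step_small : η * N ^ 2 * L ≤ 1
  /-- The lower bound for the initialization in terms of the privacy budget. -/
  privacy : L ≤ a ^ (q - 1) * ε
  init_lower : L * ((m : ℝ) ^ (1 / q) * (n / √(d : ℝ))) ≤ a
  init_upper : a * L ≤ 1
  snr : n * (V / N) ^ q * L ≤ 1
  signal_le : V ≤ N

lemma NoiseMemorizationCondition.scaleBounds {L q : ℝ} {n m d : ℕ} {v : Vec d} {σξ σ0 η ε : ℝ}
    (h : NoiseMemorizationCondition L q n m v σξ σ0 η ε) (hq : 2 < q) (hL : 1 ≤ L) (hv : v ≠ 0)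
    (hσξ : 0 < σξ) (hσ0 : 0 < σ0) (hε : 0 < ε)
    (hsnr : L ≤ SNR v σξ ^ (-q) * (n : ℝ)⁻¹) :
    ScaleBounds L q n m d ‖v‖ (σξ * √(d : ℝ)) (σ0 * (σξ * √(d : ℝ))) η ε := by
  have hL0 : 0 < L := by linarith
  have hn1 : (1 : ℝ) ≤ n := hL.trans h.samples_large
  have hm1 : (1 : ℝ) ≤ m := hL.trans h.width_large
  have hm2 : (m : ℝ) ≤ (m : ℝ) ^ max 2 (4 / (q - 2)) := by
    nth_rw 1 [← Real.rpow_one (m : ℝ)]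
    exact Real.rpow_le_rpow_of_exponent_le hm1 (le_trans (by norm_num) (le_max_left _ _))
  have hn2 : (n : ℝ) ≤ (n : ℝ) ^ max 4 ((2 * q - 2) / (q - 2)) := by
    nth_rw 1 [← Real.rpow_one (n : ℝ)]
    exact Real.rpow_le_rpow_of_exponent_le hn1 (le_trans (by norm_num) (le_max_left _ _))
  have hprod : L * ((m : ℝ) * n) ≤ d := by
    refine le_trans ?_ h.dim_large
    gcongr
  have hmn : 1 ≤ (m : ℝ) * n := one_le_mul_of_one_le_of_one_le hm1 hn1
  have hdL : L ≤ d := by nlinarith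
  have hmnd : (m : ℝ) * n ≤ d := by nlinarith
  have hd0 : (0 : ℝ) < d := by linarith
  have hsd : 0 < √(d : ℝ) := Real.sqrt_pos.2 hd0
  set N := σξ * √(d : ℝ) with hN
  have hN0 : 0 < N := by positivity
  have hV : 0 < ‖v‖ := norm_pos_iff.2 hv
  have hup := h.init_upper
  have haL : σ0 * N * L ≤ 1 := by
    have h1 : σ0 ≤ N⁻¹ / L := hup.trans (by gcongr; exact min_le_right _ _)
    calc σ0 * N * L ≤ N⁻¹ / L * N * L := by gcongr
      _ = 1 := by field_simp
  have ha0 : 0 < σ0 * N := by positivity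
  have ha1 : σ0 * N ≤ 1 := by nlinarith
  have hspos : 0 < ‖v‖ / N := by positivity
  have hsnr' : n * (‖v‖ / N) ^ q * L ≤ 1 := by
    have h1 : L ≤ ((‖v‖ / N) ^ q)⁻¹ * (n : ℝ)⁻¹ := by
      rw [SNR, Real.rpow_neg (by positivity)] at hsnr
      exact hsnr
    have h2 : 0 < (‖v‖ / N) ^ q := by positivity
    calc n * (‖v‖ / N) ^ q * L ≤ n * (‖v‖ / N) ^ q * (((‖v‖ / N) ^ q)⁻¹ * (n : ℝ)⁻¹) := by gcongr
      _ = 1 := by field_simp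
  refine ⟨hL, by exact_mod_cast hd0, by exact_mod_cast hn1, by exact_mod_cast hm1, h.width_large,
    hdL, hmnd, ?_, ?_, ?_, haL, hsnr', ?_⟩
  · have h1 : η ≤ (N ^ 2)⁻¹ / L :=
      h.stepsize_small.trans (by gcongr; exact min_le_right _ _)
    calc η * N ^ 2 * L ≤ (N ^ 2)⁻¹ / L * N ^ 2 * L := by gcongr
      _ = 1 := by field_simp
  · have h1 : L * (ε ^ (-(1 / q)) * N⁻¹) ≤ σ0 :=
      le_trans (by gcongr; exact le_max_left _ _) h.init_lower
    have h2 : L * ε ^ (-(1 / q)) ≤ σ0 * N := by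
      calc L * ε ^ (-(1 / q)) = L * (ε ^ (-(1 / q)) * N⁻¹) * N := by field_simp
        _ ≤ _ := by gcongr
    have h3 := Real.rpow_le_rpow (by positivity) h2 (show 0 ≤ q by linarith)
    rw [Real.mul_rpow (by positivity) (by positivity), ← Real.rpow_mul hε.le,
      show -(1 / q) * q = -1 by field_simp, Real.rpow_neg_one] at h3
    have h4 : L ≤ L ^ q := by
      nth_rw 1 [← Real.rpow_one L]
      exact Real.rpow_le_rpow_of_exponent_le hL (by linarith)
    have h5 : (σ0 * N) ^ q ≤ (σ0 * N) ^ (q - 1) :=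
      Real.rpow_le_rpow_of_exponent_ge ha0 ha1 (by linarith)
    calc L ≤ L ^ q := h4
      _ = L ^ q * ε⁻¹ * ε := by field_simp
      _ ≤ (σ0 * N) ^ (q - 1) * ε := by gcongr; exact h3.trans h5
  · have h1 := h.init_lower_width
    calc L * ((m : ℝ) ^ (1 / q) * (n / √(d : ℝ)))
        = L * ((m : ℝ) ^ (1 / q) * ((n : ℝ) / √(d : ℝ)) * N⁻¹) * N := by field_simp
      _ ≤ _ := by gcongr
  · have h1 : (‖v‖ / N) ^ q ≤ 1 := by
      have h2 : 0 < (‖v‖ / N) ^ q := by positivity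
      have h3 : 1 ≤ n * L := one_le_mul_of_one_le_of_one_le hn1 hL
      nlinarith
    have h2 : ‖v‖ / N ≤ 1 := by
      by_contra hcon
      exact absurd h1 (not_le.2 (Real.one_lt_rpow (not_le.1 hcon) (by linarith)))
    exact (div_le_one hN0).1 h2

section Scale

variable {L q L₀ : ℝ} {n m d T : ℕ} {V N a η ε : ℝ}

lemma growthRate_pos (hq : 0 < q) (hη : 0 < η) (hN : 0 < N) (ha : 0 < a) (hn : 1 ≤ n) (hm : 1 ≤ m) :
    0 < growthRate q η N a n m := by
  have := gate_pos (1 + 3 ^ q)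
  have hn' : (0 : ℝ) < n := by exact_mod_cast hn
  have hm' : (0 : ℝ) < m := by exact_mod_cast hm
  unfold growthRate; positivity

lemma ScaleBounds.inv_sqrt_le (h : ScaleBounds L q n m d V N a η ε) (hq : 0 < q) :
    1 / √(d : ℝ) ≤ a := by
  have hL := h.one_le_L
  have hn : (1 : ℝ) ≤ n := by exact_mod_cast h.hn
  have hm : (1 : ℝ) ≤ m := by exact_mod_cast h.hm
  have h1 : 1 ≤ (m : ℝ) ^ (1 / q) := Real.one_le_rpow hm (by positivity)
  refine le_trans ?_ h.init_lower
  have h2 : 1 / √(d : ℝ) ≤ n / √(d : ℝ) := by gcongr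
  have h3 : 0 ≤ n / √(d : ℝ) := by positivity
  calc 1 / √(d : ℝ) ≤ 1 * (1 * (n / √(d : ℝ))) := by linarith
    _ ≤ _ := by gcongr

lemma ScaleBounds.inv_le (h : ScaleBounds L q n m d V N a η ε) (hq : 0 < q) : 1 / a ≤ d := by
  have hd : (1 : ℝ) ≤ d := by exact_mod_cast h.hd
  have hsd : 0 < √(d : ℝ) := Real.sqrt_pos.2 (by linarith)
  have h1 := one_div_le_one_div_of_le (by positivity) (h.inv_sqrt_le hq)
  rw [one_div_one_div] at h1
  exact h1.trans (Real.sqrt_le_iff.2 ⟨by linarith, by nlinarith⟩)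

lemma ScaleBounds.log_le (h : ScaleBounds L q n m d V N a η ε) (hq : 0 < q) (ha : 0 < a) :
    Real.log (1 / a) ≤ 1 + Real.log d := by
  have := Real.log_le_log (by positivity) (h.inv_le hq)
  linarith

/-- The training time is inversely proportional to the growth rate. -/
lemma ScaleBounds.time_le (h : ScaleBounds L q n m d V N a η ε) (hq : 2 < q) (ha : 0 < a)
    (hT : T * growthRate q η N a n m ≤ 8 * Real.log (1 / a)) :
    T * (η / ((n : ℝ) * m)) * (a ^ (q - 2) * N ^ 2) ≤ timeConst q * (1 + Real.log d) := by
  have hg := gate_pos (1 + 3 ^ q)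
  have h1 : T * (η / ((n : ℝ) * m)) * (a ^ (q - 2) * N ^ 2)
      = T * growthRate q η N a n m * (timeConst q / 8) := by
    rw [growthRate, timeConst, Real.div_rpow ha.le (by norm_num)]
    have : (0 : ℝ) < 4 ^ (q - 2) := by positivity
    field_simp
    ring
  rw [h1]
  have ht := timeConst_pos (show 0 < q by linarith)
  have hlog := h.log_le (by linarith) ha
  have h2 : T * growthRate q η N a n m ≤ 8 * (1 + Real.log d) := by linarith
  calc _ ≤ 8 * (1 + Real.log d) * (timeConst q / 8) := by gcongr
    _ = _ := by ring

lemma mul_exp_neg_half_le_one (u : ℝ) : u * Real.exp (-(u / 2)) ≤ 1 := by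
  have h1 : u ≤ Real.exp (u / 2) := by
    have h2 := Real.quadratic_le_exp_of_nonneg (x := |u| / 2) (by positivity)
    rcases le_or_gt 0 u with hu | hu
    · rw [abs_of_nonneg hu] at h2
      nlinarith [sq_nonneg (u / 2 - 1)]
    · exact hu.le.trans (Real.exp_pos _).le
  calc u * Real.exp (-(u / 2)) ≤ Real.exp (u / 2) * Real.exp (-(u / 2)) := by gcongr
    _ = 1 := by rw [← Real.exp_add]; simp

lemma saturationLevel_rpow (hq : 0 < q) {ℓ : ℝ} (hℓ : 0 ≤ ℓ) :
    (saturationLevel q ℓ m / 2) ^ q = m * (saturationConst q * ℓ) := by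
  have hA := saturationConst_ge hq
  rw [saturationLevel, mul_div_cancel_left₀ _ (two_ne_zero), ← Real.rpow_mul
    (mul_nonneg (Nat.cast_nonneg m) (mul_nonneg (by linarith) hℓ)), one_div_mul_cancel hq.ne',
    Real.rpow_one]

/-- Above the saturation level the remaining growth over the whole training time is bounded. -/
lemma ScaleBounds.saturated_total (h : ScaleBounds L q n m d V N a η ε) (hq : 2 < q) (ha : 0 < a)
    (hT : T * growthRate q η N a n m ≤ 8 * Real.log (1 / a))
    (hM : 1 ≤ saturationLevel q (1 + Real.log d) m) :
    T * saturatedStep q η N (saturationLevel q (1 + Real.log d) m) n m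
      ≤ saturationLevel q (1 + Real.log d) m := by
  have hd : (1 : ℝ) ≤ d := by exact_mod_cast h.hd
  have hm : (1 : ℝ) ≤ m := by exact_mod_cast h.hm
  have hn : (1 : ℝ) ≤ n := by exact_mod_cast h.hn
  have hlog := Real.log_nonneg hd
  have hA := saturationConst_ge (show 0 < q by linarith)
  have ht := timeConst_pos (show 0 < q by linarith)
  have hpow := saturationLevel_rpow (q := q) (m := m) (by linarith)
    (show 0 ≤ 1 + Real.log d by linarith)
  set ℓ := 1 + Real.log d with hℓ
  set M := saturationLevel q ℓ m with hMdef
  set u := saturationConst q * ℓ with hu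
  have hu0 : 0 < u := mul_pos (by linarith) (by linarith)
  have hM0 : 0 < M := by linarith
  have hMq : M ^ q = 2 ^ q * (m * u) := by
    rw [← hpow, ← Real.mul_rpow (by norm_num) (by positivity), mul_div_cancel₀ _ two_ne_zero]
  have hmle : (m : ℝ) ≤ d := le_trans (le_mul_of_one_le_right (by linarith) hn) h.mul_le_dim
  have hℓd : ℓ ≤ d := by
    have := Real.log_le_sub_one_of_pos (show (0 : ℝ) < d by linarith)
    linarith
  have h4M : (4 * M) ^ (q - 1) ≤ 8 ^ q * (m * u) * M := by
    have h1 : M ^ (q - 2) ≤ M ^ q := Real.rpow_le_rpow_of_exponent_le hM (by linarith)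
    have h2 : (4 : ℝ) ^ (q - 1) ≤ 4 ^ q :=
      Real.rpow_le_rpow_of_exponent_le (by norm_num) (by linarith)
    have h3 : (8 : ℝ) ^ q = 4 ^ q * 2 ^ q := by
      rw [← Real.mul_rpow (by norm_num) (by norm_num)]; norm_num
    rw [Real.mul_rpow (by norm_num) hM0.le, show q - 1 = (q - 2) + 1 by ring,
      Real.rpow_add_one hM0.ne', show (q - 2) + 1 = q - 1 by ring]
    calc (4 : ℝ) ^ (q - 1) * (M ^ (q - 2) * M) ≤ 4 ^ q * (M ^ q * M) := by gcongr
      _ = _ := by rw [hMq, h3]; ring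
  have hainv : (a ^ (q - 2))⁻¹ ≤ (d : ℝ) ^ (q - 2) := by
    rw [← Real.inv_rpow ha.le, inv_eq_one_div]
    exact Real.rpow_le_rpow (by positivity) (h.inv_le (by linarith)) (by linarith)
  set B := 2 * q * Real.exp 2 * 8 ^ q * timeConst q with hB
  have hB0 : 0 < B := by positivity
  have hexp : B * (d : ℝ) ^ q * (u * Real.exp (-u)) ≤ 1 := by
    have h1 : B * (d : ℝ) ^ q ≤ Real.exp (u / 2) := by
      have h2 : u / 2 = q * ℓ + B * ℓ := by rw [hu, saturationConst]; ring
      have h3 : B ≤ Real.exp (B * ℓ) := by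
        have h4 := Real.add_one_le_exp (B * ℓ)
        have h5 : B ≤ B * ℓ := le_mul_of_one_le_right hB0.le (by linarith)
        linarith
      have h4 : (d : ℝ) ^ q ≤ Real.exp (q * ℓ) := by
        rw [Real.rpow_def_of_pos (by linarith)]
        exact Real.exp_le_exp.2 (by nlinarith)
      rw [h2, Real.exp_add, mul_comm]
      gcongr
    calc B * (d : ℝ) ^ q * (u * Real.exp (-u))
        ≤ Real.exp (u / 2) * (u * Real.exp (-u)) := by gcongr
      _ = u * (Real.exp (u / 2) * Real.exp (-u)) := by ring
      _ = u * Real.exp (-(u / 2)) := by rw [← Real.exp_add]; ring_nf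
      _ ≤ 1 := mul_exp_neg_half_le_one u
  have htime := h.time_le hq ha hT
  have hapos : 0 < a ^ (q - 2) := by positivity
  have hexp2 : Real.exp (2 - (M / 2) ^ q / m) = Real.exp 2 * Real.exp (-u) := by
    rw [hpow, mul_div_cancel_left₀ _ (by linarith), ← Real.exp_add, sub_eq_add_neg]
  calc T * saturatedStep q η N M n m
      = (T * (η / ((n : ℝ) * m)) * (a ^ (q - 2) * N ^ 2)) * ((a ^ (q - 2))⁻¹ *
          (2 * q * Real.exp 2 * Real.exp (-u) * (4 * M) ^ (q - 1))) := by
        rw [saturatedStep, hexp2]; field_simp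
    _ ≤ (timeConst q * ℓ) * ((d : ℝ) ^ (q - 2) *
          (2 * q * Real.exp 2 * Real.exp (-u) * (8 ^ q * (m * u) * M))) := by
        gcongr
    _ ≤ (timeConst q * d) * ((d : ℝ) ^ (q - 2) *
          (2 * q * Real.exp 2 * Real.exp (-u) * (8 ^ q * (d * u) * M))) := by
        gcongr
    _ = B * ((d : ℝ) ^ (q - 2) * d * d) * (u * Real.exp (-u)) * M := by rw [hB]; ring
    _ = B * (d : ℝ) ^ q * (u * Real.exp (-u)) * M := by
        rw [← Real.rpow_add_one (by linarith), ← Real.rpow_add_one (by linarith)]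
        ring_nf
    _ ≤ 1 * M := by gcongr
    _ = M := one_mul M

lemma ScaleBounds.regime (h : ScaleBounds L q n m d V N a η ε)
    (hL : FactorLarge q L₀ (1 + Real.log d) L) (hq : 2 < q) (hη : 0 < η) (hV : 0 < V) (hN : 0 < N)
    (ha : 0 < a) (hT : T * growthRate q η N a n m ≤ 8 * Real.log (1 / a))
    (hT' : 8 * Real.log (1 / a) ≤ (T + 1) * growthRate q η N a n m) :
    Regime q η N V a (a * (V / N)) (8 * (1 + Real.log d)) (saturationLevel q (1 + Real.log d) m)
      (8 * (1 + Real.log d) / √(d : ℝ)) n m T := by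
  have hd : (1 : ℝ) ≤ d := by exact_mod_cast h.hd
  have hm : (1 : ℝ) ≤ m := by exact_mod_cast h.hm
  have hn : (1 : ℝ) ≤ n := by exact_mod_cast h.hn
  have hlog := Real.log_nonneg hd
  have hA := saturationConst_ge (show 0 < q by linarith)
  have ht := timeConst_pos (show 0 < q by linarith)
  have hpow := saturationLevel_rpow (q := q) (m := m) (by linarith)
    (show 0 ≤ 1 + Real.log d by linarith)
  have hstep := h.step_small
  have haL := h.init_upper
  have hL1 := h.one_le_L
  have hsd : 0 < √(d : ℝ) := Real.sqrt_pos.2 (by linarith)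
  have htime := h.time_le hq ha hT
  have hsat := h.saturated_total hq ha hT
  have l1 := hL.log_le; have l2 := hL.exponent_le; have l3 := hL.cross_le
  have l4 := hL.signal_le; have l5 := hL.jump_le
  set ℓ := 1 + Real.log d with hℓ
  have hℓ1 : 1 ≤ ℓ := by linarith
  set u := saturationConst q * ℓ with hu
  have hu1 : 1 ≤ u := one_le_mul_of_one_le_of_one_le (by linarith) hℓ1
  have hM : 1 ≤ saturationLevel q ℓ m := by
    have : 1 ≤ ((m : ℝ) * (saturationConst q * ℓ)) ^ (1 / q) :=
      Real.one_le_rpow (one_le_mul_of_one_le_of_one_le hm hu1) (by positivity)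
    unfold saturationLevel
    linarith
  have hsat := hsat hM
  have hMle : saturationLevel q ℓ m ≤ 2 * ((m : ℝ) ^ (1 / q) * u) := by
    rw [saturationLevel, Real.mul_rpow (by linarith) (by linarith)]
    have : u ^ (1 / q) ≤ u := by
      nth_rw 2 [← Real.rpow_one u]
      exact Real.rpow_le_rpow_of_exponent_le hu1 ((div_le_one (by linarith)).2 (by linarith))
    gcongr
  set M := saturationLevel q ℓ m with hMdef
  have hM0 : 0 < M := by linarith
  set s := V / N with hs
  have hs0 : 0 < s := by positivity
  have hs1 : s ≤ 1 := (div_le_one hN).2 h.signal_le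
  have hVs : V = s * N := by rw [hs]; field_simp
  have hb : a * s ≤ a := mul_le_of_le_one_right ha.le hs1
  have hsmall : 128 * ℓ * a ≤ 1 := by
    calc 128 * ℓ * a ≤ L * a := by gcongr
      _ ≤ 1 := by linarith
  have haℓ : a ≤ ℓ * a := le_mul_of_one_le_left ha.le hℓ1
  have hsℓ : ℓ * (a * s) ≤ ℓ * a := by gcongr
  have hηN : 0 < η * N ^ 2 := by positivity
  have hmn : 1 ≤ (n : ℝ) * m := one_le_mul_of_one_le_of_one_le hn hm
  have hηnm : η / ((n : ℝ) * m) * N ^ 2 ≤ η * N ^ 2 := by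
    gcongr
    exact div_le_self hη.le hmn
  have hκ1 : growthRate q η N a n m ≤ 1 := by
    have h1 : (a / 4) ^ (q - 2) ≤ 1 := Real.rpow_le_one (by positivity) (by linarith) (by linarith)
    have h2 := gate_le_one (1 + 3 ^ q)
    have h3 := gate_pos (1 + 3 ^ q)
    calc growthRate q η N a n m
        = (η / ((n : ℝ) * m) * N ^ 2) * (gate (1 + 3 ^ q) * q * (a / 4) ^ (q - 2)) / 4 := by
          rw [growthRate]; ring
      _ ≤ (η * N ^ 2) * (1 * q * 1) / 4 := by gcongr
      _ ≤ η * N ^ 2 * L := by nlinarith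
      _ ≤ 1 := hstep
  refine ⟨hq, h.hn, h.hm, hη, by linarith, hN, ha, by positivity, hM, by positivity, ?_, ?_, ?_, ?_,
    ?_, ?_, hsat, hκ1, ?_⟩
  · linarith
  · linarith
  · have h1 := h.init_lower
    have hx : 0 ≤ (m : ℝ) ^ (1 / q) * (n / √(d : ℝ)) := by positivity
    calc n * (8 * ℓ / √(d : ℝ)) * (3 * M)
        ≤ n * (8 * ℓ / √(d : ℝ)) * (3 * (2 * ((m : ℝ) ^ (1 / q) * u))) := by gcongr
      _ = (384 * ℓ * u) * ((m : ℝ) ^ (1 / q) * (n / √(d : ℝ))) / 8 := by ring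
      _ ≤ L * ((m : ℝ) ^ (1 / q) * (n / √(d : ℝ))) / 8 := by gcongr
      _ ≤ a / 8 := by gcongr
  · have h0 : 0 < 2 * (8 * ℓ) * a := by positivity
    have h1 : (2 * (8 * ℓ) * a) ^ (q - 1) ≤ 2 * (8 * ℓ) * a := by
      nth_rw 2 [← Real.rpow_one (2 * (8 * ℓ) * a)]
      exact Real.rpow_le_rpow_of_exponent_ge h0 (by linarith) (by linarith)
    calc η / ((n : ℝ) * m) * (q * (2 * (8 * ℓ) * a) ^ (q - 1)) * (2 * N ^ 2)
        = (η / ((n : ℝ) * m) * N ^ 2) * (2 * q * (2 * (8 * ℓ) * a) ^ (q - 1)) := by ring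
      _ ≤ (η * N ^ 2) * (2 * q * (2 * (8 * ℓ) * a)) := by gcongr
      _ = (η * N ^ 2 * (4 * q)) * (8 * ℓ * a) := by ring
      _ ≤ (η * N ^ 2 * L) * (8 * ℓ * a) := by gcongr
      _ ≤ 1 * (8 * ℓ * a) := by gcongr
      _ = 8 * ℓ * a := one_mul _
  · have h1 : (3 * (8 * ℓ) * (a * s)) ^ (q - 1)
        = (24 * ℓ) ^ (q - 1) * (a ^ (q - 2) * a) * s ^ (q - 1) := by
      rw [show 3 * (8 * ℓ) * (a * s) = 24 * ℓ * a * s by ring,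
        Real.mul_rpow (by positivity) hs0.le, Real.mul_rpow (by positivity) ha.le,
        ← Real.rpow_add_one ha.ne']
      ring_nf
    have h2 : s ^ q = s ^ (q - 1) * s := by rw [← Real.rpow_add_one hs0.ne']; ring_nf
    have h3 := h.snr
    rw [← hs] at h3
    have hL0 : 0 < L := by linarith
    have h4 : n * s ^ q ≤ 1 / L := by rw [le_div_iff₀ hL0]; exact h3
    calc T * signalStep q η V (a * s) (8 * ℓ) m
        = (T * (η / ((n : ℝ) * m)) * (a ^ (q - 2) * N ^ 2)) * (q * (24 * ℓ) ^ (q - 1)) *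
            (n * s ^ q) * (a * s) := by
          rw [signalStep, h1, h2, hVs]; field_simp
      _ ≤ (timeConst q * ℓ) * (q * (24 * ℓ) ^ (q - 1)) * (1 / L) * (a * s) := by gcongr
      _ = (q * timeConst q * (24 * ℓ) ^ (q - 1)) * (1 / L) * ℓ * (a * s) := by ring
      _ ≤ (8 * L) * (1 / L) * ℓ * (a * s) := by gcongr
      _ = 8 * ℓ * (a * s) := by field_simp
  · have hMq : M ^ q = 2 ^ q * (m * u) := by
      rw [← hpow, ← Real.mul_rpow (by norm_num) (by positivity), mul_div_cancel₀ _ two_ne_zero]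
    have h4M : (2 * M) ^ (q - 1) ≤ 4 ^ q / 2 * (m * u) * M := by
      have h1 : M ^ (q - 2) ≤ M ^ q := Real.rpow_le_rpow_of_exponent_le hM (by linarith)
      have h3 : (4 : ℝ) ^ q = 2 ^ (q - 1) * 2 * 2 ^ q := by
        rw [← Real.rpow_add_one (by norm_num), show q - 1 + 1 = q by ring,
          ← Real.mul_rpow (by norm_num) (by norm_num)]; norm_num
      rw [Real.mul_rpow (by norm_num) hM0.le, show q - 1 = (q - 2) + 1 by ring,
        Real.rpow_add_one hM0.ne', show (q - 2) + 1 = q - 1 by ring]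
      calc (2 : ℝ) ^ (q - 1) * (M ^ (q - 2) * M) ≤ 2 ^ (q - 1) * (M ^ q * M) := by gcongr
        _ = _ := by rw [hMq, h3]; ring
    calc η / ((n : ℝ) * m) * (q * (2 * M) ^ (q - 1)) * (2 * N ^ 2)
        ≤ η / ((n : ℝ) * m) * (q * (4 ^ q / 2 * (m * u) * M)) * (2 * N ^ 2) := by gcongr
      _ = (η * N ^ 2) * (q * 4 ^ q * u) / n * M := by field_simp
      _ ≤ (η * N ^ 2) * L / 1 * M := by gcongr
      _ ≤ 1 * M := by rw [div_one]; gcongr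
      _ = M := one_mul M
  · have hinv : 12 ≤ 1 / a := by rw [le_div_iff₀ ha]; linarith
    have h1 : Real.log 12 ≤ Real.log (1 / a) := Real.log_le_log (by norm_num) hinv
    have h2 : 1 ≤ Real.log 12 := by
      rw [Real.le_log_iff_exp_le (by norm_num)]
      linarith [Real.exp_one_lt_d9]
    have h3 : Real.log (12 / a) = Real.log 12 + Real.log (1 / a) := by
      rw [← Real.log_mul (by norm_num) (by positivity)]; congr 1; ring
    rw [h3]
    linarith

/-- The private noise accumulated over the training time is small compared with the initialization:
this is the variance condition of `runLaw_not_typicalRun_le` at the tail level `4 (1 + log d)`. -/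
lemma ScaleBounds.private_noise_le {σ0 σξ ε δ S : ℝ} {T₀ : ℕ} {v : Vec d}
    (h : ScaleBounds L q n m d ‖v‖ (σξ * √(d : ℝ)) (σ0 * (σξ * √(d : ℝ))) η ε)
    (hL : FactorLarge q L₀ (1 + Real.log d) L) (hq : 2 < q) (hη : 0 < η) (hσξ : 0 < σξ)
    (hσ0 : 0 < σ0) (hε : 0 < ε) (hδ : 0 < δ) (hδ1 : δ < 1) (hlogδ : Real.log (1.25 / δ) ≤ L₀)
    (hS : 0 < S) (hSL : S ≤ L₀)
    (hT₀ : (T₀ : ℝ) ≤ L₀ * (σ0 * m * n * ε / (η * (‖v‖ + σξ * √(d : ℝ)))))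
    (hT : T * growthRate q η (σξ * √(d : ℝ)) (σ0 * (σξ * √(d : ℝ))) n m
      ≤ 8 * Real.log (1 / (σ0 * (σξ * √(d : ℝ))))) :
    T * privateNoiseScale S T₀ n m v σξ ε δ ^ 2 * (4 * (1 + Real.log d)) ^ 2
      ≤ (σ0 / (16 * η)) ^ 2 := by
  have hd : (1 : ℝ) ≤ d := by exact_mod_cast h.hd
  have hm : (1 : ℝ) ≤ m := by exact_mod_cast h.hm
  have hn : (1 : ℝ) ≤ n := by exact_mod_cast h.hn
  have hlog := Real.log_nonneg hd
  have ht := timeConst_pos (show 0 < q by linarith)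
  have hsd : 0 < √(d : ℝ) := Real.sqrt_pos.2 (by linarith)
  set N := σξ * √(d : ℝ) with hN
  have hN0 : 0 < N := by positivity
  have ha : 0 < σ0 * N := by positivity
  have htime := h.time_le hq ha hT
  have hpriv := h.privacy
  have hL1 := h.one_le_L
  have l7 := hL.private_le
  set ℓ := 1 + Real.log d with hℓ
  set a := σ0 * N with hadef
  set V := ‖v‖ with hV
  have hV0 : 0 ≤ V := norm_nonneg v
  have hL₀ : 0 < L₀ := hS.trans_le hSL
  have hlogδ0 : 0 ≤ Real.log (1.25 / δ) := by
    refine Real.log_nonneg ?_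
    rw [le_div_iff₀ hδ]; linarith
  have hscale : privateNoiseScale S T₀ n m v σξ ε δ ^ 2
      = T₀ * (S * (V + N) / ((n : ℝ) * m)) ^ 2 * (2 * Real.log (1.25 / δ)) / ε ^ 2 := by
    rw [privateNoiseScale, gaussianMechanismScale, mul_pow, div_pow, mul_pow,
      Real.sq_sqrt (Nat.cast_nonneg _), Real.sq_sqrt (by positivity)]
    ring
  have hap : a ^ (q - 1) = a ^ (q - 2) * a := by
    rw [← Real.rpow_add_one ha.ne']; ring_nf
  have hapos : 0 < a ^ (q - 2) := by positivity
  have hVN : V + N ≤ 2 * N := by linarith [h.signal_le]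
  have hinv : (a ^ (q - 1) * ε)⁻¹ ≤ L⁻¹ := inv_anti₀ (by linarith) hpriv
  have hVN0 : 0 < V + N := by linarith
  rw [hscale]
  calc T * (T₀ * (S * (V + N) / ((n : ℝ) * m)) ^ 2 * (2 * Real.log (1.25 / δ)) / ε ^ 2) * (4 * ℓ) ^ 2
      ≤ T * (L₀ * (σ0 * m * n * ε / (η * (V + N))) * (L₀ * (V + N) / ((n : ℝ) * m)) ^ 2 * (2 * L₀)
          / ε ^ 2) * (4 * ℓ) ^ 2 := by gcongr
    _ = (T * (η / ((n : ℝ) * m)) * (a ^ (q - 2) * N ^ 2)) *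
          (32 * L₀ ^ 4 * ℓ ^ 2 * (V + N) * σ0 / (η ^ 2 * (a ^ (q - 2) * N ^ 2) * ε)) := by
        field_simp; ring
    _ ≤ (timeConst q * ℓ) *
          (32 * L₀ ^ 4 * ℓ ^ 2 * (2 * N) * σ0 / (η ^ 2 * (a ^ (q - 2) * N ^ 2) * ε)) := by gcongr
    _ = (16384 * timeConst q * ℓ ^ 3 * L₀ ^ 4) * (a ^ (q - 1) * ε)⁻¹ * (σ0 / (16 * η)) ^ 2 := by
        rw [hap, hadef]; field_simp; ring
    _ ≤ L * L⁻¹ * (σ0 / (16 * η)) ^ 2 := by gcongr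
    _ = (σ0 / (16 * η)) ^ 2 := by rw [mul_inv_cancel₀ (by linarith), one_mul]

/-- The union bound of `runLaw_not_typicalRun_le` with the tail `3 exp (-8 (1 + log d))`, that is,
`3 e⁻⁸ d⁻⁸`, for each event. -/
lemma ScaleBounds.card_mul_exp_le (h : ScaleBounds L q n m d V N a η ε) :
    (6 * n + n * n + 2 * m + 2 * m * n + 1) * (3 * Real.exp (-(8 * (1 + Real.log d))))
      ≤ 1 / (d : ℝ) := by
  have hd : (1 : ℝ) ≤ d := by exact_mod_cast h.hd
  have hm : (1 : ℝ) ≤ m := by exact_mod_cast h.hm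
  have hn : (1 : ℝ) ≤ n := by exact_mod_cast h.hn
  have hmn := h.mul_le_dim
  have hnd : (n : ℝ) ≤ d := by nlinarith
  have hmd : (m : ℝ) ≤ d := by nlinarith
  have h1 : (6 * n + n * n + 2 * m + 2 * m * n + 1 : ℝ) ≤ 12 * d ^ 2 := by nlinarith
  have h2 : Real.exp (-(8 * (1 + Real.log d))) = (Real.exp 1 ^ 8)⁻¹ * ((d : ℝ) ^ 8)⁻¹ := by
    rw [← Real.exp_nat_mul, Real.exp_neg, mul_add, Real.exp_add, mul_inv]
    congr 2
    rw [show (8 : ℝ) * Real.log d = ((8 : ℕ) : ℝ) * Real.log d by norm_num, Real.exp_nat_mul,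
      Real.exp_log (by linarith)]
  have h3 : (36 : ℝ) ≤ Real.exp 1 ^ 8 := by
    have : (2 : ℝ) ≤ Real.exp 1 := by linarith [Real.exp_one_gt_d9]
    calc (36 : ℝ) ≤ 2 ^ 8 := by norm_num
      _ ≤ _ := by gcongr
  rw [h2]
  calc _ ≤ 12 * (d : ℝ) ^ 2 * (3 * ((36 : ℝ)⁻¹ * ((d : ℝ) ^ 8)⁻¹)) := by gcongr
    _ = ((d : ℝ) ^ 6)⁻¹ := by field_simp; norm_num
    _ ≤ 1 / (d : ℝ) := by
        rw [one_div]
        refine inv_anti₀ (by linarith) ?_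
        exact le_self_pow₀ hd (by norm_num)

end Scale

end NoisyCNN

theorem theorem4p10 (q : ℝ) (hq : 2 < q) (C₀ : ℝ) (K₀ : ℕ) :
    ∃ (C : ℝ) (K : ℕ) (C₁ C₂ : ℝ) (K₂ : ℕ), 1 ≤ C ∧
      ∀ (d n m : ℕ) (v : Vec d) (σξ σ0 η ε δ S : ℝ) (T : ℕ),
        v ≠ 0 → 0 < σξ → 0 < σ0 → 0 < η → 0 < ε →
        -- the private noise: privacy failure probability `δ`, sensitivity factor `S` and horizon `T`
        0 < δ → δ < 1 → Real.log (1.25 / δ) ≤ polylog C₀ K₀ d →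
        0 < S → S ≤ polylog C₀ K₀ d →
        (T : ℝ) ≤ polylog C₀ K₀ d * (σ0 * m * n * ε / (η * (‖v‖ + σξ * √(d : ℝ)))) →
        -- the conditions of data noise memorization and the condition on the signal-to-noise ratio
        NoiseMemorizationCondition (polylog C K d) q n m v σξ σ0 η ε →
        polylog C K d ≤ min ((SNR v σξ)⁻¹ * ε) (SNR v σξ ^ (-q) * (n : ℝ)⁻¹) →
        ∃ T₁ : ℕ,
          (T₁ : ℝ) ≤ C₁ * (Real.log (1 / (σ0 * σξ * √(d : ℝ))) * m * n /
            (0.15 ^ (q - 2) * η * q * σ0 ^ (q - 2) * (σξ * √(d : ℝ)) ^ q)) ∧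
          -- the complement of the asserted event has probability at most `1 / d`
          runLaw n m v σξ σ0 (privateNoiseScale S T n m v σξ ε δ)
            {ω | ¬ ∃ (Γ : ℕ → Bool → Fin m → ℝ) (Φ : ℕ → Bool → Fin m → Fin n → ℝ),
              IsUniqueDecomposition v (fun i => (ω.1 i).1.2) η ω.2.2
                (noisyGD q η ω.1 ω.2.1 ω.2.2) Γ Φ ∧
              (∀ i, ∃ j r, 2 ≤ posCoeff (Φ T₁ j r i)) ∧
              (∀ t ≤ T₁, ∀ j r, Γ t j r ≤ polylog C₂ K₂ d * (σ0 * ‖v‖)) ∧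
              (∀ t ≤ T₁, ∀ j r i,
                |negCoeff (Φ t j r i)| ≤ polylog C₂ K₂ d * (σ0 * σξ * √(d : ℝ)))}
            ≤ ENNReal.ofReal (1 / (d : ℝ)) := by
  obtain ⟨C, K, hC, hfactor⟩ := exists_factorLarge hq C₀ K₀
  refine ⟨C, K, timeConst q * q * 0.15 ^ (q - 2), 24, 1, hC, ?_⟩
  intro d n m v σξ σ0 η ε δ S T hv hσξ hσ0 hη hε hδ hδ1 hlogδ hS hSL hT hcond hsnr
  have hq0 : 0 < q := by linarith
  have hd : 0 < d := by
    rcases Nat.eq_zero_or_pos d with rfl | hd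
    · exact absurd (Subsingleton.elim v 0) hv
    · exact hd
  have hd1 : (1 : ℝ) ≤ d := by exact_mod_cast hd
  have hlogd := Real.log_nonneg hd1
  have hL1 : 1 ≤ polylog C K d :=
    one_le_mul_of_one_le_of_one_le hC (one_le_pow₀ (by linarith))
  have hL := hfactor d hd
  have hL₀ : polylog C₀ K₀ d ≤ polylog (|C₀|) K₀ d :=
    mul_le_mul_of_nonneg_right (le_abs_self C₀) (pow_nonneg (by linarith) _)
  have hB := hcond.scaleBounds hq hL1 hv hσξ hσ0 hε (hsnr.trans (min_le_right _ _))
  have hsd : 0 < √(d : ℝ) := Real.sqrt_pos.2 (by linarith)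
  have hV : 0 < ‖v‖ := norm_pos_iff.2 hv
  set N := σξ * √(d : ℝ) with hN
  have hN0 : 0 < N := by positivity
  have ha : 0 < σ0 * N := by positivity
  have hκ := growthRate_pos hq0 hη hN0 ha hB.hn hB.hm
  have hlog0 : 0 ≤ Real.log (1 / (σ0 * N)) := by
    refine Real.log_nonneg ((one_le_div ha).2 ?_)
    calc σ0 * N ≤ σ0 * N * polylog C K d := le_mul_of_one_le_right ha.le hL1
      _ ≤ 1 := hB.init_upper
  -- The training time is the time after which the exponential growth has certainly reached `2`.
  set X := 8 * Real.log (1 / (σ0 * N)) / growthRate q η N (σ0 * N) n m with hX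
  have hX0 : 0 ≤ X := by positivity
  have hT1 : ⌊X⌋₊ * growthRate q η N (σ0 * N) n m ≤ 8 * Real.log (1 / (σ0 * N)) :=
    (le_div_iff₀ hκ).1 (Nat.floor_le hX0)
  have hT2 : 8 * Real.log (1 / (σ0 * N)) ≤ (⌊X⌋₊ + 1) * growthRate q η N (σ0 * N) n m :=
    (div_le_iff₀ hκ).1 (Nat.lt_floor_add_one X).le
  have hassoc : σ0 * σξ * √(d : ℝ) = σ0 * N := by rw [hN]; ring
  have hR := hB.regime hL hq hη hV hN0 ha hT1 hT2
  rw [show σ0 * N * (‖v‖ / N) = σ0 * ‖v‖ by field_simp] at hR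
  have hn0 : (0 : ℝ) < n := by exact_mod_cast hB.hn
  have hm0 : (0 : ℝ) < m := by exact_mod_cast hB.hm
  refine ⟨⌊X⌋₊, ?_, ?_⟩
  · refine (Nat.floor_le hX0).trans (le_of_eq ?_)
    have hg := gate_pos (1 + 3 ^ q)
    have h1 : N ^ q = N ^ (q - 2) * N ^ 2 := by
      rw [← Real.rpow_natCast N 2, ← Real.rpow_add hN0]; norm_num
    have h2 : (0 : ℝ) < 4 ^ (q - 2) := by positivity
    have h3 : (0 : ℝ) < 0.15 ^ (q - 2) := by positivity
    rw [hX, hassoc, growthRate, timeConst, h1, Real.div_rpow ha.le (by norm_num),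
      Real.mul_rpow hσ0.le hN0.le]
    field_simp
    ring
  · have hprob := runLaw_not_typicalRun_le (n := n) (m := m) (T := ⌊X⌋₊)
      (p := 3 * Real.exp (-(8 * (1 + Real.log d)))) (t := 4 * (1 + Real.log d)) hd hv hσξ hσ0 hη
      (by positivity)
      (hB.private_noise_le hL hq hη hσξ hσ0 hε hδ hδ1 (hlogδ.trans hL₀) hS (hSL.trans hL₀)
        (hT.trans (mul_le_mul_of_nonneg_right hL₀ (by positivity))) hT1) ?_ ?_ ?_
    · refine le_trans (measure_mono ?_) (hprob.trans (ENNReal.ofReal_le_ofReal hB.card_mul_exp_le))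
      intro ω hω hty
      refine hω ?_
      rw [← hN, show 2 * (4 * (1 + Real.log d)) = 8 * (1 + Real.log d) by ring] at hty
      obtain ⟨Γ, Φ, h1, h2, h3, h4⟩ := hty.exists_coeff hR hv
      refine ⟨Γ, Φ, h1, h2, fun t ht j r => (h3 t ht j r).trans ?_,
        fun t ht j r i => (h4 t ht j r i).trans ?_⟩
      · have : 0 ≤ (1 + Real.log d) * (σ0 * ‖v‖) := by positivity
        rw [polylog, pow_one]
        linarith
      · rw [polylog, pow_one, hassoc]
        linarith
    · have h1 := hL.log_le.trans hB.dim_large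
      have h2 : Real.exp (-(d / 16)) ≤ Real.exp (-(8 * (1 + Real.log d))) :=
        Real.exp_le_exp.2 (by linarith)
      linarith
    · have h2 : Real.exp (-(4 * (1 + Real.log d)) ^ 2 / 2) ≤ Real.exp (-(8 * (1 + Real.log d))) :=
        Real.exp_le_exp.2 (by nlinarith)
      linarith [Real.exp_pos (-(8 * (1 + Real.log d)))]
    · have h1 := hL.tail_le.trans hB.width_large
      rw [div_le_iff₀ gaussianTail_pos] at h1
      have h2 : Real.exp (-(gaussianTail * m)) ≤ Real.exp (-(8 * (1 + Real.log d))) :=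
        Real.exp_le_exp.2 (by linarith)
      linarith [Real.exp_pos (-(8 * (1 + Real.log d)))]
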